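/- Let $\mathcal K$ be an equipment, that is a (pseudo) double category, with strict vertical and weak horizontal composition, that has all restrictions $K(f,g)$ of horizontal morphisms (cartesian cells). Vertical morphisms are written $f\colon A\to C$, horizontal morphisms $J\colon A\nrightarrow B$, horizontal composition $\odot$ is in diagrammatic order, and $1_A$ is the horizontal unit of $A$. Let $f_*\colon A\nrightarrow C$ and $f^*\colon C\nrightarrow A$ denote the companion $1_C(f,\mathrm{id})$ and the conjoint $1_C(\mathrm{id},f)$ of $f\colon A\to C$. Vertical cells (cells whose horizontal source and target are units) are the 2-cells of the vertical 2-category $V(\mathcal K)$; $f$ is full and faithful if its unit cell $1_f$ is cartesian. A horizontal cell is a cell whose vertical source and target are identities. A cell $\eta\colon J\Rightarrow 1_M$ with $J\colon A\nrightarrow B$, left boundary $d\colon A\to M$ and right boundary $l\colon B\to M$ defines $l$ as the left Kan extension of $d$ along $J$ if every cell $J\Rightarrow 1_M$ with left boundary $d$ and arbitrary right boundary $k\colon B\to M$ is of the form $\eta\odot\psi$ (modulo unit isomorphisms) for a unique vertical cell $\psi\colon l\Rightarrow k$. It defines $l$ as the pointwise left Kan extension if, for every $H\colon B\nrightarrow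 C$ and $k\colon C\to M$, every cell $J\odot H\Rightarrow 1_M$ with boundaries $d$ and $k$ is of the form $\eta\odot\psi$ for a unique cell $\psi\colon H\Rightarrow 1_M$ with boundaries $l$ and $k$. Let $T=(T,\mu,\iota)$ be a normal lax double monad on $\mathcal K$ (a lax double functor $T$ whose unitor cells $1_{TA}\Rightarrow T1_A$ are identities, with double transformations $\mu\colon T^2\to T$ and $\iota\colon\mathrm{id}\to T$ satisfying the monad axioms), and assume that the 2-monad to which it restricts on $V(\mathcal K)$ is colax-idempotent: every $f\colon A\to C$ between strict algebras $(A,a)$ and $(C,c)$ admits a unique vertical cell $f\circ a\Rightarrow c\circ Tf$ making it a colax $T$-morphism. For $J\colon A\nrightarrow B$ say that $\iota_J$ satisfies the right Beck–Chevalley condition if the horizontal cell $\iota_{J*}\colon J\odot\iota_{B*}\Rightarrow\iota_{A*}\odot TJ$, the horizontal composite of the opcartesian cell defining $\iota_{A*}$, the cell $\iota_J$, and the cartesian cell defining $\iota_{B*}$, is invertible. **Theorem.** Let $j\colon A\to B$, $d\colon A\to M$ and $l\colon B\to M$ be vertical morphisms and let the cell $\eta\colon j_*\Rightarrow 1_M$,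 with left boundary $d$ and right boundary $l$, define $l$ as the pointwise left Kan extension of $d$ along $j_*$. Let $B$ and $M$ carry pseudo $T$-algebra structures $(b,\bar b,\hat b)$ and $(m,\bar m,\hat m)$. Then there is a unique vertical cell $\bar l\colon l\circ b\Rightarrow m\circ Tl$ that makes $l$ into a colax $T$-morphism, and: 1. $\bar l$ is invertible whenever $\iota_{d^*}$ satisfies the right Beck–Chevalley condition and the composite $1_m\circ T\eta\colon Tj_*\Rightarrow 1_M$ defines $m\circ Tl$ as the left Kan extension of $m\circ Td$ along $Tj_*$. 2. Conversely, if $j$ is full and faithful, $\iota_{j^*}$ satisfies the right Beck–Chevalley condition and $\bar l$ is invertible, then $\iota_{d^*}$ satisfies the right Beck–Chevalley condition and $1_m\circ T\eta$ defines $m\circ Tl$ as the left Kan extension of $m\circ Td$ along $Tj_*$. -/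

import Mathlib

open CategoryTheory

universe v u w z v' u' w' z'

/-- A (pseudo) double category: vertical morphisms are the morphisms of a category, and their
composition is strictly associative and unital, as is the vertical composition of cells;
horizontal composition is associative and unital up to coherent invertible horizontal cells.

`Cell f g J H` is the type of cells with left vertical boundary `f`, right vertical boundary `g`,
top `J` and bottom `H`. To compose cells vertically one also provides proofs of what the composite
vertical boundaries are, so that the strict laws are plain equations between cells. -/
class DoubleCategory (K : Type u) extends Category.{v} K where
  /-- Horizontal morphisms. -/
  Hor : K → K → Type w
  /-- Cells. -/
  Cell : {A B C D : K} → (A ⟶ C) → (B ⟶ D) → Hor A B → Hor C D → Type z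
  /-- Vertical identity cells. -/
  vid : {A B : K} → (J : Hor A B) → Cell (𝟙 A) (𝟙 B) J J
  /-- Vertical composition of cells (the first argument on top). -/
  vcomp : {A B C D E F : K} → {f : A ⟶ C} → {g : B ⟶ D} → {h : C ⟶ E} → {k : D ⟶ F} →
    {p : A ⟶ E} → {q : B ⟶ F} → {J : Hor A B} → {H : Hor C D} → {L : Hor E F} →
    f ≫ h = p → g ≫ k = q → Cell f g J H → Cell h k H L → Cell p q J L
  vid_vcomp : ∀ {A B C D : K} {f : A ⟶ C} {g : B ⟶ D} {J : Hor A B} {H : Hor C D}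
    (φ : Cell f g J H), vcomp (Category.id_comp f) (Category.id_comp g) (vid J) φ = φ
  vcomp_vid : ∀ {A B C D : K} {f : A ⟶ C} {g : B ⟶ D} {J : Hor A B} {H : Hor C D}
    (φ : Cell f g J H), vcomp (Category.comp_id f) (Category.comp_id g) φ (vid H) = φ
  vcomp_assoc : ∀ {A B C D E F G I : K} {f : A ⟶ C} {g : B ⟶ D} {h : C ⟶ E} {k : D ⟶ F}
    {m : E ⟶ G} {n : F ⟶ I} {p : A ⟶ E} {q : B ⟶ F} {r : C ⟶ G} {s : D ⟶ I}
    {x : A ⟶ G} {y : B ⟶ I} {J : Hor A B} {H : Hor C D} {L : Hor E F} {P : Hor G I}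
    (e₁ : f ≫ h = p) (e₂ : g ≫ k = q) (e₃ : p ≫ m = x) (e₄ : q ≫ n = y)
    (e₅ : h ≫ m = r) (e₆ : k ≫ n = s) (e₇ : f ≫ r = x) (e₈ : g ≫ s = y)
    (φ : Cell f g J H) (ψ : Cell h k H L) (χ : Cell m n L P),
    vcomp e₃ e₄ (vcomp e₁ e₂ φ ψ) χ = vcomp e₇ e₈ φ (vcomp e₅ e₆ ψ χ)
  /-- Horizontal units. -/
  unit : (A : K) → Hor A A
  /-- The unit cell of a vertical morphism. -/
  unitCell : {A C : K} → (f : A ⟶ C) → Cell f f (unit A) (unit C)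
  unitCell_id : ∀ A : K, unitCell (𝟙 A) = vid (unit A)
  unitCell_comp : ∀ {A C E : K} (f : A ⟶ C) (h : C ⟶ E),
    unitCell (f ≫ h) = vcomp rfl rfl (unitCell f) (unitCell h)
  /-- Horizontal composition of horizontal morphisms, in diagrammatic order. -/
  hcomp : {A B E : K} → Hor A B → Hor B E → Hor A E
  /-- Horizontal composition of cells, in diagrammatic order. -/
  hcompCell : {A B E C D F : K} → {f : A ⟶ C} → {g : B ⟶ D} → {h : E ⟶ F} →
    {J : Hor A B} → {H : Hor B E} → {L : Hor C D} → {P : Hor D F} →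
    Cell f g J L → Cell g h H P → Cell f h (hcomp J H) (hcomp L P)
  hcompCell_vid : ∀ {A B E : K} (J : Hor A B) (H : Hor B E),
    hcompCell (vid J) (vid H) = vid (hcomp J H)
  hcompCell_vcomp : ∀ {A B C D E F G I N : K} {f : A ⟶ D} {g : B ⟶ E} {h : C ⟶ F}
    {f' : D ⟶ G} {g' : E ⟶ I} {h' : F ⟶ N} {p : A ⟶ G} {q : B ⟶ I} {r : C ⟶ N}
    {J : Hor A B} {J' : Hor B C} {H : Hor D E} {H' : Hor E F} {L : Hor G I} {L' : Hor I N}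
    (e₁ : f ≫ f' = p) (e₂ : g ≫ g' = q) (e₃ : h ≫ h' = r)
    (φ : Cell f g J H) (φ' : Cell g h J' H') (ψ : Cell f' g' H L) (ψ' : Cell g' h' H' L'),
    hcompCell (vcomp e₁ e₂ φ ψ) (vcomp e₂ e₃ φ' ψ') =
      vcomp e₁ e₃ (hcompCell φ φ') (hcompCell ψ ψ')
  /-- Associators. -/
  associator : {A B C D : K} → (J : Hor A B) → (H : Hor B C) → (L : Hor C D) →
    Cell (𝟙 A) (𝟙 D) (hcomp (hcomp J H) L) (hcomp J (hcomp H L))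
  associatorInv : {A B C D : K} → (J : Hor A B) → (H : Hor B C) → (L : Hor C D) →
    Cell (𝟙 A) (𝟙 D) (hcomp J (hcomp H L)) (hcomp (hcomp J H) L)
  associator_associatorInv : ∀ {A B C D : K} (J : Hor A B) (H : Hor B C) (L : Hor C D),
    vcomp (Category.id_comp _) (Category.id_comp _) (associator J H L) (associatorInv J H L) = vid _
  associatorInv_associator : ∀ {A B C D : K} (J : Hor A B) (H : Hor B C) (L : Hor C D),
    vcomp (Category.id_comp _) (Category.id_comp _) (associatorInv J H L) (associator J H L) = vid _
  associator_naturality : ∀ {A B C D A' B' C' D' : K}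
    {f : A ⟶ A'} {g : B ⟶ B'} {h : C ⟶ C'} {k : D ⟶ D'}
    {J : Hor A B} {H : Hor B C} {L : Hor C D} {J' : Hor A' B'} {H' : Hor B' C'} {L' : Hor C' D'}
    (φ : Cell f g J J') (ψ : Cell g h H H') (χ : Cell h k L L'),
    vcomp (Category.comp_id f) (Category.comp_id k) (hcompCell (hcompCell φ ψ) χ)
        (associator J' H' L') =
      vcomp (Category.id_comp f) (Category.id_comp k) (associator J H L)
        (hcompCell φ (hcompCell ψ χ))
  /-- Left unitors. -/
  leftUnitor : {A B : K} → (J : Hor A B) → Cell (𝟙 A) (𝟙 B) (hcomp (unit A) J) J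
  leftUnitorInv : {A B : K} → (J : Hor A B) → Cell (𝟙 A) (𝟙 B) J (hcomp (unit A) J)
  leftUnitor_leftUnitorInv : ∀ {A B : K} (J : Hor A B),
    vcomp (Category.id_comp _) (Category.id_comp _) (leftUnitor J) (leftUnitorInv J) = vid _
  leftUnitorInv_leftUnitor : ∀ {A B : K} (J : Hor A B),
    vcomp (Category.id_comp _) (Category.id_comp _) (leftUnitorInv J) (leftUnitor J) = vid _
  leftUnitor_naturality : ∀ {A B C D : K} {f : A ⟶ C} {g : B ⟶ D} {J : Hor A B} {H : Hor C D}
    (φ : Cell f g J H),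
    vcomp (Category.comp_id f) (Category.comp_id g) (hcompCell (unitCell f) φ) (leftUnitor H) =
      vcomp (Category.id_comp f) (Category.id_comp g) (leftUnitor J) φ
  /-- Right unitors. -/
  rightUnitor : {A B : K} → (J : Hor A B) → Cell (𝟙 A) (𝟙 B) (hcomp J (unit B)) J
  rightUnitorInv : {A B : K} → (J : Hor A B) → Cell (𝟙 A) (𝟙 B) J (hcomp J (unit B))
  rightUnitor_rightUnitorInv : ∀ {A B : K} (J : Hor A B),
    vcomp (Category.id_comp _) (Category.id_comp _) (rightUnitor J) (rightUnitorInv J) = vid _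
  rightUnitorInv_rightUnitor : ∀ {A B : K} (J : Hor A B),
    vcomp (Category.id_comp _) (Category.id_comp _) (rightUnitorInv J) (rightUnitor J) = vid _
  rightUnitor_naturality : ∀ {A B C D : K} {f : A ⟶ C} {g : B ⟶ D} {J : Hor A B} {H : Hor C D}
    (φ : Cell f g J H),
    vcomp (Category.comp_id f) (Category.comp_id g) (hcompCell φ (unitCell g)) (rightUnitor H) =
      vcomp (Category.id_comp f) (Category.id_comp g) (rightUnitor J) φ
  pentagon : ∀ {A B C D E : K} (J : Hor A B) (H : Hor B C) (L : Hor C D) (P : Hor D E),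
    vcomp (Category.id_comp _) (Category.id_comp _)
        (hcompCell (associator J H L) (vid P))
        (vcomp (Category.id_comp _) (Category.id_comp _) (associator J (hcomp H L) P)
          (hcompCell (vid J) (associator H L P))) =
      vcomp (Category.id_comp _) (Category.id_comp _)
        (associator (hcomp J H) L P) (associator J H (hcomp L P))
  triangle : ∀ {A B C : K} (J : Hor A B) (H : Hor B C),
    vcomp (Category.id_comp _) (Category.id_comp _) (associator J (unit B) H)
        (hcompCell (vid J) (leftUnitor H)) =
      hcompCell (rightUnitor J) (vid H)

namespace DoubleCategory

section Basic

variable {K : Type u} [DoubleCategory.{v, u, w, z} K]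

/-- Horizontal cells: both vertical boundaries are identities. -/
abbrev HCell {A B : K} (J H : Hor A B) := Cell (𝟙 A) (𝟙 B) J H

/-- Vertical composition of horizontal cells. -/
def HCell.comp {A B : K} {J H L : Hor A B} (φ : HCell J H) (ψ : HCell H L) : HCell J L :=
  vcomp (Category.id_comp _) (Category.id_comp _) φ ψ

/-- The composite of a cell with a horizontal cell on top of it. -/
def onTop {A B C D : K} {f : A ⟶ C} {g : B ⟶ D} {J J' : Hor A B} {H : Hor C D}
    (φ : HCell J' J) (ψ : Cell f g J H) : Cell f g J' H :=
  vcomp (Category.id_comp _) (Category.id_comp _) φ ψ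

/-- The composite of a cell with a horizontal cell below it. -/
def below {A B C D : K} {f : A ⟶ C} {g : B ⟶ D} {J : Hor A B} {H H' : Hor C D}
    (φ : Cell f g J H) (ψ : HCell H H') : Cell f g J H' :=
  vcomp (Category.comp_id _) (Category.comp_id _) φ ψ

/-- A horizontal cell is invertible if it has an inverse for vertical composition. -/
def HCell.IsInvertible {A B : K} {J H : Hor A B} (φ : HCell J H) : Prop :=
  ∃ ψ : HCell H J, φ.comp ψ = vid J ∧ ψ.comp φ = vid H

/-- The identity cell between equal horizontal morphisms. -/
def idHCell {A B : K} {J H : Hor A B} (e : J = H) : HCell J H := e ▸ vid J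

/-- Transport of a cell along equalities of its vertical boundaries. -/
def recast {A B C D : K} {f f' : A ⟶ C} {g g' : B ⟶ D} {J : Hor A B} {H : Hor C D}
    (e₁ : f = f') (e₂ : g = g') (φ : Cell f g J H) : Cell f' g' J H :=
  e₁ ▸ e₂ ▸ φ

/-- Vertical cells `f ⇒ g`: cells whose horizontal boundaries are units. These are the 2-cells of
the vertical 2-category of `K`. -/
abbrev VCell {A C : K} (f g : A ⟶ C) := Cell f g (unit A) (unit C)

/-- The composite `f ⇒ g ⇒ h` of vertical cells, that is their horizontal composite. -/
def VCell.comp {A C : K} {f g h : A ⟶ C} (φ : VCell f g) (ψ : VCell g h) : VCell f h :=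
  onTop (leftUnitorInv (unit A)) (below (hcompCell φ ψ) (leftUnitor (unit C)))

/-- The identity vertical cell between equal vertical morphisms. -/
def idVCell {A C : K} {f g : A ⟶ C} (e : f = g) : VCell f g := recast rfl e (unitCell f)

/-- A vertical cell is invertible if it is so in the vertical 2-category. -/
def VCell.IsInvertible {A C : K} {f g : A ⟶ C} (φ : VCell f g) : Prop :=
  ∃ ψ : VCell g f, φ.comp ψ = unitCell f ∧ ψ.comp φ = unitCell g

/-- Whiskering with a vertical morphism on the source side. -/
def preWhisker {A C E : K} (f : A ⟶ C) {g h : C ⟶ E} (φ : VCell g h) :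
    VCell (f ≫ g) (f ≫ h) :=
  vcomp rfl rfl (unitCell f) φ

/-- Whiskering with a vertical morphism on the target side. -/
def postWhisker {A C E : K} {f g : A ⟶ C} (φ : VCell f g) (h : C ⟶ E) :
    VCell (f ≫ h) (g ≫ h) :=
  vcomp rfl rfl φ (unitCell h)

/-- Cartesian cells: every cell into the same bottom, with vertical boundaries that factor through
those of `φ`, factors uniquely through `φ`. -/
def IsCartesian {A B C D : K} {f : A ⟶ C} {g : B ⟶ D} {J : Hor A B} {H : Hor C D}
    (φ : Cell f g J H) : Prop :=
  ∀ ⦃X Y : K⦄ (h : X ⟶ A) (k : Y ⟶ B) (p : X ⟶ C) (q : Y ⟶ D) (e₁ : h ≫ f = p) (e₂ : k ≫ g = q)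
    (L : Hor X Y) (χ : Cell p q L H), ∃! ψ : Cell h k L J, vcomp e₁ e₂ ψ φ = χ

/-- A companion of `f : A ⟶ C`: a restriction of the unit of `C` along `f` and `𝟙 C`. -/
structure Companion {A C : K} (f : A ⟶ C) where
  hor : Hor A C
  cart : Cell f (𝟙 C) hor (unit C)
  isCartesian : IsCartesian cart

/-- A conjoint of `f : A ⟶ C`: a restriction of the unit of `C` along `𝟙 C` and `f`. -/
structure Conjoint {A C : K} (f : A ⟶ C) where
  hor : Hor C A
  cart : Cell (𝟙 C) f hor (unit C)
  isCartesian : IsCartesian cart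

/-- The opcartesian cell corresponding to the cartesian cell that defines a companion of `f`: the
factorisation of the unit cell of `f` through the latter. -/
noncomputable def Companion.opcart {A C : K} {f : A ⟶ C} (P : Companion f) :
    Cell (𝟙 A) f (unit A) P.hor :=
  (P.isCartesian (𝟙 A) f f f (Category.id_comp f) (Category.comp_id f)
    (unit A) (unitCell f)).choose

variable (K) in
/-- An equipment is a double category with all restrictions. -/
def IsEquipment : Prop :=
  ∀ ⦃A B C D : K⦄ (f : A ⟶ C) (g : B ⟶ D) (H : Hor C D),
    ∃ (J : Hor A B) (φ : Cell f g J H), IsCartesian φ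

/-- A vertical morphism is full and faithful if its unit cell is cartesian. -/
def IsFullFaithful {A C : K} (f : A ⟶ C) : Prop := IsCartesian (unitCell f)

/-- The cell `η` defines `l` as the left Kan extension of `d` along `J`. -/
def IsLeftKan {A B M : K} {d : A ⟶ M} {l : B ⟶ M} {J : Hor A B} (η : Cell d l J (unit M)) :
    Prop :=
  ∀ (k : B ⟶ M) (φ : Cell d k J (unit M)), ∃! ψ : VCell l k,
    onTop (rightUnitorInv J) (below (hcompCell η ψ) (leftUnitor (unit M))) = φ

/-- The cell `η` defines `l` as the pointwise left Kan extension of `d` along `J`. -/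
def IsPointwiseLeftKan {A B M : K} {d : A ⟶ M} {l : B ⟶ M} {J : Hor A B}
    (η : Cell d l J (unit M)) : Prop :=
  ∀ ⦃C : K⦄ (H : Hor B C) (k : C ⟶ M) (φ : Cell d k (hcomp J H) (unit M)),
    ∃! ψ : Cell l k H (unit M), below (hcompCell η ψ) (leftUnitor (unit M)) = φ

end Basic

/-- Lax double functors. -/
structure LaxDoubleFunctor (K : Type u) [DoubleCategory.{v, u, w, z} K]
    (L : Type u') [DoubleCategory.{v', u', w', z'} L] extends K ⥤ L where
  mapHor : {A B : K} → Hor A B → Hor (obj A) (obj B)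
  mapCell : {A B C D : K} → {f : A ⟶ C} → {g : B ⟶ D} → {J : Hor A B} → {H : Hor C D} →
    Cell f g J H → Cell (map f) (map g) (mapHor J) (mapHor H)
  mapCell_vid : ∀ {A B : K} (J : Hor A B),
    mapCell (vid J) = recast (map_id A).symm (map_id B).symm (vid (mapHor J))
  mapCell_vcomp : ∀ {A B C D E F : K} {f : A ⟶ C} {g : B ⟶ D} {h : C ⟶ E} {k : D ⟶ F}
    {p : A ⟶ E} {q : B ⟶ F} {J : Hor A B} {H : Hor C D} {P : Hor E F}
    (e₁ : f ≫ h = p) (e₂ : g ≫ k = q) (φ : Cell f g J H) (ψ : Cell h k H P),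
    mapCell (vcomp e₁ e₂ φ ψ) =
      vcomp ((map_comp f h).symm.trans (congrArg map e₁))
        ((map_comp g k).symm.trans (congrArg map e₂)) (mapCell φ) (mapCell ψ)
  /-- The unitor cells. -/
  unitor : (A : K) → HCell (unit (obj A)) (mapHor (unit A))
  unitor_naturality : ∀ {A C : K} (f : A ⟶ C),
    below (unitCell (map f)) (unitor C) = onTop (unitor A) (mapCell (unitCell f))
  /-- The compositor cells. -/
  compositor : {A B C : K} → (J : Hor A B) → (H : Hor B C) →
    HCell (hcomp (mapHor J) (mapHor H)) (mapHor (hcomp J H))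
  compositor_naturality : ∀ {A B E C D F : K} {f : A ⟶ C} {g : B ⟶ D} {h : E ⟶ F}
    {J : Hor A B} {H : Hor B E} {P : Hor C D} {Q : Hor D F}
    (φ : Cell f g J P) (ψ : Cell g h H Q),
    below (hcompCell (mapCell φ) (mapCell ψ)) (compositor P Q) =
      onTop (compositor J H) (mapCell (hcompCell φ ψ))
  associativity : ∀ {A B C D : K} (J : Hor A B) (H : Hor B C) (P : Hor C D),
    (HCell.comp (hcompCell (compositor J H) (vid (mapHor P))) (compositor (hcomp J H) P)).comp
        (recast (map_id A) (map_id D) (mapCell (associator J H P))) =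
      HCell.comp (associator (mapHor J) (mapHor H) (mapHor P))
        (HCell.comp (hcompCell (vid (mapHor J)) (compositor H P)) (compositor J (hcomp H P)))
  left_unitality : ∀ {A B : K} (J : Hor A B),
    (HCell.comp (hcompCell (unitor A) (vid (mapHor J))) (compositor (unit A) J)).comp
        (recast (map_id A) (map_id B) (mapCell (leftUnitor J))) =
      leftUnitor (mapHor J)
  right_unitality : ∀ {A B : K} (J : Hor A B),
    (HCell.comp (hcompCell (vid (mapHor J)) (unitor B)) (compositor J (unit B))).comp
        (recast (map_id A) (map_id B) (mapCell (rightUnitor J))) =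
      rightUnitor (mapHor J)

section Recast

variable {K : Type u} [DoubleCategory.{v, u, w, z} K]

theorem recast_rfl {A B C D : K} {f : A ⟶ C} {g : B ⟶ D} {J : Hor A B} {H : Hor C D}
    (e₁ : f = f) (e₂ : g = g) (φ : Cell f g J H) : recast e₁ e₂ φ = φ := rfl

theorem recast_recast {A B C D : K} {f f' f'' : A ⟶ C} {g g' g'' : B ⟶ D} {J : Hor A B}
    {H : Hor C D} (e₁ : f = f') (e₂ : g = g') (e₃ : f' = f'') (e₄ : g' = g'')
    (φ : Cell f g J H) :
    recast e₃ e₄ (recast e₁ e₂ φ) = recast (e₁.trans e₃) (e₂.trans e₄) φ := by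
  subst e₁ e₂ e₃ e₄; rfl

theorem recast_vcomp {A B C D E F : K} {f : A ⟶ C} {g : B ⟶ D} {h : C ⟶ E} {k : D ⟶ F}
    {p p' : A ⟶ E} {q q' : B ⟶ F} {J : Hor A B} {H : Hor C D} {L : Hor E F}
    (e₁ : f ≫ h = p) (e₂ : g ≫ k = q) (e₃ : p = p') (e₄ : q = q')
    (φ : Cell f g J H) (ψ : Cell h k H L) :
    recast e₃ e₄ (vcomp e₁ e₂ φ ψ) = vcomp (e₁.trans e₃) (e₂.trans e₄) φ ψ := by
  subst e₃ e₄; rfl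

theorem vcomp_recast_left {A B C D E F : K} {f f' : A ⟶ C} {g g' : B ⟶ D} {h : C ⟶ E}
    {k : D ⟶ F} {p : A ⟶ E} {q : B ⟶ F} {J : Hor A B} {H : Hor C D} {L : Hor E F}
    (e₁ : f' ≫ h = p) (e₂ : g' ≫ k = q) (e₃ : f = f') (e₄ : g = g')
    (φ : Cell f g J H) (ψ : Cell h k H L) :
    vcomp e₁ e₂ (recast e₃ e₄ φ) ψ =
      vcomp ((congrArg (· ≫ h) e₃).trans e₁) ((congrArg (· ≫ k) e₄).trans e₂) φ ψ := by
  subst e₃ e₄; rfl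

theorem vcomp_recast_right {A B C D E F : K} {f : A ⟶ C} {g : B ⟶ D} {h h' : C ⟶ E}
    {k k' : D ⟶ F} {p : A ⟶ E} {q : B ⟶ F} {J : Hor A B} {H : Hor C D} {L : Hor E F}
    (e₁ : f ≫ h' = p) (e₂ : g ≫ k' = q) (e₃ : h = h') (e₄ : k = k')
    (φ : Cell f g J H) (ψ : Cell h k H L) :
    vcomp e₁ e₂ φ (recast e₃ e₄ ψ) =
      vcomp ((congrArg (f ≫ ·) e₃).trans e₁) ((congrArg (g ≫ ·) e₄).trans e₂) φ ψ := by
  subst e₃ e₄; rfl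

theorem hcompCell_recast {A B E C D F : K} {f f' : A ⟶ C} {g g' : B ⟶ D} {h h' : E ⟶ F}
    {J : Hor A B} {H : Hor B E} {L : Hor C D} {P : Hor D F}
    (e₁ : f = f') (e₂ : g = g') (e₃ : h = h') (φ : Cell f g J L) (ψ : Cell g h H P) :
    hcompCell (recast e₁ e₂ φ) (recast e₂ e₃ ψ) = recast e₁ e₃ (hcompCell φ ψ) := by
  subst e₁ e₂ e₃; rfl

/-- The horizontal morphisms as the objects of a category, with vertical composition. -/
structure HorObj (K : Type u) [DoubleCategory.{v, u, w, z} K] where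
  {src tgt : K}
  hor : Hor src tgt

/-- Arbitrary cells between two given horizontal morphisms. -/
structure HorHom (X Y : HorObj K) where
  {left : X.src ⟶ Y.src}
  {right : X.tgt ⟶ Y.tgt}
  cell : Cell left right X.hor Y.hor

theorem horHom_vcomp {A B C D E F : K} {f : A ⟶ C} {g : B ⟶ D} {h : C ⟶ E} {k : D ⟶ F}
    {p : A ⟶ E} {q : B ⟶ F} {J : Hor A B} {H : Hor C D} {L : Hor E F}
    (e₁ : f ≫ h = p) (e₂ : g ≫ k = q) (φ : Cell f g J H) (ψ : Cell h k H L) :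
    (⟨vcomp rfl rfl φ ψ⟩ : HorHom ⟨J⟩ ⟨L⟩) = ⟨vcomp e₁ e₂ φ ψ⟩ := by
  subst e₁ e₂; rfl

instance : Category (HorObj K) where
  Hom X Y := HorHom X Y
  id X := ⟨vid X.hor⟩
  comp φ ψ := ⟨vcomp rfl rfl φ.cell ψ.cell⟩
  id_comp φ :=
    (horHom_vcomp (Category.id_comp _) (Category.id_comp _) _ _).trans
      (congrArg HorHom.mk (vid_vcomp φ.cell))
  comp_id φ :=
    (horHom_vcomp (Category.comp_id _) (Category.comp_id _) _ _).trans
      (congrArg HorHom.mk (vcomp_vid φ.cell))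
  assoc _ _ _ :=
    (horHom_vcomp (Category.assoc _ _ _) (Category.assoc _ _ _) _ _).trans
      (congrArg HorHom.mk (vcomp_assoc ..))

/-- A cell as a morphism of the category of horizontal morphisms. -/
def toHom {A B C D : K} {f : A ⟶ C} {g : B ⟶ D} {J : Hor A B} {H : Hor C D}
    (φ : Cell f g J H) : HorObj.mk J ⟶ HorObj.mk H :=
  HorHom.mk φ

theorem toHom_injective {A B C D : K} {f : A ⟶ C} {g : B ⟶ D} {J : Hor A B} {H : Hor C D}
    {φ ψ : Cell f g J H} (e : toHom φ = toHom ψ) : φ = ψ :=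
  eq_of_heq (HorHom.mk.inj e).2.2

theorem toHom_vid {A B : K} (J : Hor A B) : toHom (vid J) = 𝟙 (HorObj.mk J) := rfl

theorem toHom_vcomp {A B C D E F : K} {f : A ⟶ C} {g : B ⟶ D} {h : C ⟶ E} {k : D ⟶ F}
    {p : A ⟶ E} {q : B ⟶ F} {J : Hor A B} {H : Hor C D} {L : Hor E F}
    (e₁ : f ≫ h = p) (e₂ : g ≫ k = q) (φ : Cell f g J H) (ψ : Cell h k H L) :
    toHom (vcomp e₁ e₂ φ ψ) = toHom φ ≫ toHom ψ :=
  (horHom_vcomp e₁ e₂ φ ψ).symm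

theorem toHom_recast {A B C D : K} {f f' : A ⟶ C} {g g' : B ⟶ D} {J : Hor A B} {H : Hor C D}
    (e₁ : f = f') (e₂ : g = g') (φ : Cell f g J H) : toHom (recast e₁ e₂ φ) = toHom φ := by
  subst e₁ e₂; rfl

end Recast

namespace LaxDoubleFunctor

variable {K : Type u} [DoubleCategory.{v, u, w, z} K]
variable {L : Type u'} [DoubleCategory.{v', u', w', z'} L]

theorem mapCell_recast (F : LaxDoubleFunctor K L) {A B C D : K} {f f' : A ⟶ C} {g g' : B ⟶ D}
    {J : Hor A B} {H : Hor C D} (e₁ : f = f') (e₂ : g = g') (φ : Cell f g J H) :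
    F.mapCell (recast e₁ e₂ φ) =
      recast (congrArg F.map e₁) (congrArg F.map e₂) (F.mapCell φ) := by
  subst e₁ e₂; rfl

variable (K) in
/-- The identity double functor. -/
def id : LaxDoubleFunctor K K where
  toFunctor := 𝟭 K
  mapHor J := J
  mapCell φ := φ
  mapCell_vid _ := rfl
  mapCell_vcomp _ _ _ _ := rfl
  unitor A := vid (unit A)
  unitor_naturality f := by
    simp only [below, onTop]; exact (vcomp_vid _).trans (vid_vcomp _).symm
  compositor J H := vid (hcomp J H)
  compositor_naturality φ ψ := by
    simp only [below, onTop]; exact (vcomp_vid _).trans (vid_vcomp _).symm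
  associativity J H P := by
    simp only [HCell.comp, hcompCell_vid]
    rw [vid_vcomp, vid_vcomp, vid_vcomp, vcomp_vid]; rfl
  left_unitality J := by
    simp only [HCell.comp]; rw [vcomp_vid]
    erw [hcompCell_vid, vid_vcomp]; rfl
  right_unitality J := by
    simp only [HCell.comp]; rw [vcomp_vid]
    erw [hcompCell_vid, vid_vcomp]; rfl

theorem toHom_mapCell_comp (F : LaxDoubleFunctor K L) {A B : K} {J H P : Hor A B}
    (φ : HCell J H) (ψ : HCell H P) :
    toHom (F.mapCell (φ.comp ψ)) = toHom (F.mapCell φ) ≫ toHom (F.mapCell ψ) := by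
  rw [HCell.comp, F.mapCell_vcomp, toHom_vcomp]

theorem vid_hcompCell_comp {A B C : L} {J : Hor A B} {H H' H'' : Hor B C} (φ : HCell H H')
    (ψ : HCell H' H'') :
    toHom (hcompCell (vid J) (φ.comp ψ)) =
      toHom (hcompCell (vid J) φ) ≫ toHom (hcompCell (vid J) ψ) := by
  rw [← toHom_vcomp (Category.id_comp _) (Category.id_comp _),
    ← hcompCell_vcomp (Category.id_comp _) (Category.id_comp _) (Category.id_comp _), vid_vcomp]
  rfl

theorem comp_hcompCell_vid {A B C : L} {J J' J'' : Hor A B} {H : Hor B C} (φ : HCell J J')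
    (ψ : HCell J' J'') :
    toHom (hcompCell (φ.comp ψ) (vid H)) =
      toHom (hcompCell φ (vid H)) ≫ toHom (hcompCell ψ (vid H)) := by
  rw [← toHom_vcomp (Category.id_comp _) (Category.id_comp _),
    ← hcompCell_vcomp (Category.id_comp _) (Category.id_comp _) (Category.id_comp _), vid_vcomp]
  rfl

theorem mapCell_hcompCell_vid (F : LaxDoubleFunctor K L) {A B C : K} {J J' : Hor A B}
    (φ : HCell J J') (H : Hor B C) :
    toHom (hcompCell (recast (F.map_id _) (F.map_id _) (F.mapCell φ)) (vid (F.mapHor H))) ≫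
        toHom (F.compositor J' H) =
      toHom (F.compositor J H) ≫ toHom (F.mapCell (hcompCell φ (vid H))) := by
  have h := congrArg toHom (F.compositor_naturality φ (vid H))
  rw [below, onTop, toHom_vcomp, toHom_vcomp] at h
  rw [← h, F.mapCell_vid, ← toHom_recast (F.map_id _) (F.map_id _)
    (hcompCell (F.mapCell φ) _), ← hcompCell_recast _ (F.map_id _), recast_recast]
  rfl

theorem mapCell_vid_hcompCell (F : LaxDoubleFunctor K L) {A B C : K} {H H' : Hor B C}
    (J : Hor A B) (φ : HCell H H') :
    toHom (hcompCell (vid (F.mapHor J)) (recast (F.map_id _) (F.map_id _) (F.mapCell φ))) ≫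
        toHom (F.compositor J H') =
      toHom (F.compositor J H) ≫ toHom (F.mapCell (hcompCell (vid J) φ)) := by
  have h := congrArg toHom (F.compositor_naturality (vid J) φ)
  rw [below, onTop, toHom_vcomp, toHom_vcomp] at h
  rw [← h, F.mapCell_vid, ← toHom_recast (F.map_id _) (F.map_id _)
    (hcompCell _ (F.mapCell φ)), ← hcompCell_recast _ (F.map_id _), recast_recast]
  rfl

/-- The composite of a lax double functor with itself. Its unitors and compositors are
`1 ⇒ F1 ⇒ FF1` and `FFJ ⊙ FFH ⇒ F(FJ ⊙ FH) ⇒ FF(J ⊙ H)`. -/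
def square (F : LaxDoubleFunctor K K) : LaxDoubleFunctor K K where
  toFunctor := F.toFunctor ⋙ F.toFunctor
  mapHor J := F.mapHor (F.mapHor J)
  mapCell φ := F.mapCell (F.mapCell φ)
  mapCell_vid J := by
    rw [F.mapCell_vid, F.mapCell_recast, F.mapCell_vid, recast_recast]
  mapCell_vcomp e₁ e₂ φ ψ := by
    rw [F.mapCell_vcomp, F.mapCell_vcomp]
  unitor A :=
    (F.unitor (F.obj A)).comp (recast (F.map_id _) (F.map_id _) (F.mapCell (F.unitor A)))
  unitor_naturality f := by
    apply toHom_injective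
    have h1 := congrArg toHom (F.unitor_naturality (F.map f))
    have h2 := congrArg (fun φ => toHom (F.mapCell φ)) (F.unitor_naturality f)
    simp only [below, onTop, HCell.comp, F.mapCell_vcomp, toHom_vcomp, toHom_recast] at h1 h2 ⊢
    rw [Category.assoc, ← h2, ← Category.assoc, ← Category.assoc, ← h1]
    rfl
  compositor J H :=
    (F.compositor (F.mapHor J) (F.mapHor H)).comp
      (recast (F.map_id _) (F.map_id _) (F.mapCell (F.compositor J H)))
  compositor_naturality φ ψ := by
    apply toHom_injective
    have h1 := congrArg toHom (F.compositor_naturality (F.mapCell φ) (F.mapCell ψ))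
    have h2 := congrArg (fun φ => toHom (F.mapCell φ)) (F.compositor_naturality φ ψ)
    simp only [below, onTop, HCell.comp, F.mapCell_vcomp, toHom_vcomp, toHom_recast] at h1 h2 ⊢
    rw [Category.assoc, ← h2, ← Category.assoc, ← Category.assoc, ← h1]
  associativity J H P := by
    apply toHom_injective
    have h1 := congrArg toHom (F.associativity (F.mapHor J) (F.mapHor H) (F.mapHor P))
    have h2 := congrArg (fun φ => toHom (F.mapCell φ)) (F.associativity J H P)
    have h3 := F.mapCell_hcompCell_vid (F.compositor J H) (F.mapHor P)
    have h4 := F.mapCell_vid_hcompCell (F.mapHor J) (F.compositor H P)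
    simp only [HCell.comp, toHom_vcomp, toHom_recast, F.mapCell_vcomp, F.mapCell_recast,
      Category.assoc] at h1 h2 h3 h4 ⊢
    have h5 := comp_hcompCell_vid (H := F.mapHor (F.mapHor P))
      (F.compositor (F.mapHor J) (F.mapHor H))
      (recast (F.map_id _) (F.map_id _) (F.mapCell (F.compositor J H)))
    have h6 := vid_hcompCell_comp (J := F.mapHor (F.mapHor J))
      (F.compositor (F.mapHor H) (F.mapHor P))
      (recast (F.map_id _) (F.map_id _) (F.mapCell (F.compositor H P)))
    simp only [HCell.comp] at h5 h6
    erw [h5, h6]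
    simp only [Category.assoc]
    erw [reassoc_of% h3, reassoc_of% h4, h2, reassoc_of% h1]
  left_unitality {A B} J := by
    apply toHom_injective
    have h1 := congrArg toHom (F.left_unitality (F.mapHor J))
    have h2 := congrArg (fun φ => toHom (F.mapCell φ)) (F.left_unitality J)
    have h3 := F.mapCell_hcompCell_vid (F.unitor A) (F.mapHor J)
    simp only [HCell.comp, toHom_vcomp, toHom_recast, F.mapCell_vcomp, F.mapCell_recast,
      Category.assoc] at h1 h2 h3 ⊢
    have h5 := comp_hcompCell_vid (H := F.mapHor (F.mapHor J)) (F.unitor (F.obj A))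
      (recast (F.map_id _) (F.map_id _) (F.mapCell (F.unitor A)))
    simp only [HCell.comp] at h5
    erw [h5]
    simp only [Category.assoc]
    erw [reassoc_of% h3, h2, h1]
  right_unitality {A B} J := by
    apply toHom_injective
    have h1 := congrArg toHom (F.right_unitality (F.mapHor J))
    have h2 := congrArg (fun φ => toHom (F.mapCell φ)) (F.right_unitality J)
    have h3 := F.mapCell_vid_hcompCell (F.mapHor J) (F.unitor B)
    simp only [HCell.comp, toHom_vcomp, toHom_recast, F.mapCell_vcomp, F.mapCell_recast,
      Category.assoc] at h1 h2 h3 ⊢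
    have h5 := vid_hcompCell_comp (J := F.mapHor (F.mapHor J)) (F.unitor (F.obj B))
      (recast (F.map_id _) (F.map_id _) (F.mapCell (F.unitor B)))
    simp only [HCell.comp] at h5
    erw [h5]
    simp only [Category.assoc]
    erw [reassoc_of% h3, h2, h1]

end LaxDoubleFunctor

/-- Double transformations between lax double functors. -/
structure DoubleTransformation {K : Type u} [DoubleCategory.{v, u, w, z} K]
    {L : Type u'} [DoubleCategory.{v', u', w', z'} L] (F G : LaxDoubleFunctor K L) extends
    F.toFunctor ⟶ G.toFunctor where
  cell : {A B : K} → (J : Hor A B) → Cell (app A) (app B) (F.mapHor J) (G.mapHor J)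
  cell_naturality : ∀ {A B C D : K} {f : A ⟶ C} {g : B ⟶ D} {J : Hor A B} {H : Hor C D}
    (φ : Cell f g J H),
    vcomp (naturality f) (naturality g) (F.mapCell φ) (cell H) =
      vcomp rfl rfl (cell J) (G.mapCell φ)
  cell_hcomp : ∀ {A B C : K} (J : Hor A B) (H : Hor B C),
    onTop (F.compositor J H) (cell (hcomp J H)) =
      below (hcompCell (cell J) (cell H)) (G.compositor J H)
  cell_unit : ∀ A : K,
    onTop (F.unitor A) (cell (unit A)) = below (unitCell (app A)) (G.unitor A)

/-- Normal lax double monads: the underlying lax double functor is normal, that is its unitor cells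
are identities. -/
structure NormalLaxDoubleMonad (K : Type u) [DoubleCategory.{v, u, w, z} K] extends
    LaxDoubleFunctor K K where
  mapHor_unit : ∀ A : K, mapHor (unit A) = unit (obj A)
  unitor_eq : ∀ A : K, unitor A = idHCell (mapHor_unit A).symm
  μ : DoubleTransformation toLaxDoubleFunctor.square toLaxDoubleFunctor
  ι : DoubleTransformation (LaxDoubleFunctor.id K) toLaxDoubleFunctor
  μ_μ : ∀ A : K, map (μ.app A) ≫ μ.app A = μ.app (obj A) ≫ μ.app A
  ι_μ : ∀ A : K, ι.app (obj A) ≫ μ.app A = 𝟙 (obj A)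
  map_ι_μ : ∀ A : K, map (ι.app A) ≫ μ.app A = 𝟙 (obj A)
  μ_μ_cell : ∀ {A B : K} (J : Hor A B),
    vcomp (μ_μ A) (μ_μ B) (mapCell (μ.cell J)) (μ.cell J) =
      vcomp rfl rfl (μ.cell (mapHor J)) (μ.cell J)
  ι_μ_cell : ∀ {A B : K} (J : Hor A B),
    vcomp (ι_μ A) (ι_μ B) (ι.cell (mapHor J)) (μ.cell J) = vid (mapHor J)
  map_ι_μ_cell : ∀ {A B : K} (J : Hor A B),
    vcomp (map_ι_μ A) (map_ι_μ B) (mapCell (ι.cell J)) (μ.cell J) = vid (mapHor J)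

namespace NormalLaxDoubleMonad

variable {K : Type u} [DoubleCategory.{v, u, w, z} K] (T : NormalLaxDoubleMonad K)

/-- The component `A ⟶ T A` of the unit of `T`. -/
def ιApp (A : K) : A ⟶ T.obj A := T.ι.app A

/-- The component `T (T A) ⟶ T A` of the multiplication of `T`. -/
def μApp (A : K) : T.obj (T.obj A) ⟶ T.obj A := T.μ.app A

/-- The cell `J ⇒ T J` that is the component of the unit of `T` at `J`. -/
def ιCell {A B : K} (J : Hor A B) : Cell (T.ιApp A) (T.ιApp B) J (T.mapHor J) := T.ι.cell J

theorem ιApp_naturality {A C : K} (f : A ⟶ C) : f ≫ T.ιApp C = T.ιApp A ≫ T.map f :=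
  T.ι.naturality f

theorem μApp_naturality {A C : K} (f : A ⟶ C) :
    T.map (T.map f) ≫ T.μApp C = T.μApp A ≫ T.map f :=
  T.μ.naturality f

theorem ιApp_μApp (A : K) : T.ιApp (T.obj A) ≫ T.μApp A = 𝟙 (T.obj A) := T.ι_μ A

theorem map_ιApp_μApp (A : K) : T.map (T.ιApp A) ≫ T.μApp A = 𝟙 (T.obj A) := T.map_ι_μ A

theorem μApp_μApp (A : K) :
    T.map (T.μApp A) ≫ T.μApp A = T.μApp (T.obj A) ≫ T.μApp A := T.μ_μ A

/-- The image under `T` of a cell whose bottom is a unit, where `T 1 = 1`. -/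
def mapToUnit {A B M : K} {f : A ⟶ M} {g : B ⟶ M} {J : Hor A B} (φ : Cell f g J (unit M)) :
    Cell (T.map f) (T.map g) (T.mapHor J) (unit (T.obj M)) :=
  below (T.mapCell φ) (idHCell (T.mapHor_unit M))

/-- The action of `T` on vertical cells, which makes it restrict to the vertical 2-category. -/
def mapVCell {A C : K} {f g : A ⟶ C} (φ : VCell f g) : VCell (T.map f) (T.map g) :=
  onTop (idHCell (T.mapHor_unit A).symm) (T.mapToUnit φ)

/-- Pseudo algebras for the 2-monad that `T` restricts to on the vertical 2-category. -/
structure PseudoAlgebra (M : K) where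
  act : T.obj M ⟶ M
  /-- The associator `m ∘ T m ⇒ m ∘ μ`. -/
  associator : VCell (T.map act ≫ act) (T.μApp M ≫ act)
  /-- The unitor `id ⇒ m ∘ ι`. -/
  unitor : VCell (𝟙 M) (T.ιApp M ≫ act)
  associator_isInvertible : associator.IsInvertible
  unitor_isInvertible : unitor.IsInvertible
  /-- The two composites `m ∘ T m ∘ T T m ⇒ m ∘ μ ∘ T μ` coincide. -/
  associativity :
    VCell.comp
      (recast rfl (by rw [T.map_comp, Category.assoc])
        (postWhisker (T.mapVCell associator) act) :
          VCell (T.map (T.map act ≫ act) ≫ act) (T.map (T.μApp M) ≫ T.map act ≫ act))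
      (preWhisker (T.map (T.μApp M)) associator) =
    VCell.comp
      (recast (by rw [T.map_comp, Category.assoc])
        (by rw [← Category.assoc, T.μApp_naturality, Category.assoc])
        (preWhisker (T.map (T.map act)) associator) :
          VCell (T.map (T.map act ≫ act) ≫ act) (T.μApp (T.obj M) ≫ T.map act ≫ act))
      (recast rfl (by rw [← Category.assoc, ← T.μApp_μApp, Category.assoc])
        (preWhisker (T.μApp (T.obj M)) associator))
  /-- The composite `m ⇒ m ∘ T m ∘ T ι ⇒ m ∘ μ ∘ T ι = m` is the identity. -/
  right_unitality :
    VCell.comp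
      (recast (by rw [T.map_id, Category.id_comp]) (by rw [T.map_comp, Category.assoc])
        (postWhisker (T.mapVCell unitor) act) :
          VCell act (T.map (T.ιApp M) ≫ T.map act ≫ act))
      (preWhisker (T.map (T.ιApp M)) associator) =
    idVCell (by rw [← Category.assoc, T.map_ιApp_μApp, Category.id_comp])
  /-- The composite `m ⇒ m ∘ ι ∘ m = m ∘ T m ∘ ι ⇒ m ∘ μ ∘ ι = m` is the identity. -/
  left_unitality :
    VCell.comp
      (recast (Category.comp_id act)
        (by rw [← Category.assoc, T.ιApp_naturality, Category.assoc])
        (preWhisker act unitor) :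
          VCell act (T.ιApp (T.obj M) ≫ T.map act ≫ act))
      (preWhisker (T.ιApp (T.obj M)) associator) =
    idVCell (by rw [← Category.assoc, T.ιApp_μApp, Category.id_comp])

variable {T}

/-- Strict algebras: the associator and the unitor are identities. -/
def PseudoAlgebra.IsStrict {M : K} (𝔪 : T.PseudoAlgebra M) : Prop :=
  (∃ e, 𝔪.associator = idVCell e) ∧ ∃ e, 𝔪.unitor = idVCell e

/-- The cell `φ : f ∘ a ⇒ c ∘ T f` makes `f` into a colax morphism of pseudo algebras. -/
structure IsColaxMorphism {A C : K} (𝔞 : T.PseudoAlgebra A) (𝔠 : T.PseudoAlgebra C) (f : A ⟶ C)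
    (φ : VCell (𝔞.act ≫ f) (T.map f ≫ 𝔠.act)) : Prop where
  /-- The two composites `f ∘ a ∘ T a ⇒ c ∘ μ ∘ T T f = c ∘ T f ∘ μ` coincide. -/
  associativity :
    VCell.comp
      (recast rfl (Category.assoc _ _ _) (postWhisker 𝔞.associator f) :
        VCell ((T.map 𝔞.act ≫ 𝔞.act) ≫ f) (T.μApp A ≫ 𝔞.act ≫ f))
      (preWhisker (T.μApp A) φ) =
    VCell.comp
      (recast (Category.assoc _ _ _).symm
        (by rw [T.map_comp, Category.assoc])
        (preWhisker (T.map 𝔞.act) φ) :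
          VCell ((T.map 𝔞.act ≫ 𝔞.act) ≫ f) (T.map (𝔞.act ≫ f) ≫ 𝔠.act))
      (VCell.comp
        (recast rfl (by rw [T.map_comp, Category.assoc])
          (postWhisker (T.mapVCell φ) 𝔠.act) :
            VCell (T.map (𝔞.act ≫ f) ≫ 𝔠.act) (T.map (T.map f) ≫ T.map 𝔠.act ≫ 𝔠.act))
        (recast rfl (by rw [← Category.assoc, T.μApp_naturality, Category.assoc])
          (preWhisker (T.map (T.map f)) 𝔠.associator)))
  /-- The composite `f ⇒ f ∘ a ∘ ι ⇒ c ∘ T f ∘ ι = c ∘ ι ∘ f` is induced by the unitor of `c`. -/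
  unitality :
    VCell.comp
      (recast (Category.id_comp f) (Category.assoc _ _ _) (postWhisker 𝔞.unitor f) :
        VCell f (T.ιApp A ≫ 𝔞.act ≫ f))
      (preWhisker (T.ιApp A) φ) =
    recast (Category.comp_id f) (by rw [← Category.assoc, T.ιApp_naturality, Category.assoc])
      (preWhisker f 𝔠.unitor)

variable (T) in
/-- The 2-monad that `T` restricts to on the vertical 2-category is colax-idempotent: every
vertical morphism between (strict) algebras admits a unique structure of colax morphism. -/
def IsColaxIdempotent : Prop :=
  ∀ ⦃A C : K⦄ (𝔞 : T.PseudoAlgebra A) (𝔠 : T.PseudoAlgebra C), 𝔞.IsStrict → 𝔠.IsStrict →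
    ∀ f : A ⟶ C, ∃! φ : VCell (𝔞.act ≫ f) (T.map f ≫ 𝔠.act), IsColaxMorphism 𝔞 𝔠 f φ

variable (T) in
/-- The horizontal cell `ι_{J*} : J ⊙ ι_{B*} ⇒ ι_{A*} ⊙ T J` that is the composite of the
opcartesian cell defining `ι_{A*}`, the cell `ι_J` and the cartesian cell defining `ι_{B*}`. -/
noncomputable def ιStar {A B : K} (J : Hor A B) (P : Companion (T.ιApp A))
    (Q : Companion (T.ιApp B)) :
    HCell (hcomp J Q.hor) (hcomp P.hor (T.mapHor J)) :=
  onTop (leftUnitorInv (hcomp J Q.hor))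
    (below (hcompCell P.opcart (hcompCell (T.ιCell J) Q.cart))
      (hcompCell (vid P.hor) (rightUnitor (T.mapHor J))))

variable (T) in
/-- The cell `ι_J` satisfies the right Beck-Chevalley condition: `ι_{J*}` is invertible. This does
not depend on the choice of the companions of `ι_A` and `ι_B`. -/
def RightBeckChevalley {A B : K} (J : Hor A B) : Prop :=
  ∀ (P : Companion (T.ιApp A)) (Q : Companion (T.ιApp B)), (T.ιStar J P Q).IsInvertible

end NormalLaxDoubleMonad

end DoubleCategory

/-! Everything reduces to universal properties of vertical cells. Colax-idempotency is applied to
free algebras only, where it gives `ι_{TA} ⊣ μ_A` with identity unit (`exists_counit`). From this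
every pseudo algebra `(B, b)` acquires an adjunction `ι_B ⊣ b` in the vertical 2-category, whose
unit is the unitor of the algebra (`PseudoAlgebra.exists_isVAdjunction`).

By taking mates, cells `l ∘ b ⇒ m ∘ Tl` correspond to cells `l ⇒ m ∘ Tl ∘ ι_B = m ∘ ι_M ∘ l`, and
unitality of a colax structure says exactly that its mate is the unitor of `m` at `l`. This
determines the structure cell `lbar` and also produces it. Associativity is then automatic: up to
the associator of `b`, both of its sides have source `l ∘ b ∘ μ_B`, and such cells are determined by
their restrictions along `ι_{TB}` (`vCell_μApp_ext`, `isColaxMorphism_of_unitality`).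

The Beck–Chevalley condition for `d^*` is translated likewise. Because `ι_M ⊣ m`, the companion of
`ι_M` is also a conjoint of `m`. Comparing opcartesian cells on both sides of `ι_{d^*}` then shows
that it is invertible if and only if the unitor `d ⇒ m ∘ Td ∘ ι_A` exhibits `m ∘ Td` as an absolute
left Kan extension of `d` along `ι_A`, a property called exactness here (`ιStar_isInvertible_iff`).

Both numbered parts rest on one commuting square of maps on cells `ψ : m ∘ Tl ⇒ k`
(`toHom_unitorAt_square`). One way round composes with `Tη` and then with the unitor at `d`; the
other composes with `lbar`, takes the mate under `ι_B ⊣ b`, and composes with `η`. Mates and `η`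
always give bijections, and the unitor at `d` does so when it is exact. Hence, if it is exact, `1_m
∘ Tη` is a left Kan extension if and only if composition with `lbar` is always bijective, that is
`lbar` is invertible (`bijective_iff_of_square`).

This is the first part. For the converse only exactness at `d` is missing. When `j` is full and
faithful, `j_* ⊙ j^*` is a unit, so pointwiseness of `η` tested on `j^*` makes `d ⇒ l ∘ j`
invertible (`IsPointwiseLeftKan.isInvertible_of_isFullFaithful`). Exactness at `j` is absolute, so
it survives composition with `l`, and the isomorphisms `d ≅ l ∘ j` and `l ∘ b ≅ m ∘ Tl` carry it to
`d` (`IsExact.unitorAt_of_isInvertible`). -/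

namespace DoubleCategory

/-! ### Calculus of cells, with vertical boundaries forgotten. -/

section Calculus

variable {K : Type u} [DoubleCategory.{v, u, w, z} K]

/-- The horizontal composite of cells is functorial for vertical composition. -/
theorem toHom_hcompCell_comp {A B C D E F G I N : K} {f : A ⟶ D} {g : B ⟶ E} {h : C ⟶ F}
    {f' : D ⟶ G} {g' : E ⟶ I} {h' : F ⟶ N} {p : A ⟶ G} {q : B ⟶ I} {r : C ⟶ N}
    {J : Hor A B} {J' : Hor B C} {H : Hor D E} {H' : Hor E F} {L : Hor G I} {L' : Hor I N}
    (e₁ : f ≫ f' = p) (e₂ : g ≫ g' = q) (e₃ : h ≫ h' = r)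
    (φ : Cell f g J H) (φ' : Cell g h J' H') (ψ : Cell f' g' H L) (ψ' : Cell g' h' H' L') :
    toHom (hcompCell φ φ') ≫ toHom (hcompCell ψ ψ') =
      toHom (hcompCell (vcomp e₁ e₂ φ ψ) (vcomp e₂ e₃ φ' ψ')) := by
  rw [hcompCell_vcomp e₁ e₂ e₃, toHom_vcomp]

theorem toHom_onTop {A B C D : K} {f : A ⟶ C} {g : B ⟶ D} {J J' : Hor A B} {H : Hor C D}
    (φ : HCell J' J) (ψ : Cell f g J H) : toHom (onTop φ ψ) = toHom φ ≫ toHom ψ :=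
  toHom_vcomp _ _ _ _

theorem toHom_below {A B C D : K} {f : A ⟶ C} {g : B ⟶ D} {J : Hor A B} {H H' : Hor C D}
    (φ : Cell f g J H) (ψ : HCell H H') : toHom (below φ ψ) = toHom φ ≫ toHom ψ :=
  toHom_vcomp _ _ _ _

theorem toHom_hcellComp {A B : K} {J H L : Hor A B} (φ : HCell J H) (ψ : HCell H L) :
    toHom (φ.comp ψ) = toHom φ ≫ toHom ψ :=
  toHom_vcomp _ _ _ _

theorem toHom_unitCell_id (A : K) : toHom (unitCell (𝟙 A)) = 𝟙 _ := by
  rw [unitCell_id, toHom_vid]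

theorem toHom_unitCell_comp {A C E : K} {f : A ⟶ C} {h : C ⟶ E} {p : A ⟶ E} (e : f ≫ h = p) :
    toHom (unitCell f) ≫ toHom (unitCell h) = toHom (unitCell p) := by
  subst e; rw [unitCell_comp, toHom_vcomp]

theorem vcomp_unitCell {A C E : K} {f : A ⟶ C} {h : C ⟶ E} {p : A ⟶ E} (e₁ e₂ : f ≫ h = p) :
    vcomp e₁ e₂ (unitCell f) (unitCell h) = unitCell p := by
  subst e₁; rw [unitCell_comp]

theorem toHom_hcompCell_vid {A B E : K} (J : Hor A B) (H : Hor B E) :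
    toHom (hcompCell (vid J) (vid H)) = 𝟙 _ := by
  rw [hcompCell_vid, toHom_vid]

/-- The left unitor as an isomorphism. -/
def leftIso {A B : K} (J : Hor A B) : HorObj.mk (hcomp (unit A) J) ≅ HorObj.mk J where
  hom := toHom (leftUnitor J)
  inv := toHom (leftUnitorInv J)
  hom_inv_id := by rw [← toHom_vcomp (Category.id_comp _) (Category.id_comp _),
    leftUnitor_leftUnitorInv, toHom_vid]
  inv_hom_id := by rw [← toHom_vcomp (Category.id_comp _) (Category.id_comp _),
    leftUnitorInv_leftUnitor, toHom_vid]

/-- The right unitor as an isomorphism. -/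
def rightIso {A B : K} (J : Hor A B) : HorObj.mk (hcomp J (unit B)) ≅ HorObj.mk J where
  hom := toHom (rightUnitor J)
  inv := toHom (rightUnitorInv J)
  hom_inv_id := by rw [← toHom_vcomp (Category.id_comp _) (Category.id_comp _),
    rightUnitor_rightUnitorInv, toHom_vid]
  inv_hom_id := by rw [← toHom_vcomp (Category.id_comp _) (Category.id_comp _),
    rightUnitorInv_rightUnitor, toHom_vid]

/-- The associator as an isomorphism. -/
def assocIso {A B C D : K} (J : Hor A B) (H : Hor B C) (L : Hor C D) :
    HorObj.mk (hcomp (hcomp J H) L) ≅ HorObj.mk (hcomp J (hcomp H L)) where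
  hom := toHom (associator J H L)
  inv := toHom (associatorInv J H L)
  hom_inv_id := by rw [← toHom_vcomp (Category.id_comp _) (Category.id_comp _),
    associator_associatorInv, toHom_vid]
  inv_hom_id := by rw [← toHom_vcomp (Category.id_comp _) (Category.id_comp _),
    associatorInv_associator, toHom_vid]

theorem toHom_leftUnitor {A B : K} (J : Hor A B) :
    toHom (leftUnitor J) = (leftIso J).hom := rfl

theorem toHom_leftUnitorInv {A B : K} (J : Hor A B) :
    toHom (leftUnitorInv J) = (leftIso J).inv := rfl

theorem toHom_rightUnitor {A B : K} (J : Hor A B) :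
    toHom (rightUnitor J) = (rightIso J).hom := rfl

theorem toHom_rightUnitorInv {A B : K} (J : Hor A B) :
    toHom (rightUnitorInv J) = (rightIso J).inv := rfl

theorem leftIso_naturality {A B C D : K} {f : A ⟶ C} {g : B ⟶ D} {J : Hor A B} {H : Hor C D}
    (φ : Cell f g J H) :
    toHom (hcompCell (unitCell f) φ) ≫ (leftIso H).hom = (leftIso J).hom ≫ toHom φ := by
  have h := congrArg toHom (leftUnitor_naturality φ)
  rwa [toHom_vcomp, toHom_vcomp] at h

theorem leftIso_inv_naturality {A B C D : K} {f : A ⟶ C} {g : B ⟶ D} {J : Hor A B} {H : Hor C D}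
    (φ : Cell f g J H) :
    (leftIso J).inv ≫ toHom (hcompCell (unitCell f) φ) = toHom φ ≫ (leftIso H).inv := by
  rw [Iso.inv_comp_eq, ← Category.assoc, Iso.eq_comp_inv, leftIso_naturality]

theorem rightIso_naturality {A B C D : K} {f : A ⟶ C} {g : B ⟶ D} {J : Hor A B} {H : Hor C D}
    (φ : Cell f g J H) :
    toHom (hcompCell φ (unitCell g)) ≫ (rightIso H).hom = (rightIso J).hom ≫ toHom φ := by
  have h := congrArg toHom (rightUnitor_naturality φ)
  rwa [toHom_vcomp, toHom_vcomp] at h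

theorem rightIso_inv_naturality {A B C D : K} {f : A ⟶ C} {g : B ⟶ D} {J : Hor A B}
    {H : Hor C D} (φ : Cell f g J H) :
    (rightIso J).inv ≫ toHom (hcompCell φ (unitCell g)) = toHom φ ≫ (rightIso H).inv := by
  rw [Iso.inv_comp_eq, ← Category.assoc, Iso.eq_comp_inv, rightIso_naturality]

theorem assocIso_naturality {A B C D A' B' C' D' : K}
    {f : A ⟶ A'} {g : B ⟶ B'} {h : C ⟶ C'} {k : D ⟶ D'}
    {J : Hor A B} {H : Hor B C} {L : Hor C D} {J' : Hor A' B'} {H' : Hor B' C'} {L' : Hor C' D'}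
    (φ : Cell f g J J') (ψ : Cell g h H H') (χ : Cell h k L L') :
    toHom (hcompCell (hcompCell φ ψ) χ) ≫ (assocIso J' H' L').hom =
      (assocIso J H L).hom ≫ toHom (hcompCell φ (hcompCell ψ χ)) := by
  have h := congrArg toHom (associator_naturality φ ψ χ)
  rwa [toHom_vcomp, toHom_vcomp] at h

theorem assocIso_inv_naturality {A B C D A' B' C' D' : K}
    {f : A ⟶ A'} {g : B ⟶ B'} {h : C ⟶ C'} {k : D ⟶ D'}
    {J : Hor A B} {H : Hor B C} {L : Hor C D} {J' : Hor A' B'} {H' : Hor B' C'} {L' : Hor C' D'}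
    (φ : Cell f g J J') (ψ : Cell g h H H') (χ : Cell h k L L') :
    (assocIso J H L).inv ≫ toHom (hcompCell (hcompCell φ ψ) χ) =
      toHom (hcompCell φ (hcompCell ψ χ)) ≫ (assocIso J' H' L').inv := by
  rw [Iso.inv_comp_eq, ← Category.assoc, Iso.eq_comp_inv, assocIso_naturality]

end Calculus

/-! ### Coherence, by way of the horizontal bicategory. -/

section Coherence

variable {K : Type u} [DoubleCategory.{v, u, w, z} K]

theorem vid_hcompCell_hcellComp {A B C : K} (J : Hor A B) {H H' H'' : Hor B C} (φ : HCell H H')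
    (ψ : HCell H' H'') :
    hcompCell (vid J) (φ.comp ψ) = HCell.comp (hcompCell (vid J) φ) (hcompCell (vid J) ψ) :=
  toHom_injective <|
    (LaxDoubleFunctor.vid_hcompCell_comp φ ψ).trans (toHom_hcellComp _ _).symm

theorem hcellComp_hcompCell_vid {A B C : K} {J J' J'' : Hor A B} (φ : HCell J J')
    (ψ : HCell J' J'') (H : Hor B C) :
    hcompCell (φ.comp ψ) (vid H) = HCell.comp (hcompCell φ (vid H)) (hcompCell ψ (vid H)) :=
  toHom_injective <|
    (LaxDoubleFunctor.comp_hcompCell_vid φ ψ).trans (toHom_hcellComp _ _).symm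

theorem vid_unit_hcompCell {A B : K} {J H : Hor A B} (φ : HCell J H) :
    hcompCell (vid (unit A)) φ = HCell.comp (leftUnitor J) (φ.comp (leftUnitorInv H)) := by
  apply toHom_injective
  rw [toHom_hcellComp, toHom_hcellComp, toHom_leftUnitor, toHom_leftUnitorInv, ← Category.assoc,
    Iso.eq_comp_inv, ← unitCell_id, leftIso_naturality]

theorem hcompCell_vid_unit {A B : K} {J H : Hor A B} (φ : HCell J H) :
    hcompCell φ (vid (unit B)) = HCell.comp (rightUnitor J) (φ.comp (rightUnitorInv H)) := by
  apply toHom_injective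
  rw [toHom_hcellComp, toHom_hcellComp, toHom_rightUnitor, toHom_rightUnitorInv,
    ← Category.assoc, Iso.eq_comp_inv, ← unitCell_id, rightIso_naturality]

theorem hcompCell_hcompCell {A B C D : K} {J J' : Hor A B} {H H' : Hor B C} {L L' : Hor C D}
    (φ : HCell J J') (ψ : HCell H H') (χ : HCell L L') :
    hcompCell (hcompCell φ ψ) χ = HCell.comp (associator J H L)
      (HCell.comp (hcompCell φ (hcompCell ψ χ)) (associatorInv J' H' L')) := by
  apply toHom_injective
  rw [toHom_hcellComp, toHom_hcellComp, ← Category.assoc]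
  exact (Iso.eq_comp_inv (assocIso J' H' L')).2 (assocIso_naturality φ ψ χ)

theorem hcompCell_hcompCell' {A B C D : K} {J J' : Hor A B} {H H' : Hor B C} {L L' : Hor C D}
    (φ : HCell J J') (ψ : HCell H H') (χ : HCell L L') :
    hcompCell φ (hcompCell ψ χ) = HCell.comp (associatorInv J H L)
      (HCell.comp (hcompCell (hcompCell φ ψ) χ) (associator J' H' L')) := by
  apply toHom_injective
  rw [toHom_hcellComp, toHom_hcellComp]
  exact (Iso.eq_inv_comp (assocIso J H L)).2 (assocIso_naturality φ ψ χ).symm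

theorem hcompCell_exchange {A B C : K} {J J' : Hor A B} {H H' : Hor B C}
    (φ : HCell J J') (ψ : HCell H H') :
    HCell.comp (hcompCell (vid J) ψ) (hcompCell φ (vid H')) =
      HCell.comp (hcompCell φ (vid H)) (hcompCell (vid J') ψ) := by
  simp only [HCell.comp]
  rw [← hcompCell_vcomp _ (Category.id_comp _), ← hcompCell_vcomp _ (Category.id_comp _), vid_vcomp,
    vid_vcomp, vcomp_vid, vcomp_vid]

/-- The objects of `K`, as those of its bicategory of horizontal morphisms and horizontal cells. -/
def Horizontal (K : Type u) : Type u := K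

instance : CategoryStruct (Horizontal K) where
  Hom A B := Hor (K := K) A B
  id A := unit (K := K) A
  comp J H := hcomp (K := K) J H

instance (A B : Horizontal K) : Category (A ⟶ B) where
  Hom J H := HCell (K := K) J H
  id J := vid (K := K) J
  comp φ ψ := HCell.comp (K := K) φ ψ
  id_comp φ := vid_vcomp (K := K) φ
  comp_id φ := vcomp_vid (K := K) φ
  assoc φ ψ χ := vcomp_assoc (K := K) _ _ _ _ _ _ _ _ φ ψ χ

/-- Gives access to the consequences of the pentagon and triangle in a bicategory: that the two
unitors of a unit agree, and that the left unitor of a composite is determined by an associator. -/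
instance : Bicategory (Horizontal K) where
  whiskerLeft J _ _ φ := hcompCell (K := K) (vid J) φ
  whiskerRight φ H := hcompCell (K := K) φ (vid H)
  associator J H L :=
    ⟨associator (K := K) J H L, associatorInv (K := K) J H L,
      associator_associatorInv (K := K) J H L, associatorInv_associator (K := K) J H L⟩
  leftUnitor J :=
    ⟨leftUnitor (K := K) J, leftUnitorInv (K := K) J,
      leftUnitor_leftUnitorInv (K := K) J, leftUnitorInv_leftUnitor (K := K) J⟩
  rightUnitor J :=
    ⟨rightUnitor (K := K) J, rightUnitorInv (K := K) J,
      rightUnitor_rightUnitorInv (K := K) J, rightUnitorInv_rightUnitor (K := K) J⟩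
  whiskerLeft_id J H := hcompCell_vid (K := K) J H
  whiskerLeft_comp J _ _ _ φ ψ := vid_hcompCell_hcellComp (K := K) J φ ψ
  id_whiskerLeft φ := vid_unit_hcompCell (K := K) φ
  comp_whiskerLeft J H _ _ φ :=
    (congrArg (fun χ => hcompCell (K := K) χ φ) (hcompCell_vid (K := K) J H).symm).trans
      (hcompCell_hcompCell (K := K) _ _ φ)
  id_whiskerRight J H := hcompCell_vid (K := K) J H
  comp_whiskerRight φ ψ H := hcellComp_hcompCell_vid (K := K) φ ψ H
  whiskerRight_id φ := hcompCell_vid_unit (K := K) φ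
  whiskerRight_comp φ H L :=
    (congrArg (fun χ => hcompCell (K := K) φ χ) (hcompCell_vid (K := K) H L).symm).trans
      (hcompCell_hcompCell' (K := K) φ _ _)
  whisker_assoc _ _ _ φ _ := hcompCell_hcompCell (K := K) _ φ _
  whisker_exchange φ ψ := hcompCell_exchange (K := K) φ ψ
  pentagon J H L P := pentagon (K := K) J H L P
  triangle J H := triangle (K := K) J H

theorem leftIso_unit (A : K) : leftIso (unit A) = rightIso (unit A) :=
  Iso.ext (congrArg (toHom (K := K)) (show leftUnitor (unit A) = rightUnitor (unit A) from
    Bicategory.unitors_equal (B := Horizontal K) (a := A)))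

theorem leftIso_hcomp {A B C : K} (J : Hor A B) (H : Hor B C) :
    (assocIso (unit A) J H).hom ≫ (leftIso (hcomp J H)).hom =
      toHom (hcompCell (leftUnitor J) (vid H)) := by
  rw [← Iso.eq_inv_comp]
  exact (congrArg (toHom (K := K)) (show leftUnitor (hcomp J H) =
    HCell.comp (associatorInv (unit A) J H) (hcompCell (leftUnitor J) (vid H)) from
      Bicategory.leftUnitor_comp (B := Horizontal K) (a := A) (b := B) (c := C) J H)).trans
    (toHom_hcellComp (K := K) _ _)

theorem triangleIso {A B C : K} (J : Hor A B) (H : Hor B C) :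
    (assocIso J (unit B) H).hom ≫ toHom (hcompCell (vid J) (leftUnitor H)) =
      toHom (hcompCell (rightUnitor J) (vid H)) := by
  rw [← triangle, toHom_vcomp]; rfl

end Coherence

/-! ### Pasting vertical cells onto the left of arbitrary cells. -/

section Action

variable {K : Type u} [DoubleCategory.{v, u, w, z} K]

/-- The action of vertical cells on cells, on the left. -/
def lact {A B C D : K} {f f' : A ⟶ C} {g : B ⟶ D} {J : Hor A B} {H : Hor C D}
    (α : VCell f' f) (χ : Cell f g J H) : Cell f' g J H :=
  onTop (leftUnitorInv J) (below (hcompCell α χ) (leftUnitor H))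

theorem toHom_lact {A B C D : K} {f f' : A ⟶ C} {g : B ⟶ D} {J : Hor A B} {H : Hor C D}
    (α : VCell f' f) (χ : Cell f g J H) :
    toHom (lact α χ) = (leftIso J).inv ≫ toHom (hcompCell α χ) ≫ (leftIso H).hom := by
  rw [lact, toHom_onTop, toHom_below]; rfl

theorem comp_eq_lact {A C : K} {f g h : A ⟶ C} (φ : VCell f g) (ψ : VCell g h) :
    φ.comp ψ = lact φ ψ := rfl

theorem unitCell_lact {A B C D : K} {f : A ⟶ C} {g : B ⟶ D} {J : Hor A B} {H : Hor C D}
    (χ : Cell f g J H) : lact (unitCell f) χ = χ := by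
  apply toHom_injective
  rw [toHom_lact, leftIso_naturality, Iso.inv_hom_id_assoc]

theorem unitCell_vComp {A C : K} {f g : A ⟶ C} (φ : VCell f g) :
    VCell.comp (unitCell f) φ = φ :=
  unitCell_lact φ

theorem vComp_unitCell {A C : K} {f g : A ⟶ C} (φ : VCell f g) : φ.comp (unitCell g) = φ := by
  rw [comp_eq_lact]
  apply toHom_injective
  rw [toHom_lact, leftIso_unit, leftIso_unit, rightIso_naturality, Iso.inv_hom_id_assoc]

/-- Interchange for the action of vertical cells and vertical composition. -/
theorem vcomp_lact {A B C D E F : K} {f f' : A ⟶ C} {g : B ⟶ D} {h h' : C ⟶ E} {k : D ⟶ F}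
    {p p' : A ⟶ E} {q : B ⟶ F} {J : Hor A B} {H : Hor C D} {L : Hor E F}
    (e₁ : f ≫ h = p) (e₂ : g ≫ k = q) (e₃ : f' ≫ h' = p')
    (α : VCell f' f) (β : VCell h' h) (φ : Cell f g J H) (ψ : Cell h k H L) :
    vcomp e₃ e₂ (lact α φ) (lact β ψ) = lact (vcomp e₃ e₁ α β) (vcomp e₁ e₂ φ ψ) := by
  apply toHom_injective
  simp only [toHom_vcomp, toHom_lact, Category.assoc, Iso.hom_inv_id_assoc]
  rw [← toHom_hcompCell_comp e₃ e₁ e₂, Category.assoc]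

/-- Associativity of the action of vertical cells on composites of cells. -/
theorem hcompCell_lact {A B C D E F : K} {f f' : A ⟶ D} {g : B ⟶ E} {h : C ⟶ F}
    {J : Hor A B} {H : Hor B C} {L : Hor D E} {P : Hor E F} (α : VCell f' f)
    (φ : Cell f g J L) (ψ : Cell g h H P) :
    hcompCell (lact α φ) ψ = lact α (hcompCell φ ψ) := by
  apply toHom_injective
  have h1 : toHom (hcompCell (leftUnitorInv J) (vid H)) ≫ (assocIso (unit A) J H).hom =
      (leftIso (hcomp J H)).inv := by
    rw [← cancel_mono (leftIso (hcomp J H)).hom, Category.assoc, leftIso_hcomp,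
      toHom_hcompCell_comp (Category.id_comp _) (Category.id_comp _) (Category.id_comp _),
      leftUnitorInv_leftUnitor, vid_vcomp, toHom_hcompCell_vid, Iso.inv_hom_id]
  have h2 : toHom (hcompCell (lact α φ) ψ) = toHom (hcompCell (leftUnitorInv J) (vid H)) ≫
      toHom (hcompCell (hcompCell α φ) ψ) ≫ toHom (hcompCell (leftUnitor L) (vid P)) := by
    rw [toHom_hcompCell_comp (Category.comp_id _) (Category.comp_id _) (Category.comp_id _),
      toHom_hcompCell_comp (Category.id_comp _) (Category.id_comp _) (Category.id_comp _),
      vcomp_vid, vid_vcomp]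
    rfl
  rw [h2, toHom_lact, ← h1, ← leftIso_hcomp, Category.assoc, ← reassoc_of% assocIso_naturality]

/-- A horizontal cell is itself the result of acting on it by a unit cell, so this is a case of
interchange. -/
theorem below_lact {A B C D : K} {f f' : A ⟶ C} {g : B ⟶ D} {J : Hor A B} {H H' : Hor C D}
    (α : VCell f' f) (χ : Cell f g J H) (ψ : HCell H H') :
    below (lact α χ) ψ = lact α (below χ ψ) := by
  rw [below, ← unitCell_lact ψ, vcomp_lact (Category.comp_id _) (Category.comp_id _), unitCell_id,
    vcomp_vid, ← unitCell_id, unitCell_lact]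
  rfl

theorem onTop_lact {A B C D : K} {f f' : A ⟶ C} {g : B ⟶ D} {J J' : Hor A B} {H : Hor C D}
    (α : VCell f' f) (φ : HCell J' J) (χ : Cell f g J H) :
    onTop φ (lact α χ) = lact α (onTop φ χ) := by
  rw [onTop, ← unitCell_lact φ, vcomp_lact (Category.id_comp _) (Category.id_comp _), unitCell_id,
    vid_vcomp, ← unitCell_id, unitCell_lact]
  rfl

/-- The left action of vertical cells is associative. -/
theorem vComp_lact {A B C D : K} {f f' f'' : A ⟶ C} {g : B ⟶ D} {J : Hor A B} {H : Hor C D}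
    (α : VCell f'' f') (β : VCell f' f) (χ : Cell f g J H) :
    lact (α.comp β) χ = lact α (lact β χ) := by
  rw [lact.eq_def β χ, ← onTop_lact, ← below_lact, ← hcompCell_lact]
  rfl

theorem vComp_assoc {A C : K} {f g h k : A ⟶ C} (φ : VCell f g) (ψ : VCell g h)
    (χ : VCell h k) : (φ.comp ψ).comp χ = φ.comp (ψ.comp χ) :=
  vComp_lact φ ψ χ

end Action
-- Opcartesian cells, companions and conjoints.
section Opcartesian

variable {K : Type u} [DoubleCategory.{v, u, w, z} K]

/-- Opcartesian cells: every cell from the same top, with vertical boundaries that factor through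
those of `φ`, factors uniquely through `φ`. -/
def IsOpcartesian {A B C D : K} {f : A ⟶ C} {g : B ⟶ D} {J : Hor A B} {H : Hor C D}
    (φ : Cell f g J H) : Prop :=
  ∀ ⦃X Y : K⦄ (p : C ⟶ X) (q : D ⟶ Y) (r : A ⟶ X) (s : B ⟶ Y) (e₁ : f ≫ p = r) (e₂ : g ≫ q = s)
    (L : Hor X Y), Function.Bijective fun ψ : Cell p q H L => vcomp e₁ e₂ φ ψ

theorem IsCartesian.ext {A B C D X Y : K} {f : A ⟶ C} {g : B ⟶ D} {J : Hor A B} {H : Hor C D}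
    {φ : Cell f g J H} (hφ : IsCartesian φ) {h : X ⟶ A} {k : Y ⟶ B} {L : Hor X Y}
    {χ ψ : Cell h k L J} (e : toHom χ ≫ toHom φ = toHom ψ ≫ toHom φ) : χ = ψ := by
  refine (hφ h k _ _ rfl rfl L (vcomp rfl rfl ψ φ)).unique ?_ rfl
  apply toHom_injective
  rw [toHom_vcomp, toHom_vcomp, e]

theorem IsOpcartesian.comp {A B C D E F : K} {f : A ⟶ C} {g : B ⟶ D} {h : C ⟶ E} {k : D ⟶ F}
    {p : A ⟶ E} {q : B ⟶ F} {J : Hor A B} {H : Hor C D} {L : Hor E F}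
    {e₁ : f ≫ h = p} {e₂ : g ≫ k = q} {φ : Cell f g J H} {ψ : Cell h k H L}
    (hφ : IsOpcartesian φ) (hψ : IsOpcartesian ψ) : IsOpcartesian (vcomp e₁ e₂ φ ψ) := by
  intro X Y p q r s e₃ e₄ P
  subst e₁ e₂
  have h := (hφ _ _ r s (by rw [← e₃, Category.assoc]) (by rw [← e₄, Category.assoc]) P).comp
    (hψ p q _ _ rfl rfl P)
  convert h using 1
  funext χ
  exact vcomp_assoc ..

theorem HCell.IsInvertible.isOpcartesian {A B : K} {J H : Hor A B} {φ : HCell J H}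
    (hφ : φ.IsInvertible) : IsOpcartesian φ := by
  obtain ⟨ψ, h1, h2⟩ := hφ
  intro X Y p q r s e₁ e₂ L
  rw [Category.id_comp] at e₁ e₂
  subst e₁ e₂
  refine Function.bijective_iff_has_inverse.2
    ⟨fun χ => vcomp (Category.id_comp _) (Category.id_comp _) ψ χ, fun χ => ?_, fun χ => ?_⟩ <;>
  apply toHom_injective <;>
  simp only [toHom_vcomp]
  · rw [← Category.assoc, ← toHom_hcellComp, h2, toHom_vid, Category.id_comp]
  · rw [← Category.assoc, ← toHom_hcellComp, h1, toHom_vid, Category.id_comp]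

/-- Opcartesian cells with equal tops and boundaries have isomorphic bottoms. Thus invertibility of
a horizontal cell, such as the one in the Beck–Chevalley condition, can be tested on universal
properties. -/
theorem IsOpcartesian.isInvertible_iff {A B C D : K} {f : A ⟶ C} {g : B ⟶ D} {J : Hor A B}
    {H H' : Hor C D} {φ : Cell f g J H} (hφ : IsOpcartesian φ) (ψ : HCell H H') :
    ψ.IsInvertible ↔ IsOpcartesian (below φ ψ) := by
  refine ⟨fun h => hφ.comp h.isOpcartesian, fun h => ?_⟩
  obtain ⟨χ, hχ⟩ := (h _ _ _ _ (Category.comp_id _) (Category.comp_id _) H).2 φ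
  have hχ' := congrArg toHom hχ
  simp only [toHom_vcomp, toHom_below] at hχ'
  refine ⟨χ, (hφ _ _ _ _ (Category.comp_id _) (Category.comp_id _) _).1 ?_,
    (h _ _ _ _ (Category.comp_id _) (Category.comp_id _) _).1 ?_⟩ <;>
  apply toHom_injective <;>
  simp only [toHom_vcomp, toHom_below, toHom_hcellComp, toHom_vid, Category.comp_id]
  · rw [← Category.assoc, hχ']
  · rw [← Category.assoc, hχ']

theorem leftUnitorInv_isInvertible {A B : K} (J : Hor A B) :
    HCell.IsInvertible (leftUnitorInv J) :=
  ⟨leftUnitor J, leftUnitorInv_leftUnitor J, leftUnitor_leftUnitorInv J⟩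

theorem rightUnitor_isInvertible {A B : K} (J : Hor A B) :
    HCell.IsInvertible (rightUnitor J) :=
  ⟨rightUnitorInv J, rightUnitor_rightUnitorInv J, rightUnitorInv_rightUnitor J⟩

/-- The cells `o` and `c` exhibit `F` as a companion of `f`. -/
structure IsCompanionPair {A C : K} {f : A ⟶ C} {F : Hor A C} (o : Cell (𝟙 A) f (unit A) F)
    (c : Cell f (𝟙 C) F (unit C)) : Prop where
  vert : toHom o ≫ toHom c = toHom (unitCell f)
  hor : toHom (hcompCell o c) ≫ (rightIso F).hom = (leftIso F).hom

/-- The cells `o` and `c` exhibit `G` as a conjoint of `g`. -/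
structure IsConjointPair {A C : K} {g : A ⟶ C} {G : Hor C A} (o : Cell g (𝟙 A) (unit A) G)
    (c : Cell (𝟙 C) g G (unit C)) : Prop where
  vert : toHom o ≫ toHom c = toHom (unitCell g)
  hor : toHom (hcompCell c o) ≫ (leftIso G).hom = (rightIso G).hom

/-- The vertical identity is the defining factorisation. The horizontal one may be checked after
composing with the cartesian cell, where it reduces to the vertical one and the coincidence of the
two unitors of a unit. -/
theorem Companion.isCompanionPair {A C : K} {f : A ⟶ C} (P : Companion f) :
    IsCompanionPair P.opcart P.cart := by
  have h : toHom P.opcart ≫ toHom P.cart = toHom (unitCell f) := by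
    rw [← toHom_vcomp (Category.id_comp f) (Category.comp_id f)]
    exact congrArg toHom (P.isCartesian (𝟙 A) f f f (Category.id_comp f) (Category.comp_id f)
      (unit A) (unitCell f)).choose_spec.1
  refine ⟨h, ?_⟩
  rw [← toHom_rightUnitor, ← toHom_leftUnitor,
    ← toHom_vcomp (Category.comp_id _) (Category.comp_id _)]
  refine congrArg toHom (P.isCartesian.ext ?_)
  rw [toHom_vcomp, Category.assoc, toHom_rightUnitor, ← rightIso_naturality,
    ← Category.assoc, toHom_hcompCell_comp (Category.id_comp f) (Category.comp_id f)
      (Category.comp_id _), unitCell_id, vcomp_vid, toHom_leftUnitor, ← leftIso_naturality,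
    leftIso_unit]
  congr 3
  exact toHom_injective ((toHom_vcomp _ _ _ _).trans h)

/-- The opcartesian cell that corresponds to the cartesian cell defining a conjoint. -/
noncomputable def Conjoint.opcart {A C : K} {g : A ⟶ C} (P : Conjoint g) :
    Cell g (𝟙 A) (unit A) P.hor :=
  (P.isCartesian g (𝟙 A) g g (Category.comp_id g) (Category.id_comp g)
    (unit A) (unitCell g)).choose

theorem Conjoint.isConjointPair {A C : K} {g : A ⟶ C} (P : Conjoint g) :
    IsConjointPair P.opcart P.cart := by
  have h : toHom P.opcart ≫ toHom P.cart = toHom (unitCell g) := by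
    rw [← toHom_vcomp (Category.comp_id g) (Category.id_comp g)]
    exact congrArg toHom (P.isCartesian g (𝟙 A) g g (Category.comp_id g) (Category.id_comp g)
      (unit A) (unitCell g)).choose_spec.1
  refine ⟨h, ?_⟩
  rw [← toHom_rightUnitor, ← toHom_leftUnitor,
    ← toHom_vcomp (Category.comp_id _) (Category.comp_id _)]
  refine congrArg toHom (P.isCartesian.ext ?_)
  rw [toHom_vcomp, Category.assoc, toHom_leftUnitor, ← leftIso_naturality,
    ← Category.assoc, toHom_hcompCell_comp (Category.comp_id _) (Category.comp_id g)
      (Category.id_comp g), unitCell_id, vcomp_vid, toHom_rightUnitor, ← rightIso_naturality,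
    leftIso_unit]
  congr 3
  exact toHom_injective ((toHom_vcomp _ _ _ _).trans h)

/-- The opcartesian cell of a companion is opcartesian. -/
theorem IsCompanionPair.isOpcartesian {A C : K} {f : A ⟶ C} {F : Hor A C}
    {o : Cell (𝟙 A) f (unit A) F} {c : Cell f (𝟙 C) F (unit C)} (h : IsCompanionPair o c) :
    IsOpcartesian o := by
  intro X Y p q r s e₁ e₂ L
  rw [Category.id_comp] at e₁
  subst e₁ e₂
  have key (χ : Cell p (f ≫ q) (unit A) L) : toHom (onTop (leftUnitorInv F) (below
      (hcompCell χ (vcomp rfl (Category.id_comp q) c (unitCell q))) (rightUnitor L))) =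
      (leftIso F).inv ≫ toHom (hcompCell χ (vcomp rfl (Category.id_comp q) c (unitCell q))) ≫
        (rightIso L).hom := by
    rw [toHom_onTop, toHom_below]; rfl
  -- The inverse pastes `c` on the right of a given cell. The horizontal identity of the pair gives
  -- one composite, the vertical identity the other.
  refine Function.bijective_iff_has_inverse.2 ⟨fun χ => onTop (leftUnitorInv F)
    (below (hcompCell χ (vcomp rfl (Category.id_comp q) c (unitCell q))) (rightUnitor L)),
    fun ψ => ?_, fun χ => ?_⟩ <;> apply toHom_injective
  · rw [key, ← toHom_hcompCell_comp (Category.id_comp _) rfl (Category.id_comp q), Category.assoc,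
      rightIso_naturality, reassoc_of% h.hor, Iso.inv_hom_id_assoc]
  · have h1 : vcomp (Category.id_comp _) rfl o (vcomp rfl (Category.id_comp q) c (unitCell q)) =
      unitCell (f ≫ q) := by
      apply toHom_injective
      rw [toHom_vcomp, toHom_vcomp, ← Category.assoc, h.vert, toHom_unitCell_comp rfl]
    rw [toHom_vcomp, key, ← reassoc_of% leftIso_inv_naturality,
      ← Category.assoc (toHom _), toHom_hcompCell_comp (Category.id_comp _) (Category.id_comp _) rfl,
      h1, unitCell_id, vid_vcomp, leftIso_unit, rightIso_naturality, Iso.inv_hom_id_assoc]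

/-- Composition with a conjoint on the left is an opcartesian extension. -/
theorem IsConjointPair.isOpcartesian_hcompCell {A C B : K} {g : A ⟶ C} {G : Hor C A}
    {o : Cell g (𝟙 A) (unit A) G} {c : Cell (𝟙 C) g G (unit C)} (h : IsConjointPair o c)
    (H : Hor A B) : IsOpcartesian (onTop (leftUnitorInv H) (hcompCell o (vid H))) := by
  intro X Y p q r s e₁ e₂ L
  rw [Category.id_comp] at e₂
  subst e₁ e₂
  refine Function.bijective_iff_has_inverse.2 ⟨fun χ => below
    (hcompCell (vcomp (Category.id_comp p) rfl c (unitCell p)) χ) (leftUnitor L),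
    fun ψ => ?_, fun χ => ?_⟩ <;> apply toHom_injective
  -- This is the horizontal identity of the pair, composed with `H`; the triangle axiom absorbs the
  -- unit between `G` and `H`.
  · have h2 : toHom (hcompCell c (onTop (leftUnitorInv H) (hcompCell o (vid H)))) ≫
        (leftIso (hcomp G H)).hom = 𝟙 _ := by
      have h3 : toHom (hcompCell c (onTop (leftUnitorInv H) (hcompCell o (vid H)))) =
        toHom (hcompCell (vid G) (leftUnitorInv H)) ≫
          toHom (hcompCell c (hcompCell o (vid H))) := by
        rw [toHom_hcompCell_comp (Category.id_comp _) (Category.id_comp _) (Category.id_comp _),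
          vid_vcomp]
        rfl
      have h4 : toHom (hcompCell c (hcompCell o (vid H))) ≫ (leftIso (hcomp G H)).hom =
          (assocIso _ _ _).inv ≫ toHom (hcompCell (rightUnitor G) (vid H)) := by
        have h5 : toHom (hcompCell (hcompCell c o) (vid H)) ≫
            toHom (hcompCell (leftUnitor G) (vid H)) =
              toHom (hcompCell (rightUnitor G) (vid H)) := by
          rw [toHom_hcompCell_comp (Category.comp_id _) (Category.comp_id _) (Category.comp_id _),
            vcomp_vid]
          congr 2
          exact toHom_injective ((toHom_vcomp _ _ _ _).trans h.hor)
        rw [← h5, ← leftIso_hcomp, reassoc_of% assocIso_inv_naturality, Iso.inv_hom_id_assoc]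
      rw [h3, Category.assoc, h4, ← triangleIso, Iso.inv_hom_id_assoc,
        toHom_hcompCell_comp (Category.id_comp _) (Category.id_comp _) (Category.id_comp _),
        leftUnitorInv_leftUnitor, vid_vcomp, toHom_hcompCell_vid]
    rw [toHom_below, ← toHom_hcompCell_comp (Category.id_comp p) rfl (Category.id_comp _),
      Category.assoc, toHom_leftUnitor, leftIso_naturality, reassoc_of% h2]
  · have h1 : vcomp rfl (Category.id_comp _) o (vcomp (Category.id_comp p) rfl c (unitCell p)) =
      unitCell (g ≫ p) := by
      apply toHom_injective
      rw [toHom_vcomp, toHom_vcomp, ← Category.assoc, h.vert, toHom_unitCell_comp rfl]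
    rw [toHom_vcomp, toHom_below, toHom_onTop, Category.assoc, ← Category.assoc (toHom (hcompCell o _)),
      toHom_hcompCell_comp rfl (Category.id_comp _) (Category.id_comp _), h1, vid_vcomp, toHom_leftUnitor,
      leftIso_naturality, toHom_leftUnitorInv, Iso.inv_hom_id_assoc]

/-- The opcartesian cell of a conjoint is opcartesian. -/
theorem IsConjointPair.isOpcartesian {A C : K} {g : A ⟶ C} {G : Hor C A}
    {o : Cell g (𝟙 A) (unit A) G} {c : Cell (𝟙 C) g G (unit C)} (h : IsConjointPair o c) :
    IsOpcartesian o := by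
  -- The preceding extension result for a unit `H`, up to the right unitor of `G`.
  have h1 := (((h.isOpcartesian_hcompCell (unit A)).isInvertible_iff (rightUnitor G)).1
    (rightUnitor_isInvertible G))
  convert h1
  apply toHom_injective
  rw [toHom_below, toHom_onTop, Category.assoc, toHom_rightUnitor, ← unitCell_id,
    rightIso_naturality, toHom_leftUnitorInv, leftIso_unit, Iso.inv_hom_id_assoc]

/-- Composition with a companion on the left is a restriction; this is the uniqueness part. -/
theorem IsCompanionPair.hcompCell_ext {A B C X Y : K} {f : A ⟶ C} {F : Hor A C}
    {o : Cell (𝟙 A) f (unit A) F} {c : Cell f (𝟙 C) F (unit C)} (h : IsCompanionPair o c)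
    {H : Hor C B} {L : Hor X Y} {p : X ⟶ A} {q : Y ⟶ B} {χ ψ : Cell p q L (hcomp F H)}
    (e : toHom χ ≫ toHom (hcompCell c (vid H)) = toHom ψ ≫ toHom (hcompCell c (vid H))) :
    χ = ψ := by
  have h1 : (leftIso (hcomp F H)).inv ≫ toHom (hcompCell o (below (hcompCell c (vid H))
      (leftUnitor H))) = 𝟙 _ := by
    have h2 : toHom (hcompCell o (below (hcompCell c (vid H)) (leftUnitor H))) =
        toHom (hcompCell o (hcompCell c (vid H))) ≫ toHom (hcompCell (vid F) (leftUnitor H)) := by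
      rw [toHom_hcompCell_comp (Category.comp_id _) (Category.comp_id _) (Category.comp_id _),
        vcomp_vid]
      rfl
    have h3 : toHom (hcompCell (hcompCell o c) (vid H)) ≫
          toHom (hcompCell (rightUnitor F) (vid H)) = toHom (hcompCell (leftUnitor F) (vid H)) := by
      rw [toHom_hcompCell_comp (Category.comp_id _) (Category.comp_id _) (Category.comp_id _),
        vcomp_vid]
      congr 2
      exact toHom_injective ((toHom_vcomp _ _ _ _).trans h.hor)
    rw [h2, ← cancel_epi (leftIso (hcomp F H)).hom, Iso.hom_inv_id_assoc, Category.comp_id,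
      ← cancel_epi (assocIso _ _ _).hom, leftIso_hcomp, ← reassoc_of% assocIso_naturality,
      triangleIso, h3]
  -- Pasting `o` back on the left recovers `χ` from its composite with `c`.
  have h4 (χ : Cell p q L (hcomp F H)) : (leftIso L).inv ≫ toHom (hcompCell
      (vcomp (Category.comp_id p) rfl (unitCell p) o) (below
        (vcomp rfl (Category.comp_id q) χ (hcompCell c (vid H))) (leftUnitor H))) = toHom χ := by
    have h5 : below (vcomp rfl (Category.comp_id q) χ (hcompCell c (vid H))) (leftUnitor H) =
        vcomp rfl (Category.comp_id q) χ (below (hcompCell c (vid H)) (leftUnitor H)) := by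
      apply toHom_injective
      simp only [toHom_vcomp, toHom_below, Category.assoc]
    rw [h5, ← toHom_hcompCell_comp (Category.comp_id p) rfl (Category.comp_id q),
      reassoc_of% leftIso_inv_naturality, h1, Category.comp_id]
  apply toHom_injective
  rw [← h4 χ, ← h4 ψ]
  congr 4
  apply toHom_injective
  rw [toHom_vcomp, toHom_vcomp, e]

end Opcartesian
-- The vertical 2-category: interchange and adjunctions.
section VerticalCells

variable {K : Type u} [DoubleCategory.{v, u, w, z} K]

/-- Equality in `HorObj K` already forces the boundaries to agree. Pastings can therefore be
compared factor by factor although their boundaries are only propositionally equal. -/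
theorem toHom_lact_congr {A B C D : K} {f f' k k' : A ⟶ C} {g g' : B ⟶ D} {J : Hor A B}
    {H : Hor C D} {α : VCell f' f} {χ : Cell f g J H} {β : VCell k' k} {ψ : Cell k g' J H}
    (h : toHom α = toHom β) (h' : toHom χ = toHom ψ) : toHom (lact α χ) = toHom (lact β ψ) := by
  obtain ⟨rfl, rfl, h⟩ := HorHom.mk.inj h
  obtain ⟨-, rfl, h'⟩ := HorHom.mk.inj h'
  rw [eq_of_heq h, eq_of_heq h']

theorem toHom_vComp_congr {A C : K} {f g h f' g' h' : A ⟶ C} {φ : VCell f g} {ψ : VCell g h}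
    {φ' : VCell f' g'} {ψ' : VCell g' h'} (e : toHom φ = toHom φ') (e' : toHom ψ = toHom ψ') :
    toHom (φ.comp ψ) = toHom (φ'.comp ψ') :=
  toHom_lact_congr e e'

theorem toHom_lact_of_eq_unitCell {A B C D : K} {f f' k : A ⟶ C} {g : B ⟶ D} {J : Hor A B}
    {H : Hor C D} {α : VCell f' f} {χ : Cell f g J H} (h : toHom α = toHom (unitCell k)) :
    toHom (lact α χ) = toHom χ := by
  obtain ⟨rfl, rfl, h⟩ := HorHom.mk.inj h
  rw [eq_of_heq h, unitCell_lact]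

theorem toHom_vComp_of_eq_unitCell_left {A C : K} {f g h k : A ⟶ C} {φ : VCell f g}
    {ψ : VCell g h} (e : toHom φ = toHom (unitCell k)) : toHom (φ.comp ψ) = toHom ψ :=
  toHom_lact_of_eq_unitCell e

theorem toHom_vComp_of_eq_unitCell_right {A C : K} {f g h k : A ⟶ C} {φ : VCell f g}
    {ψ : VCell g h} (e : toHom ψ = toHom (unitCell k)) : toHom (φ.comp ψ) = toHom φ := by
  obtain ⟨rfl, rfl, e⟩ := HorHom.mk.inj e
  rw [eq_of_heq e, vComp_unitCell]

theorem toHom_idVCell {A C : K} {f g : A ⟶ C} (e : f = g) :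
    toHom (idVCell e) = toHom (unitCell f) := by
  rw [idVCell, toHom_recast]

theorem toHom_preWhisker {A C E : K} (f : A ⟶ C) {g h : C ⟶ E} (φ : VCell g h) :
    toHom (preWhisker f φ) = toHom (unitCell f) ≫ toHom φ := rfl

theorem toHom_postWhisker {A C E : K} {f g : A ⟶ C} (φ : VCell f g) (h : C ⟶ E) :
    toHom (postWhisker φ h) = toHom φ ≫ toHom (unitCell h) := rfl

theorem vcomp_vComp {A C E : K} {f g h : A ⟶ C} {f' g' h' : C ⟶ E} {p q r : A ⟶ E}
    (e₁ : f ≫ f' = p) (e₂ : g ≫ g' = q) (e₃ : h ≫ h' = r) (α : VCell f g) (β : VCell g h)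
    (α' : VCell f' g') (β' : VCell g' h') :
    vcomp e₁ e₃ (α.comp β) (α'.comp β') =
      VCell.comp (vcomp e₁ e₂ α α') (vcomp e₂ e₃ β β') :=
  vcomp_lact e₂ e₃ e₁ α α' β β'

theorem unitCell_vcomp_vComp {A C E : K} {f : A ⟶ C} {f' g' h' : C ⟶ E} {p q r : A ⟶ E}
    (e₁ : f ≫ f' = p) (e₂ : f ≫ g' = q) (e₃ : f ≫ h' = r)
    (α' : VCell f' g') (β' : VCell g' h') :
    vcomp e₁ e₃ (unitCell f) (α'.comp β') =
      VCell.comp (vcomp e₁ e₂ (unitCell f) α') (vcomp e₂ e₃ (unitCell f) β') := by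
  rw [← vcomp_vComp, unitCell_vComp]

theorem vComp_vcomp_unitCell {A C E : K} {f g h : A ⟶ C} {f' : C ⟶ E} {p q r : A ⟶ E}
    (e₁ : f ≫ f' = p) (e₂ : g ≫ f' = q) (e₃ : h ≫ f' = r) (α : VCell f g) (β : VCell g h) :
    vcomp e₁ e₃ (α.comp β) (unitCell f') =
      VCell.comp (vcomp e₁ e₂ α (unitCell f')) (vcomp e₂ e₃ β (unitCell f')) := by
  rw [← vcomp_vComp, unitCell_vComp]

theorem vcomp_exchange {A C E : K} {f f' : A ⟶ C} {h h' : C ⟶ E} {p q r : A ⟶ E}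
    (e₁ : f ≫ h = p) (e₂ : f' ≫ h = q) (e₃ : f' ≫ h' = r) (α : VCell f f') (β : VCell h h') :
    VCell.comp (vcomp e₁ e₂ α (unitCell h)) (vcomp e₂ e₃ (unitCell f') β) = vcomp e₁ e₃ α β := by
  rw [← vcomp_vComp, vComp_unitCell, unitCell_vComp]

theorem vcomp_exchange' {A C E : K} {f f' : A ⟶ C} {h h' : C ⟶ E} {p q r : A ⟶ E}
    (e₁ : f ≫ h = p) (e₂ : f ≫ h' = q) (e₃ : f' ≫ h' = r) (α : VCell f f') (β : VCell h h') :
    VCell.comp (vcomp e₁ e₂ (unitCell f) β) (vcomp e₂ e₃ α (unitCell h')) = vcomp e₁ e₃ α β := by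
  rw [← vcomp_vComp, vComp_unitCell, unitCell_vComp]

/-- Adjunctions in the vertical 2-category. -/
structure IsVAdjunction {A X : K} {i : A ⟶ X} {m : X ⟶ A} (unit : VCell (𝟙 A) (i ≫ m))
    (counit : VCell (m ≫ i) (𝟙 X)) : Prop where
  left_triangle : VCell.comp (vcomp (Category.id_comp i) (Category.assoc i m i) unit (unitCell i))
    (vcomp rfl (Category.comp_id i) (unitCell i) counit) = unitCell i
  right_triangle : VCell.comp (vcomp (Category.comp_id m) rfl (unitCell m) unit)
    (vcomp (Category.assoc m i m) (Category.id_comp m) counit (unitCell m)) = unitCell m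

/-- The mate correspondence. The inverse pastes with the counit; the right triangle gives one
composite and the left triangle the other. -/
theorem IsVAdjunction.bijective {A X M : K} {i : A ⟶ X} {m : X ⟶ A}
    {unit : VCell (𝟙 A) (i ≫ m)} {counit : VCell (m ≫ i) (𝟙 X)}
    (h : IsVAdjunction unit counit) (f : A ⟶ M) (k : X ⟶ M) :
    Function.Bijective fun φ : VCell (m ≫ f) k =>
      VCell.comp (vcomp (Category.id_comp f) (Category.assoc i m f) unit (unitCell f))
        (vcomp rfl rfl (unitCell i) φ) := by
  refine Function.bijective_iff_has_inverse.2 ⟨fun χ =>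
    VCell.comp (vcomp rfl rfl (unitCell m) χ)
      (vcomp (Category.assoc m i k) (Category.id_comp k) counit (unitCell k)),
    fun φ => ?_, fun χ => ?_⟩ <;> dsimp only
  · rw [unitCell_vcomp_vComp rfl (show m ≫ i ≫ m ≫ f = m ≫ i ≫ m ≫ f from rfl) rfl, vComp_assoc]
    have h1 : VCell.comp (vcomp rfl rfl (unitCell m) (vcomp rfl rfl (unitCell i) φ))
        (vcomp (Category.assoc m i k) (Category.id_comp k) counit (unitCell k)) =
        VCell.comp (vcomp (by simp : (m ≫ i ≫ m) ≫ f = m ≫ i ≫ m ≫ f) rfl (vcomp (Category.assoc m i m) (Category.id_comp m)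
          counit (unitCell m)) (unitCell f)) φ := by
      have h2 : vcomp rfl rfl (unitCell m) (vcomp rfl rfl (unitCell i) φ) =
          vcomp (by simp) (by simp) (unitCell (m ≫ i)) φ := by
        apply toHom_injective
        simp only [toHom_vcomp, ← toHom_unitCell_comp (rfl : m ≫ i = _), Category.assoc]
      have h3 : vcomp (by simp : (m ≫ i ≫ m) ≫ f = m ≫ i ≫ m ≫ f) rfl (vcomp (Category.assoc m i m) (Category.id_comp m)
          counit (unitCell m)) (unitCell f) =
          vcomp (by simp) (by simp) counit (unitCell (m ≫ f)) := by
        apply toHom_injective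
        simp only [toHom_vcomp, ← toHom_unitCell_comp (rfl : m ≫ f = _), Category.assoc]
      rw [h2, h3, vcomp_exchange' _ _ _ counit φ]
      have h4 := vcomp_exchange (show (m ≫ i) ≫ m ≫ f = m ≫ i ≫ m ≫ f by simp)
        (Category.id_comp (m ≫ f)) (Category.id_comp k) counit φ
      rw [unitCell_id, vid_vcomp] at h4
      exact h4.symm
    have h5 : vcomp rfl rfl (unitCell m) (vcomp (Category.id_comp f) (Category.assoc i m f)
        unit (unitCell f)) = vcomp rfl (by simp) (vcomp (Category.comp_id m) rfl (unitCell m) unit)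
          (unitCell f) := by
      apply toHom_injective
      simp only [toHom_vcomp, Category.assoc]
    rw [h1, ← vComp_assoc, h5, ← vComp_vcomp_unitCell, h.right_triangle, vcomp_unitCell,
      unitCell_vComp]
  · rw [unitCell_vcomp_vComp rfl (show i ≫ m ≫ i ≫ k = i ≫ m ≫ i ≫ k from rfl) rfl, ← vComp_assoc]
    have h1 : VCell.comp (vcomp (Category.id_comp f) (Category.assoc i m f) unit (unitCell f))
        (vcomp rfl rfl (unitCell i) (vcomp rfl rfl (unitCell m) χ)) =
        VCell.comp χ (vcomp rfl (by simp : (i ≫ m ≫ i) ≫ k = i ≫ m ≫ i ≫ k) (vcomp (Category.id_comp i) (Category.assoc i m i)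
          unit (unitCell i)) (unitCell k)) := by
      have h2 : vcomp rfl rfl (unitCell i) (vcomp rfl rfl (unitCell m) χ) =
          vcomp (by simp) (by simp) (unitCell (i ≫ m)) χ := by
        apply toHom_injective
        simp only [toHom_vcomp, ← toHom_unitCell_comp (rfl : i ≫ m = _), Category.assoc]
      have h3 : vcomp rfl (by simp : (i ≫ m ≫ i) ≫ k = i ≫ m ≫ i ≫ k) (vcomp (Category.id_comp i) (Category.assoc i m i)
          unit (unitCell i)) (unitCell k) =
          vcomp (Category.id_comp _) (by simp) unit (unitCell (i ≫ k)) := by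
        apply toHom_injective
        simp only [toHom_vcomp, ← toHom_unitCell_comp (rfl : i ≫ k = _), Category.assoc]
      rw [h2, h3, vcomp_exchange _ _ _ unit χ]
      have h4 := vcomp_exchange' (Category.id_comp f) (Category.id_comp (i ≫ k))
        (show (i ≫ m) ≫ i ≫ k = i ≫ m ≫ i ≫ k by simp) unit χ
      rw [unitCell_id, vid_vcomp] at h4
      exact h4.symm
    have h5 : vcomp rfl rfl (unitCell i) (vcomp (Category.assoc m i k) (Category.id_comp k)
        counit (unitCell k)) = vcomp (by simp) rfl (vcomp rfl (Category.comp_id i) (unitCell i)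
          counit) (unitCell k) := by
      apply toHom_injective
      simp only [toHom_vcomp, Category.assoc]
    rw [h1, vComp_assoc, h5, ← vComp_vcomp_unitCell, h.left_triangle, vcomp_unitCell,
      vComp_unitCell]

end VerticalCells

/-! ### The action of a normal lax double monad on vertical cells. -/

namespace NormalLaxDoubleMonad

variable {K : Type u} [DoubleCategory.{v, u, w, z} K] (T : NormalLaxDoubleMonad K)

/-- The functorial action of `T` on cells. -/
def hmap {A B C D : K} {J : Hor A B} {H : Hor C D} (φ : HorObj.mk J ⟶ HorObj.mk H) :
    HorObj.mk (T.mapHor J) ⟶ HorObj.mk (T.mapHor H) :=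
  toHom (T.mapCell (HorHom.cell φ))

theorem toHom_mapCell {A B C D : K} {f : A ⟶ C} {g : B ⟶ D} {J : Hor A B} {H : Hor C D}
    (φ : Cell f g J H) : toHom (T.mapCell φ) = T.hmap (toHom φ) := rfl

theorem hmap_id {A B : K} (J : Hor A B) : T.hmap (𝟙 (HorObj.mk J)) = 𝟙 _ := by
  change toHom (T.mapCell (vid J)) = _
  rw [T.mapCell_vid, toHom_recast]; rfl

theorem hmap_comp {A B C D E F : K} {J : Hor A B} {H : Hor C D} {L : Hor E F}
    (φ : HorObj.mk J ⟶ HorObj.mk H) (ψ : HorObj.mk H ⟶ HorObj.mk L) :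
    T.hmap (φ ≫ ψ) = T.hmap φ ≫ T.hmap ψ := by
  change toHom (T.mapCell (vcomp rfl rfl (HorHom.cell φ) (HorHom.cell ψ))) = _
  rw [T.mapCell_vcomp, toHom_vcomp]; rfl

/-- The action of `T` on invertible cells. -/
@[simps]
def hmapIso {A B C D : K} {J : Hor A B} {H : Hor C D} (φ : HorObj.mk J ≅ HorObj.mk H) :
    HorObj.mk (T.mapHor J) ≅ HorObj.mk (T.mapHor H) where
  hom := T.hmap φ.hom
  inv := T.hmap φ.inv
  hom_inv_id := by rw [← hmap_comp, Iso.hom_inv_id, hmap_id]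
  inv_hom_id := by rw [← hmap_comp, Iso.inv_hom_id, hmap_id]

theorem toHom_idHCell_comp {A B : K} {J H : Hor A B} (e : J = H) (e' : H = J) :
    toHom (idHCell e) ≫ toHom (idHCell e') = 𝟙 _ := by
  subst e; exact Category.id_comp _

/-- The identity cell between the unit of `T A` and the image of the unit of `A`. -/
def unitIso (A : K) : HorObj.mk (unit (T.obj A)) ≅ HorObj.mk (T.mapHor (unit A)) where
  hom := toHom (idHCell (T.mapHor_unit A).symm)
  inv := toHom (idHCell (T.mapHor_unit A))
  hom_inv_id := toHom_idHCell_comp _ _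
  inv_hom_id := toHom_idHCell_comp _ _

theorem unitIso_hom (A : K) : (T.unitIso A).hom = toHom (T.unitor A) := by
  rw [T.unitor_eq]; rfl

theorem toHom_mapToUnit {A B M : K} {f : A ⟶ M} {g : B ⟶ M} {J : Hor A B}
    (φ : Cell f g J (unit M)) :
    toHom (T.mapToUnit φ) = T.hmap (toHom φ) ≫ (T.unitIso M).inv :=
  toHom_below _ _

theorem toHom_mapVCell {A C : K} {f g : A ⟶ C} (φ : VCell f g) :
    toHom (T.mapVCell φ) =
      (T.unitIso A).hom ≫ T.hmap (toHom φ) ≫ (T.unitIso C).inv := by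
  rw [mapVCell, toHom_onTop, toHom_mapToUnit]; rfl

theorem toHom_mapVCell_unitCell {A C : K} (f : A ⟶ C) :
    toHom (T.mapVCell (unitCell f)) = toHom (unitCell (T.map f)) := by
  have h := congrArg toHom (T.unitor_naturality f)
  rw [toHom_below, toHom_onTop, ← unitIso_hom, ← unitIso_hom] at h
  rw [toHom_mapVCell, ← toHom_mapCell, ← Category.assoc, ← h, Category.assoc, Iso.hom_inv_id,
    Category.comp_id]

theorem toHom_mapVCell_vcomp {A C E : K} {f f' : A ⟶ C} {h h' : C ⟶ E} {p q : A ⟶ E}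
    (e₁ : f ≫ h = p) (e₂ : f' ≫ h' = q) (α : VCell f f') (β : VCell h h') :
    toHom (T.mapVCell (vcomp e₁ e₂ α β)) = toHom (T.mapVCell α) ≫ toHom (T.mapVCell β) := by
  simp only [toHom_mapVCell, toHom_vcomp, hmap_comp, Category.assoc,
    Iso.inv_hom_id_assoc]

/-- Normality makes the unitor of `T` invertible, so it can be moved to the other side of the
unitality axiom. -/
theorem compositor_leftIso {A B : K} (J : Hor A B) :
    toHom (hcompCell (idHCell (T.mapHor_unit A)) (vid (T.mapHor J))) ≫
        (leftIso (T.mapHor J)).hom =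
      toHom (T.compositor (unit A) J) ≫ T.hmap (leftIso J).hom := by
  have h := congrArg toHom (T.left_unitality J)
  rw [toHom_hcellComp, toHom_hcellComp, toHom_recast, T.unitor_eq] at h
  rw [← toHom_leftUnitor, ← h, Category.assoc, ← Category.assoc,
    toHom_hcompCell_comp (Category.id_comp _) (Category.id_comp _) (Category.id_comp _),
    vid_vcomp]
  have h1 : vcomp (Category.id_comp _) (Category.id_comp _) (idHCell (T.mapHor_unit A))
      (idHCell (T.mapHor_unit A).symm) = vid _ :=
    toHom_injective ((toHom_vcomp _ _ _ _).trans (toHom_idHCell_comp _ _))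
  rw [h1, toHom_hcompCell_vid, Category.id_comp]
  rfl

theorem compositor_rightIso {A B : K} (J : Hor A B) :
    toHom (hcompCell (vid (T.mapHor J)) (idHCell (T.mapHor_unit B))) ≫
        (rightIso (T.mapHor J)).hom =
      toHom (T.compositor J (unit B)) ≫ T.hmap (rightIso J).hom := by
  have h := congrArg toHom (T.right_unitality J)
  rw [toHom_hcellComp, toHom_hcellComp, toHom_recast, T.unitor_eq] at h
  rw [← toHom_rightUnitor, ← h, Category.assoc, ← Category.assoc,
    toHom_hcompCell_comp (Category.id_comp _) (Category.id_comp _) (Category.id_comp _),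
    vid_vcomp]
  have h1 : vcomp (Category.id_comp _) (Category.id_comp _) (idHCell (T.mapHor_unit B))
      (idHCell (T.mapHor_unit B).symm) = vid _ :=
    toHom_injective ((toHom_vcomp _ _ _ _).trans (toHom_idHCell_comp _ _))
  rw [h1, toHom_hcompCell_vid, Category.id_comp]
  rfl

theorem leftIso_compositor {A B : K} (J : Hor A B) :
    toHom (hcompCell (T.unitor A) (vid (T.mapHor J))) ≫ toHom (T.compositor (unit A) J) ≫
      T.hmap (leftIso J).hom = (leftIso (T.mapHor J)).hom := by
  have h := congrArg toHom (T.left_unitality J)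
  rw [toHom_hcellComp, toHom_hcellComp, toHom_recast, Category.assoc] at h
  exact h

theorem rightIso_compositor {A B : K} (J : Hor A B) :
    toHom (hcompCell (vid (T.mapHor J)) (T.unitor B)) ≫ toHom (T.compositor J (unit B)) ≫
      T.hmap (rightIso J).hom = (rightIso (T.mapHor J)).hom := by
  have h := congrArg toHom (T.right_unitality J)
  rw [toHom_hcellComp, toHom_hcellComp, toHom_recast, Category.assoc] at h
  exact h

theorem toHom_compositor_naturality {A B E C D F : K} {f : A ⟶ C} {g : B ⟶ D} {h : E ⟶ F}
    {J : Hor A B} {H : Hor B E} {P : Hor C D} {Q : Hor D F}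
    (φ : Cell f g J P) (ψ : Cell g h H Q) :
    toHom (hcompCell (T.mapCell φ) (T.mapCell ψ)) ≫ toHom (T.compositor P Q) =
      toHom (T.compositor J H) ≫ T.hmap (toHom (hcompCell φ ψ)) := by
  have h := congrArg toHom (T.compositor_naturality φ ψ)
  rwa [toHom_below, toHom_onTop] at h

/-- The image of a cell whose top is a unit, where `T 1 = 1`. -/
def mapFromUnit {A C D : K} {f : A ⟶ C} {g : A ⟶ D} {H : Hor C D} {p : T.obj A ⟶ T.obj C}
    {q : T.obj A ⟶ T.obj D} (e₁ : T.map f = p) (e₂ : T.map g = q) (φ : Cell f g (unit A) H) :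
    Cell p q (unit (T.obj A)) (T.mapHor H) :=
  vcomp ((Category.id_comp _).trans e₁) ((Category.id_comp _).trans e₂) (T.unitor A)
    (T.mapCell φ)

theorem toHom_mapFromUnit {A C D : K} {f : A ⟶ C} {g : A ⟶ D} {H : Hor C D}
    {p : T.obj A ⟶ T.obj C} {q : T.obj A ⟶ T.obj D} (e₁ : T.map f = p) (e₂ : T.map g = q)
    (φ : Cell f g (unit A) H) :
    toHom (T.mapFromUnit e₁ e₂ φ) = (T.unitIso A).hom ≫ T.hmap (toHom φ) := by
  rw [mapFromUnit, toHom_vcomp, unitIso_hom]; rfl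

/-- Compositors need not be invertible, but by unitality and normality the one at `1 ⊙ 1` is a
composite of unitors and identity cells; it cancels. -/
theorem mapVCell_vComp {A C : K} {f g h : A ⟶ C} (φ : VCell f g) (ψ : VCell g h) :
    T.mapVCell (φ.comp ψ) = (T.mapVCell φ).comp (T.mapVCell ψ) := by
  have hl (A : K) : toHom (hcompCell (T.unitor A) (T.unitor A)) ≫
      toHom (T.compositor (unit A) (unit A)) =
        (leftIso _).hom ≫ (T.unitIso A).hom ≫ T.hmap (leftIso (unit A)).inv := by
    rw [← Category.assoc, ← hmapIso_inv, Iso.eq_comp_inv, hmapIso_hom, unitIso_hom,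
      ← leftIso_naturality, ← leftIso_compositor, Category.assoc, ← Category.assoc (toHom _)
      (toHom _) (toHom _ ≫ _), toHom_hcompCell_comp (Category.id_comp _) (Category.id_comp _)
      (Category.id_comp _), unitCell_id, vid_vcomp, vcomp_vid]
  have hr (C : K) : toHom (hcompCell (idHCell (T.mapHor_unit C)) (idHCell (T.mapHor_unit C))) ≫
      (leftIso _).hom = toHom (T.compositor (unit C) (unit C)) ≫
        T.hmap (leftIso (unit C)).hom ≫ (T.unitIso C).inv := by
    rw [← Category.assoc, ← compositor_leftIso, Category.assoc]
    change _ = _ ≫ _ ≫ toHom (idHCell (T.mapHor_unit C))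
    rw [← leftIso_naturality, ← Category.assoc, unitCell_id, toHom_hcompCell_comp
      (Category.id_comp _) (Category.id_comp _) (Category.id_comp _), vid_vcomp, vcomp_vid]
  have hm : hcompCell (T.mapVCell φ) (T.mapVCell ψ) = vcomp (Category.id_comp _)
      (Category.id_comp _) (hcompCell (T.unitor A) (T.unitor A)) (vcomp (Category.comp_id _)
        (Category.comp_id _) (hcompCell (T.mapCell φ) (T.mapCell ψ))
          (hcompCell (idHCell (T.mapHor_unit C)) (idHCell (T.mapHor_unit C)))) := by
    rw [← hcompCell_vcomp (Category.comp_id _) (Category.comp_id _) (Category.comp_id _),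
      ← hcompCell_vcomp (Category.id_comp _) (Category.id_comp _) (Category.id_comp _),
      T.unitor_eq]
    rfl
  apply toHom_injective
  rw [comp_eq_lact, comp_eq_lact, toHom_lact, hm, toHom_vcomp, toHom_vcomp]
  simp only [Category.assoc]
  rw [hr, reassoc_of% toHom_compositor_naturality, reassoc_of% hl, Iso.inv_hom_id_assoc,
    toHom_mapVCell, toHom_lact]
  simp only [hmap_comp, Category.assoc]

end NormalLaxDoubleMonad
-- The unit of the monad on cells; preservation of companions and conjoints.
namespace NormalLaxDoubleMonad

variable {K : Type u} [DoubleCategory.{v, u, w, z} K] (T : NormalLaxDoubleMonad K)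

theorem ιCell_naturality {A B C D : K} {f : A ⟶ C} {g : B ⟶ D} {J : Hor A B} {H : Hor C D}
    (φ : Cell f g J H) : toHom φ ≫ toHom (T.ιCell H) = toHom (T.ιCell J) ≫ T.hmap (toHom φ) := by
  have h := congrArg toHom (T.ι.cell_naturality φ)
  rwa [toHom_vcomp, toHom_vcomp] at h

theorem ιCell_unit (A : K) :
    toHom (T.ιCell (unit A)) = toHom (unitCell (T.ιApp A)) ≫ (T.unitIso A).hom := by
  have h := congrArg toHom (T.ι.cell_unit A)
  rw [toHom_onTop, toHom_below, ← unitIso_hom] at h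
  exact (Category.id_comp _).symm.trans h

theorem ιApp_naturality_vCell {A C : K} {f g : A ⟶ C} (φ : VCell f g) :
    toHom φ ≫ toHom (unitCell (T.ιApp C)) =
      toHom (unitCell (T.ιApp A)) ≫ toHom (T.mapVCell φ) := by
  have h := T.ιCell_naturality φ
  rw [ιCell_unit, ιCell_unit, ← Category.assoc, ← Iso.eq_comp_inv] at h
  rw [h, toHom_mapVCell]
  simp only [Category.assoc]

/-- Companion pairs are defined by equations, so they survive although `T` is only lax: naturality
exchanges the compositor at `F ⊙ 1` for that at `1 ⊙ F`, and both are absorbed by unitality. -/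
theorem isCompanionPair_map {A C : K} {f : A ⟶ C} {F : Hor A C} {o : Cell (𝟙 A) f (unit A) F}
    {c : Cell f (𝟙 C) F (unit C)} (h : IsCompanionPair o c) :
    IsCompanionPair (T.mapFromUnit (T.map_id A) rfl o)
      (recast rfl (T.map_id C) (T.mapToUnit c)) where
  vert := by
    rw [toHom_mapFromUnit, toHom_recast, toHom_mapToUnit, ← T.toHom_mapVCell_unitCell,
      toHom_mapVCell, ← h.vert, hmap_comp]
    simp only [Category.assoc]
  hor := by
    have hm : hcompCell (T.mapFromUnit (T.map_id A) rfl o)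
        (recast rfl (T.map_id C) (T.mapToUnit c)) = vcomp (by simp) (Category.id_comp _)
          (hcompCell (T.unitor A) (vid (T.mapHor F))) (vcomp (Category.comp_id _) (by simp)
          (hcompCell (T.mapCell o) (T.mapCell c))
            (hcompCell (vid (T.mapHor F)) (idHCell (T.mapHor_unit C)))) := by
      rw [← hcompCell_vcomp (Category.comp_id _) (Category.comp_id _) (by simp),
        ← hcompCell_vcomp (by simp) (Category.id_comp _) (Category.id_comp _), vcomp_vid,
        vid_vcomp]
      congr 1
      apply toHom_injective
      rw [toHom_recast, toHom_vcomp]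
      exact toHom_mapToUnit _ _
    rw [hm, toHom_vcomp, toHom_vcomp, Category.assoc, Category.assoc, compositor_rightIso,
      reassoc_of% toHom_compositor_naturality, ← hmap_comp, h.hor, leftIso_compositor]

theorem isConjointPair_map {A C : K} {g : A ⟶ C} {G : Hor C A} {o : Cell g (𝟙 A) (unit A) G}
    {c : Cell (𝟙 C) g G (unit C)} (h : IsConjointPair o c) :
    IsConjointPair (T.mapFromUnit rfl (T.map_id A) o)
      (recast (T.map_id C) rfl (T.mapToUnit c)) where
  vert := by
    rw [toHom_mapFromUnit, toHom_recast, toHom_mapToUnit, ← T.toHom_mapVCell_unitCell,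
      toHom_mapVCell, ← h.vert, hmap_comp]
    simp only [Category.assoc]
  hor := by
    have hm : hcompCell (recast (T.map_id C) rfl (T.mapToUnit c))
        (T.mapFromUnit rfl (T.map_id A) o) = vcomp (Category.id_comp _) (by simp)
          (hcompCell (vid (T.mapHor G)) (T.unitor A)) (vcomp (by simp) (Category.comp_id _)
          (hcompCell (T.mapCell c) (T.mapCell o))
            (hcompCell (idHCell (T.mapHor_unit C)) (vid (T.mapHor G)))) := by
      rw [← hcompCell_vcomp (by simp) (Category.comp_id _) (Category.comp_id _),
        ← hcompCell_vcomp (Category.id_comp _) (Category.id_comp _) (by simp), vcomp_vid,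
        vid_vcomp]
      congr 1
      apply toHom_injective
      rw [toHom_recast, toHom_vcomp]
      exact toHom_mapToUnit _ _
    rw [hm, toHom_vcomp, toHom_vcomp, Category.assoc, Category.assoc, compositor_leftIso,
      reassoc_of% toHom_compositor_naturality, ← hmap_comp, h.hor, rightIso_compositor]

end NormalLaxDoubleMonad

/-! ### Vertical cells that are identities up to equality of boundaries. -/

section IsIdentity

variable {K : Type u} [DoubleCategory.{v, u, w, z} K]

/-- A vertical cell that is a unit cell, up to an equality of its boundaries. -/
def VCell.IsIdentity {A C : K} {f g : A ⟶ C} (φ : VCell f g) : Prop :=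
  toHom φ = toHom (unitCell f)

namespace VCell.IsIdentity

theorem of_eq {A C : K} {f g h : A ⟶ C} {φ : VCell f g} (e : toHom φ = toHom (unitCell h)) :
    φ.IsIdentity := by
  obtain ⟨rfl, -, -⟩ := HorHom.mk.inj e
  exact e

theorem eq {A C : K} {f g : A ⟶ C} {φ ψ : VCell f g} (hφ : φ.IsIdentity) (hψ : ψ.IsIdentity) :
    φ = ψ :=
  toHom_injective (hφ.trans hψ.symm)

theorem unitCell {A C : K} (f : A ⟶ C) : VCell.IsIdentity (unitCell f) := rfl

theorem idVCell {A C : K} {f g : A ⟶ C} (e : f = g) : VCell.IsIdentity (idVCell e) :=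
  toHom_idVCell e

theorem recast {A C : K} {f g f' g' : A ⟶ C} {φ : VCell f g} (h : φ.IsIdentity) (e : f = f')
    (e' : g = g') : VCell.IsIdentity (recast e e' φ) :=
  of_eq ((toHom_recast e e' φ).trans h)

theorem vcomp {A C E : K} {f f' : A ⟶ C} {h h' : C ⟶ E} {p q : A ⟶ E} {φ : VCell f f'}
    {ψ : VCell h h'} (hφ : φ.IsIdentity) (hψ : ψ.IsIdentity) (e₁ : f ≫ h = p)
    (e₂ : f' ≫ h' = q) : VCell.IsIdentity (vcomp e₁ e₂ φ ψ) := by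
  rw [VCell.IsIdentity, toHom_vcomp, hφ, hψ, toHom_unitCell_comp e₁]

theorem preWhisker {A C E : K} (f : A ⟶ C) {g h : C ⟶ E} {φ : VCell g h}
    (hφ : φ.IsIdentity) : (preWhisker f φ).IsIdentity :=
  vcomp (unitCell f) hφ _ _

theorem postWhisker {A C E : K} {f g : A ⟶ C} {φ : VCell f g} (hφ : φ.IsIdentity)
    (h : C ⟶ E) : (postWhisker φ h).IsIdentity :=
  vcomp hφ (unitCell h) _ _

theorem comp {A C : K} {f g h : A ⟶ C} {φ : VCell f g} {ψ : VCell g h} (hφ : φ.IsIdentity)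
    (hψ : ψ.IsIdentity) : (φ.comp ψ).IsIdentity :=
  of_eq ((toHom_vComp_of_eq_unitCell_left hφ).trans hψ)

theorem isInvertible {A C : K} {f g : A ⟶ C} {φ : VCell f g} (h : φ.IsIdentity) :
    φ.IsInvertible := by
  obtain ⟨-, e, h⟩ := HorHom.mk.inj h
  subst e
  rw [eq_of_heq h]
  exact ⟨DoubleCategory.unitCell _, unitCell_vComp _, unitCell_vComp _⟩

theorem mapVCell (T : NormalLaxDoubleMonad K) {A C : K} {f g : A ⟶ C} {φ : VCell f g}
    (h : φ.IsIdentity) : (T.mapVCell φ).IsIdentity := by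
  rw [VCell.IsIdentity, ← T.toHom_mapVCell_unitCell, T.toHom_mapVCell, T.toHom_mapVCell, h]

end VCell.IsIdentity

end IsIdentity

/-! ### Free algebras and what colax-idempotency says about them. -/

namespace NormalLaxDoubleMonad

variable {K : Type u} [DoubleCategory.{v, u, w, z} K] (T : NormalLaxDoubleMonad K)

/-- The free algebra on `A`. -/
def freeAlgebra (A : K) : T.PseudoAlgebra (T.obj A) where
  act := T.μApp A
  associator := idVCell (T.μApp_μApp A)
  unitor := idVCell (T.ιApp_μApp A).symm
  associator_isInvertible := (VCell.IsIdentity.idVCell _).isInvertible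
  unitor_isInvertible := (VCell.IsIdentity.idVCell _).isInvertible
  associativity := VCell.IsIdentity.eq
    (.comp (.recast (.postWhisker (.mapVCell T (.idVCell _)) _) _ _) (.preWhisker _ (.idVCell _)))
    (.comp (.recast (.preWhisker _ (.idVCell _)) _ _) (.recast (.preWhisker _ (.idVCell _)) _ _))
  right_unitality := VCell.IsIdentity.eq
    (.comp (.recast (.postWhisker (.mapVCell T (.idVCell _)) _) _ _) (.preWhisker _ (.idVCell _)))
    (.idVCell _)
  left_unitality := VCell.IsIdentity.eq
    (.comp (.recast (.preWhisker _ (.idVCell _)) _ _) (.preWhisker _ (.idVCell _)))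
    (.idVCell _)

theorem freeAlgebra_isStrict (A : K) : (T.freeAlgebra A).IsStrict := ⟨⟨_, rfl⟩, ⟨_, rfl⟩⟩

/-- The structure cells of free algebras are identities, so they drop out of the two axioms. -/
theorem isColaxMorphism_freeAlgebra_iff {A C : K} (f : T.obj A ⟶ T.obj C)
    (φ : VCell (T.μApp A ≫ f) (T.map f ≫ T.μApp C)) :
    IsColaxMorphism (T.freeAlgebra A) (T.freeAlgebra C) f φ ↔
      toHom (unitCell (T.μApp (T.obj A))) ≫ toHom φ = toHom (VCell.comp
        (vcomp rfl (by rw [T.map_comp, Category.assoc]) (unitCell (T.map (T.μApp A))) φ :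
          VCell (T.map (T.μApp A) ≫ T.μApp A ≫ f) (T.map (T.μApp A ≫ f) ≫ T.μApp C))
        (postWhisker (T.mapVCell φ) (T.μApp C))) ∧
      toHom (unitCell (T.ιApp (T.obj A))) ≫ toHom φ = toHom (unitCell f) := by
  have h1 : toHom (VCell.comp (recast rfl (Category.assoc _ _ _)
      (postWhisker (T.freeAlgebra A).associator f) :
        VCell ((T.map (T.μApp A) ≫ T.μApp A) ≫ f) (T.μApp (T.obj A) ≫ T.μApp A ≫ f))
      (preWhisker (T.μApp (T.obj A)) φ)) = toHom (unitCell (T.μApp (T.obj A))) ≫ toHom φ :=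
    toHom_vComp_of_eq_unitCell_left (VCell.IsIdentity.recast (.postWhisker (.idVCell _) _) _ _)
  have h2 : toHom (VCell.comp (recast (Category.assoc _ _ _).symm (by rw [T.map_comp, Category.assoc])
        (preWhisker (T.map (T.μApp A)) φ) :
          VCell ((T.map (T.μApp A) ≫ T.μApp A) ≫ f) (T.map (T.μApp A ≫ f) ≫ T.μApp C))
      (VCell.comp (recast rfl (by rw [T.map_comp, Category.assoc])
          (postWhisker (T.mapVCell φ) (T.μApp C)) :
            VCell (T.map (T.μApp A ≫ f) ≫ T.μApp C)
              (T.map (T.map f) ≫ T.map (T.μApp C) ≫ T.μApp C))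
        (recast rfl (by rw [← Category.assoc, T.μApp_naturality, Category.assoc]; rfl)
          (preWhisker (T.map (T.map f)) (T.freeAlgebra C).associator) :
            VCell _ (T.μApp (T.obj A) ≫ T.map f ≫ T.μApp C)))) = toHom (VCell.comp
        (vcomp rfl (by rw [T.map_comp, Category.assoc]) (unitCell (T.map (T.μApp A))) φ :
          VCell (T.map (T.μApp A) ≫ T.μApp A ≫ f) (T.map (T.μApp A ≫ f) ≫ T.μApp C))
        (postWhisker (T.mapVCell φ) (T.μApp C))) := by
    refine toHom_vComp_congr ?_ ?_
    · rw [toHom_recast, toHom_preWhisker, toHom_vcomp]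
    · exact (toHom_vComp_of_eq_unitCell_right
        (VCell.IsIdentity.recast (.preWhisker _ (.idVCell _)) _ _)).trans (toHom_recast _ _ _)
  have h3 : toHom (VCell.comp (recast (Category.id_comp f) (Category.assoc _ _ _)
        (postWhisker (T.freeAlgebra A).unitor f) :
        VCell f (T.ιApp (T.obj A) ≫ T.μApp A ≫ f))
      (preWhisker (T.ιApp (T.obj A)) φ)) = toHom (unitCell (T.ιApp (T.obj A))) ≫ toHom φ :=
    toHom_vComp_of_eq_unitCell_left (VCell.IsIdentity.recast (.postWhisker (.idVCell _) _) _ _)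
  have h4 : toHom (recast (Category.comp_id f)
      (by rw [← Category.assoc, T.ιApp_naturality, Category.assoc]; rfl)
      (preWhisker f (T.freeAlgebra C).unitor) : VCell f (T.ιApp (T.obj A) ≫ T.map f ≫ T.μApp C)) =
      toHom (unitCell f) :=
    VCell.IsIdentity.recast (.preWhisker _ (.idVCell _)) _ _
  rw [← h1, ← h2, ← h3, ← h4]
  exact ⟨fun h => ⟨congrArg toHom h.associativity, congrArg toHom h.unitality⟩,
    fun h => ⟨toHom_injective h.1, toHom_injective h.2⟩⟩

theorem existsUnique_colax_freeAlgebra (hT : T.IsColaxIdempotent) {A C : K}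
    (f : T.obj A ⟶ T.obj C) : ∃! φ : VCell (T.μApp A ≫ f) (T.map f ≫ T.μApp C),
      toHom (unitCell (T.μApp (T.obj A))) ≫ toHom φ = toHom (VCell.comp
        (vcomp rfl (by rw [T.map_comp, Category.assoc]) (unitCell (T.map (T.μApp A))) φ :
          VCell (T.map (T.μApp A) ≫ T.μApp A ≫ f) (T.map (T.μApp A ≫ f) ≫ T.μApp C))
        (postWhisker (T.mapVCell φ) (T.μApp C))) ∧
      toHom (unitCell (T.ιApp (T.obj A))) ≫ toHom φ = toHom (unitCell f) := by
  obtain ⟨φ, hφ, h⟩ := hT (T.freeAlgebra A) (T.freeAlgebra C) (T.freeAlgebra_isStrict A)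
    (T.freeAlgebra_isStrict C) f
  exact ⟨φ, (T.isColaxMorphism_freeAlgebra_iff f φ).1 hφ,
    fun ψ hψ => h ψ ((T.isColaxMorphism_freeAlgebra_iff f ψ).2 hψ)⟩

/-- The cell `θ` is the colax structure of `ι_{TA}` between free algebras, its target being the
identity because `μ ∘ Tι = 1`. The first equation is its unitality; the second comes from uniqueness
of the colax structure on the identity of `TA`. -/
theorem exists_counit (hT : T.IsColaxIdempotent) (A : K) :
    ∃ θ : VCell (T.μApp A ≫ T.ιApp (T.obj A)) (𝟙 (T.obj (T.obj A))),
      toHom (unitCell (T.ιApp (T.obj A))) ≫ toHom θ = toHom (unitCell (T.ιApp (T.obj A))) ∧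
      toHom θ ≫ toHom (unitCell (T.μApp A)) = toHom (unitCell (T.μApp A)) := by
  obtain ⟨θ, ⟨h1, h2⟩, -⟩ := T.existsUnique_colax_freeAlgebra hT (T.ιApp (T.obj A))
  refine ⟨recast rfl (T.map_ιApp_μApp _) θ, by rw [toHom_recast, h2], ?_⟩
  have hφ : T.μApp A ≫ 𝟙 (T.obj A) = T.map (𝟙 (T.obj A)) ≫ T.μApp A := by
    rw [T.map_id, Category.id_comp, Category.comp_id]
  have hψ : (T.map (T.ιApp (T.obj A)) ≫ T.μApp (T.obj A)) ≫ T.μApp A =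
      T.map (𝟙 (T.obj A)) ≫ T.μApp A := by
    rw [T.map_ιApp_μApp, T.map_id, Category.id_comp]
  have hψ' : (T.μApp A ≫ T.ιApp (T.obj A)) ≫ T.μApp A = T.μApp A ≫ 𝟙 (T.obj A) := by
    rw [Category.assoc, T.ιApp_μApp]
  -- Since `μ ∘ ι = 1`, composing the colax structure of `ι_{TA}` with the strict morphism `μ_A`
  -- gives a colax structure on the identity, to be compared with the trivial one.
  have h := (T.existsUnique_colax_freeAlgebra hT (𝟙 (T.obj A))).unique (y₁ := vcomp hψ' hψ θ (unitCell (T.μApp A)))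
    (y₂ := idVCell hφ) ?_ ?_
  · rw [toHom_recast, ← toHom_vcomp hψ' hψ, h, toHom_idVCell]
    exact congrArg (fun f => toHom (unitCell f)) (Category.comp_id _)
  · constructor
    · rw [toHom_vcomp, ← Category.assoc, h1, ← toHom_vcomp rfl rfl,
        vComp_vcomp_unitCell rfl rfl rfl]
      refine toHom_vComp_congr ?_ ?_
      · simp only [toHom_vcomp, Category.assoc]
      · have h3 : T.map (T.μApp A) ≫ T.μApp A = T.μApp (T.obj A) ≫ T.μApp A := T.μApp_μApp A
        rw [toHom_vcomp, toHom_postWhisker, toHom_postWhisker, toHom_mapVCell_vcomp,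
          toHom_mapVCell_unitCell, Category.assoc, Category.assoc, toHom_unitCell_comp h3,
          toHom_unitCell_comp rfl]
    · rw [toHom_vcomp, ← Category.assoc, h2, toHom_unitCell_comp (T.ιApp_μApp A)]
  · constructor
    · have h3 : T.map (T.μApp A ≫ 𝟙 _) ≫ T.μApp A = T.μApp (T.obj A) ≫ T.μApp A ≫ 𝟙 _ := by
        rw [Category.comp_id, T.μApp_μApp]
      rw [toHom_vComp_of_eq_unitCell_left (VCell.IsIdentity.vcomp (.unitCell _) (.idVCell _) _ _),
        VCell.IsIdentity.postWhisker (.mapVCell T (.idVCell _)) _, toHom_idVCell,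
        toHom_unitCell_comp rfl, h3]
    · rw [toHom_idVCell, toHom_unitCell_comp rfl, ← Category.assoc, T.ιApp_μApp,
        Category.id_comp]

end NormalLaxDoubleMonad
-- The adjunction between the unit of the monad and the action of a pseudo algebra.
theorem VCell.left_inverse_eq_right_inverse {K : Type u} [DoubleCategory.{v, u, w, z} K]
    {A C : K} {f g : A ⟶ C} {α β : VCell f g} {γ : VCell g f} (h : α.comp γ = unitCell f)
    (h' : γ.comp β = unitCell g) : α = β := by
  rw [← vComp_unitCell α, ← h', ← vComp_assoc, h, unitCell_vComp]

namespace NormalLaxDoubleMonad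

variable {K : Type u} [DoubleCategory.{v, u, w, z} K] {T : NormalLaxDoubleMonad K}

/-- With an identity as unit, the triangle identities are precisely the two equations on `θ`. -/
theorem isVAdjunction_μApp {A : K}
    {θ : VCell (T.μApp A ≫ T.ιApp (T.obj A)) (𝟙 (T.obj (T.obj A)))}
    (h : toHom (unitCell (T.ιApp (T.obj A))) ≫ toHom θ = toHom (unitCell (T.ιApp (T.obj A))))
    (h' : toHom θ ≫ toHom (unitCell (T.μApp A)) = toHom (unitCell (T.μApp A))) :
    IsVAdjunction (idVCell (T.ιApp_μApp A).symm) θ where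
  left_triangle := by
    apply toHom_injective
    rw [toHom_vComp_of_eq_unitCell_left (VCell.IsIdentity.vcomp (.idVCell _) (.unitCell _) _ _), toHom_vcomp, h]
  right_triangle := by
    apply toHom_injective
    rw [toHom_vComp_of_eq_unitCell_left (VCell.IsIdentity.vcomp (.unitCell _) (.idVCell _) _ _), toHom_vcomp, h']

theorem PseudoAlgebra.left_unitality_vcomp {B : K} (𝔟 : T.PseudoAlgebra B)
    (e : T.ιApp (T.obj B) ≫ T.map 𝔟.act ≫ 𝔟.act = 𝔟.act ≫ T.ιApp B ≫ 𝔟.act)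
    (e' : T.ιApp (T.obj B) ≫ T.μApp B ≫ 𝔟.act = 𝔟.act) :
    VCell.comp (vcomp (Category.comp_id 𝔟.act) rfl (unitCell 𝔟.act) 𝔟.unitor)
      (vcomp e e' (unitCell (T.ιApp (T.obj B))) 𝔟.associator) = unitCell 𝔟.act := by
  apply toHom_injective
  have h := congrArg toHom 𝔟.left_unitality
  rw [toHom_idVCell] at h
  rw [← h]
  refine toHom_vComp_congr ?_ ?_
  · rw [toHom_recast, toHom_vcomp]; rfl
  · rw [toHom_vcomp]; rfl

/-- The action of a pseudo algebra is right adjoint to the unit of the monad. -/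
theorem PseudoAlgebra.exists_isVAdjunction (hT : T.IsColaxIdempotent) {B : K}
    (𝔟 : T.PseudoAlgebra B) :
    ∃ ε : VCell (𝔟.act ≫ T.ιApp B) (𝟙 (T.obj B)), IsVAdjunction 𝔟.unitor ε := by
  obtain ⟨θ, h1, h2⟩ := T.exists_counit hT B
  obtain ⟨βi, hβ1, hβ2⟩ := 𝔟.unitor_isInvertible
  have e0 : T.map (T.ιApp B) ≫ T.μApp B ≫ T.ιApp (T.obj B) = T.ιApp (T.obj B) := by
    rw [← Category.assoc, T.map_ιApp_μApp, Category.id_comp]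
  have e1 : T.ιApp (T.obj B) ≫ T.map 𝔟.act = 𝔟.act ≫ T.ιApp B := (T.ιApp_naturality _).symm
  have e2 : T.map (T.ιApp B) ≫ T.map 𝔟.act = T.map (T.ιApp B ≫ 𝔟.act) := (T.map_comp _ _).symm
  have e3 : T.ιApp B ≫ T.map (T.ιApp B) = T.ιApp B ≫ T.ιApp (T.obj B) :=
    (T.ιApp_naturality _).symm
  -- The counit is `ι_B ∘ b = Tb ∘ ι_{TB} ⇒ Tb ∘ Tι_B = T(b ∘ ι_B) ⇒ 1`. The first cell `δ` is `θ`
  -- whiskered with `Tι_B` and `Tb`; the second, `γ`, is `T` of the inverse unitor.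
  let δ : VCell (𝔟.act ≫ T.ιApp B) (T.map (T.ιApp B ≫ 𝔟.act)) :=
    vcomp e1 e2 (vcomp e0 (Category.comp_id _) (unitCell (T.map (T.ιApp B))) θ)
      (unitCell (T.map 𝔟.act))
  let γ : VCell (T.map (T.ιApp B ≫ 𝔟.act)) (𝟙 (T.obj B)) := recast rfl (T.map_id B) (T.mapVCell βi)
  refine ⟨δ.comp γ, ⟨?_, ?_⟩⟩
  · rw [unitCell_vcomp_vComp rfl (show T.ιApp B ≫ T.map (T.ιApp B ≫ 𝔟.act) = T.ιApp B ≫ 𝔟.act ≫ T.ιApp B by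
      rw [T.map_comp, ← Category.assoc, e3, Category.assoc, e1]) (Category.comp_id _)]
    -- Restricted along `ι_B`, the cell `δ` is an identity, because `Tι_B ∘ ι_B = ι_{TB} ∘ ι_B` and
    -- `θ` is trivial on `ι_{TB}`. By naturality of `ι`, the cell `γ` becomes the inverse unitor.
    have h3 : VCell.comp (vcomp rfl (by
        rw [T.map_comp, ← Category.assoc, e3, Category.assoc, e1]) (unitCell (T.ιApp B)) δ :
          VCell (T.ιApp B ≫ 𝔟.act ≫ T.ιApp B) (T.ιApp B ≫ 𝔟.act ≫ T.ιApp B))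
        (vcomp (by rw [T.map_comp, ← Category.assoc, e3, Category.assoc, e1])
          (Category.comp_id _) (unitCell (T.ιApp B)) γ) =
        vcomp (Category.assoc _ _ _) (Category.id_comp _) βi (unitCell (T.ιApp B)) := by
      apply toHom_injective
      rw [toHom_vComp_of_eq_unitCell_left (k := T.ιApp B ≫ 𝔟.act ≫ T.ιApp B), toHom_vcomp,
        toHom_vcomp, toHom_recast, ← ιApp_naturality_vCell]
      rw [toHom_vcomp, toHom_vcomp, toHom_vcomp, ← Category.assoc, ← Category.assoc,
        toHom_unitCell_comp e3, ← toHom_unitCell_comp rfl, Category.assoc (toHom _), h1,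
        toHom_unitCell_comp rfl, toHom_unitCell_comp (by rw [Category.assoc, e1])]
    rw [h3, ← vComp_vcomp_unitCell, hβ1, vcomp_unitCell]
  · rw [vComp_vcomp_unitCell _ (rfl : T.map (T.ιApp B ≫ 𝔟.act) ≫ 𝔟.act = _) _ δ γ, ← vComp_assoc]
    have e4 : T.ιApp (T.obj B) ≫ T.map 𝔟.act ≫ 𝔟.act = 𝔟.act ≫ T.ιApp B ≫ 𝔟.act := by
      rw [← Category.assoc, e1, Category.assoc]
    have e5 : T.ιApp (T.obj B) ≫ T.μApp B ≫ 𝔟.act = 𝔟.act := by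
      rw [← Category.assoc, T.ιApp_μApp, Category.id_comp]
    have e6 : T.map (T.ιApp B) ≫ T.map 𝔟.act ≫ 𝔟.act = T.map (T.ιApp B ≫ 𝔟.act) ≫ 𝔟.act := by
      rw [T.map_comp, Category.assoc]
    have e7 : T.map (T.ιApp B) ≫ T.μApp B ≫ 𝔟.act = 𝔟.act := by
      rw [← Category.assoc, T.map_ιApp_μApp, Category.id_comp]
    set s : VCell (T.map (T.ιApp B ≫ 𝔟.act) ≫ 𝔟.act) 𝔟.act :=
      vcomp e6 e7 (unitCell (T.map (T.ιApp B))) 𝔟.associator with hs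
    set y : VCell (𝔟.act ≫ T.ιApp B ≫ 𝔟.act) 𝔟.act :=
      vcomp e4 e5 (unitCell (T.ιApp (T.obj B))) 𝔟.associator with hy
    set t : VCell 𝔟.act (T.map (T.ιApp B ≫ 𝔟.act) ≫ 𝔟.act) :=
      vcomp (by rw [T.map_id, Category.id_comp]) rfl (T.mapVCell 𝔟.unitor) (unitCell 𝔟.act) with ht
    have hts : t.comp s = unitCell 𝔟.act := by
      apply toHom_injective
      have h := congrArg toHom 𝔟.right_unitality
      rw [toHom_idVCell] at h
      rw [← h]
      refine toHom_vComp_congr ?_ ?_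
      · rw [toHom_recast, ht, toHom_vcomp]; rfl
      · rw [hs, toHom_vcomp]; rfl
    have hxy : VCell.comp (vcomp (Category.comp_id 𝔟.act) rfl (unitCell 𝔟.act) 𝔟.unitor) y =
        unitCell 𝔟.act := 𝔟.left_unitality_vcomp e4 e5
    have htt : VCell.comp (vcomp rfl (Category.id_comp 𝔟.act) γ (unitCell 𝔟.act)) t =
        unitCell _ := by
      have h3 : VCell.comp (recast rfl (T.map_id B) (T.mapVCell βi)) (recast (T.map_id B) rfl (T.mapVCell 𝔟.unitor)) =
          unitCell (T.map (T.ιApp B ≫ 𝔟.act)) := by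
        apply toHom_injective
        rw [toHom_vComp_congr (φ' := T.mapVCell βi) (ψ' := T.mapVCell 𝔟.unitor)
          (toHom_recast _ _ _) (toHom_recast _ _ _), ← mapVCell_vComp, hβ2,
          toHom_mapVCell_unitCell]
      have h4 : t = vcomp (Category.id_comp _) rfl (recast (T.map_id B) rfl (T.mapVCell 𝔟.unitor))
          (unitCell 𝔟.act) := by
        apply toHom_injective
        rw [ht, toHom_vcomp, toHom_vcomp, toHom_recast]
      rw [h4, ← vComp_vcomp_unitCell, h3, vcomp_unitCell]
    -- Both cells are inverse to `t`: one because `γ` is `T` of an inverse, the other by right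
    -- unitality.
    have hγs : vcomp rfl (Category.id_comp 𝔟.act) γ (unitCell 𝔟.act) = s :=
      VCell.left_inverse_eq_right_inverse htt hts
    -- Interchange of `θ` with the associator of `b`; the leftover copy of `θ` is whiskered with
    -- `μ_B` and hence trivial. What remains, `y`, cancels the unitor by left unitality.
    have hzs : VCell.comp (vcomp (Category.assoc _ _ _) rfl δ (unitCell 𝔟.act)) s = y := by
      have d4 : (T.map (T.ιApp B) ≫ T.μApp B ≫ T.ιApp (T.obj B)) ≫ T.map 𝔟.act ≫ 𝔟.act =
          𝔟.act ≫ T.ιApp B ≫ 𝔟.act := by rw [e0, e4]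
      have d5 : (T.map (T.ιApp B) ≫ T.μApp B ≫ T.ιApp (T.obj B)) ≫ T.μApp B ≫ 𝔟.act =
          𝔟.act := by rw [e0, e5]
      have d6 : (T.map (T.ιApp B) ≫ 𝟙 _) ≫ T.map 𝔟.act ≫ 𝔟.act =
          T.map (T.ιApp B ≫ 𝔟.act) ≫ 𝔟.act := by rw [Category.comp_id, e6]
      have d7 : (T.map (T.ιApp B) ≫ 𝟙 _) ≫ T.μApp B ≫ 𝔟.act = 𝔟.act := by
        rw [Category.comp_id, e7]
      have h5 := (vcomp_exchange d4 d6 d7 (vcomp rfl rfl (unitCell (T.map (T.ιApp B))) θ)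
        𝔟.associator).trans (vcomp_exchange' d4 d5 d7 _ _).symm
      have h6 : toHom (vcomp (Category.assoc _ _ _) rfl δ (unitCell 𝔟.act)) =
          toHom (vcomp d4 d6 (vcomp rfl rfl (unitCell (T.map (T.ιApp B))) θ)
            (unitCell (T.map 𝔟.act ≫ 𝔟.act))) := by
        simp only [δ, toHom_vcomp, ← toHom_unitCell_comp (rfl : T.map 𝔟.act ≫ 𝔟.act = _),
          Category.assoc]
      have h7 : toHom s = toHom (vcomp d6 d7 (unitCell (T.map (T.ιApp B) ≫ 𝟙 _))
          𝔟.associator) := by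
        rw [hs, toHom_vcomp, toHom_vcomp, Category.comp_id]
      apply toHom_injective
      rw [toHom_vComp_congr h6 h7, h5, toHom_vComp_of_eq_unitCell_right (k := 𝔟.act), hy,
        toHom_vcomp, toHom_vcomp, e0]
      rw [toHom_vcomp, toHom_vcomp, ← toHom_unitCell_comp (rfl : T.μApp B ≫ 𝔟.act = _),
        Category.assoc, reassoc_of% h2, toHom_unitCell_comp rfl, toHom_unitCell_comp e7]
    rw [hγs, vComp_assoc, hzs, hxy]

end NormalLaxDoubleMonad
-- Existence and uniqueness of colax structures between pseudo algebras.
namespace NormalLaxDoubleMonad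

variable {K : Type u} [DoubleCategory.{v, u, w, z} K] {T : NormalLaxDoubleMonad K}

/-- Vertical cells out of a composite with the multiplication are determined by their restriction
along the unit. -/
theorem vCell_μApp_ext (hT : T.IsColaxIdempotent) {A X : K} {f : T.obj A ⟶ X}
    {k : T.obj (T.obj A) ⟶ X} {φ ψ : VCell (T.μApp A ≫ f) k}
    (h : toHom (unitCell (T.ιApp (T.obj A))) ≫ toHom φ =
      toHom (unitCell (T.ιApp (T.obj A))) ≫ toHom ψ) : φ = ψ := by
  obtain ⟨θ, h1, h2⟩ := T.exists_counit hT A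
  -- The unit of `ι_{TA} ⊣ μ_A` is an identity, so taking mates is just restriction along `ι_{TA}`.
  apply ((isVAdjunction_μApp h1 h2).bijective f k).1
  apply toHom_injective
  dsimp only
  rw [toHom_vComp_of_eq_unitCell_left (VCell.IsIdentity.vcomp (.idVCell _) (.unitCell _) _ _),
    toHom_vComp_of_eq_unitCell_left (VCell.IsIdentity.vcomp (.idVCell _) (.unitCell _) _ _),
    toHom_vcomp, toHom_vcomp, h]

/-- The unitality of a colax morphism, as an equation that determines its structure cell. -/
theorem unitality_iff {B M : K} (𝔟 : T.PseudoAlgebra B) (𝔪 : T.PseudoAlgebra M) (l : B ⟶ M)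
    (φ : VCell (𝔟.act ≫ l) (T.map l ≫ 𝔪.act)) :
    VCell.comp
      (recast (Category.id_comp l) (Category.assoc _ _ _) (postWhisker 𝔟.unitor l) :
        VCell l (T.ιApp B ≫ 𝔟.act ≫ l))
      (preWhisker (T.ιApp B) φ) =
    recast (Category.comp_id l) (by rw [← Category.assoc, T.ιApp_naturality, Category.assoc])
      (preWhisker l 𝔪.unitor) ↔
    VCell.comp (vcomp (Category.id_comp l) (Category.assoc _ _ _) 𝔟.unitor (unitCell l))
      (vcomp rfl rfl (unitCell (T.ιApp B)) φ) = vcomp (Category.comp_id l)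
        (by rw [← Category.assoc, T.ιApp_naturality, Category.assoc]) (unitCell l) 𝔪.unitor := by
  rw [postWhisker, recast_vcomp, preWhisker, preWhisker, recast_vcomp]

/-- A cell that satisfies the unitality of a colax morphism also satisfies its associativity. -/
theorem isColaxMorphism_of_unitality (hT : T.IsColaxIdempotent) {B M : K}
    (𝔟 : T.PseudoAlgebra B) (𝔪 : T.PseudoAlgebra M) (l : B ⟶ M)
    (φ : VCell (𝔟.act ≫ l) (T.map l ≫ 𝔪.act))
    (h : VCell.comp (vcomp (Category.id_comp l) (Category.assoc _ _ _) 𝔟.unitor (unitCell l))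
      (vcomp rfl rfl (unitCell (T.ιApp B)) φ) = vcomp (Category.comp_id l)
        (by rw [← Category.assoc, T.ιApp_naturality, Category.assoc]) (unitCell l) 𝔪.unitor) :
    IsColaxMorphism 𝔟 𝔪 l φ := by
  refine ⟨?_, (unitality_iff 𝔟 𝔪 l φ).2 h⟩
  obtain ⟨βi, hβ1, hβ2⟩ := 𝔟.associator_isInvertible
  -- Composing with the inverse associator turns the common source into `l ∘ b ∘ μ_B`, to which
  -- `vCell_μApp_ext` applies.
  let q : VCell (T.μApp B ≫ 𝔟.act ≫ l) ((T.map 𝔟.act ≫ 𝔟.act) ≫ l) :=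
    vcomp (Category.assoc _ _ _) rfl βi (unitCell l)
  have hq' : VCell.comp q (recast rfl (Category.assoc _ _ _) (postWhisker 𝔟.associator l)) =
      unitCell (T.μApp B ≫ 𝔟.act ≫ l) := by
    rw [postWhisker, recast_vcomp, ← vComp_vcomp_unitCell, hβ2, vcomp_unitCell]
  have hq'' : VCell.comp (recast rfl (Category.assoc _ _ _) (postWhisker 𝔟.associator l)) q =
      unitCell ((T.map 𝔟.act ≫ 𝔟.act) ≫ l) := by
    rw [postWhisker, recast_vcomp, ← vComp_vcomp_unitCell, hβ1, vcomp_unitCell]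
  have cancel {k : T.obj (T.obj B) ⟶ M} {x y : VCell ((T.map 𝔟.act ≫ 𝔟.act) ≫ l) k}
      (e : q.comp x = q.comp y) : x = y := by
    rw [← unitCell_vComp x, ← hq'', vComp_assoc, e, ← vComp_assoc, hq'', unitCell_vComp]
  apply cancel
  rw [← vComp_assoc, hq', unitCell_vComp]
  apply vCell_μApp_ext hT
  rw [toHom_preWhisker, ← Category.assoc, toHom_unitCell_comp (T.ιApp_μApp _),
    toHom_unitCell_id, Category.id_comp]
  have e1 : T.ιApp (T.obj B) ≫ T.map 𝔟.act = 𝔟.act ≫ T.ιApp B := (T.ιApp_naturality _).symm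
  have e2 : T.ιApp (T.obj B) ≫ T.map (T.map l) = T.map l ≫ T.ιApp (T.obj M) :=
    (T.ιApp_naturality _).symm
  have e3 : T.ιApp (T.obj M) ≫ T.map 𝔪.act = 𝔪.act ≫ T.ιApp M := (T.ιApp_naturality _).symm
  have e4 : T.ιApp B ≫ T.map l = l ≫ T.ιApp M := (T.ιApp_naturality _).symm
  have d1 : T.ιApp (T.obj B) ≫ T.μApp B ≫ 𝔟.act ≫ l = 𝔟.act ≫ l := by
    rw [← Category.assoc, T.ιApp_μApp, Category.id_comp]
  have d2 : T.ιApp (T.obj B) ≫ (T.map 𝔟.act ≫ 𝔟.act) ≫ l = 𝔟.act ≫ T.ιApp B ≫ 𝔟.act ≫ l := by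
    rw [Category.assoc, ← Category.assoc, e1, Category.assoc]
  have d3 : T.ιApp (T.obj B) ≫ T.map (𝔟.act ≫ l) ≫ 𝔪.act = 𝔟.act ≫ T.ιApp B ≫ T.map l ≫ 𝔪.act := by
    rw [T.map_comp, Category.assoc, ← Category.assoc, e1, Category.assoc]
  have d4 : T.ιApp (T.obj B) ≫ T.map (T.map l) ≫ T.map 𝔪.act ≫ 𝔪.act =
      T.map l ≫ 𝔪.act ≫ T.ιApp M ≫ 𝔪.act := by
    rw [← Category.assoc, e2, Category.assoc, ← Category.assoc (T.ιApp (T.obj M)), e3,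
      Category.assoc]
  have d5 : T.ιApp (T.obj B) ≫ T.μApp B ≫ T.map l ≫ 𝔪.act = T.map l ≫ 𝔪.act := by
    rw [← Category.assoc, T.ιApp_μApp, Category.id_comp]
  have d6 : T.ιApp (T.obj M) ≫ T.map 𝔪.act ≫ 𝔪.act = 𝔪.act ≫ T.ιApp M ≫ 𝔪.act := by
    rw [← Category.assoc, e3, Category.assoc]
  have d7 : T.ιApp (T.obj M) ≫ T.μApp M ≫ 𝔪.act = 𝔪.act := by
    rw [← Category.assoc, T.ιApp_μApp, Category.id_comp]
  have d8 : T.ιApp (T.obj B) ≫ T.map 𝔟.act ≫ 𝔟.act = 𝔟.act ≫ T.ιApp B ≫ 𝔟.act := by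
    rw [← Category.assoc, e1, Category.assoc]
  have d9 : T.ιApp (T.obj B) ≫ T.μApp B ≫ 𝔟.act = 𝔟.act := by
    rw [← Category.assoc, T.ιApp_μApp, Category.id_comp]
  -- Left unitality of `b`: along `ι_{TB}` the inverse associator restricts to the unitor.
  have hβ : vcomp (Category.comp_id 𝔟.act) rfl (unitCell 𝔟.act) 𝔟.unitor =
      vcomp d9 d8 (unitCell (T.ιApp (T.obj B))) βi := by
    refine VCell.left_inverse_eq_right_inverse (𝔟.left_unitality_vcomp d8 d9) ?_
    rw [← unitCell_vcomp_vComp, hβ1, vcomp_unitCell]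
  have c1 : vcomp d1 d2 (unitCell (T.ιApp (T.obj B))) q = vcomp rfl rfl (unitCell 𝔟.act)
      (vcomp (Category.id_comp l) (Category.assoc _ _ _) 𝔟.unitor (unitCell l)) := by
    apply toHom_injective
    have h1 := congrArg toHom hβ
    rw [toHom_vcomp, toHom_vcomp] at h1
    simp only [q, toHom_vcomp]
    rw [← Category.assoc, ← h1, Category.assoc]
  -- The identity of `m` is inserted after `φ` as unitor followed by restricted associator, and
  -- interchange moves the unitor in front of `φ`, where the hypothesis `h` can meet it.
  have hlhs : toHom φ = toHom (VCell.comp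
      (vcomp rfl rfl (unitCell 𝔟.act) (vcomp (Category.comp_id l)
        (by rw [← Category.assoc, T.ιApp_naturality, Category.assoc]) (unitCell l) 𝔪.unitor) :
          VCell (𝔟.act ≫ l) (𝔟.act ≫ T.ιApp B ≫ T.map l ≫ 𝔪.act))
      (VCell.comp
        (vcomp (by rw [← Category.assoc (T.ιApp B), e4]; simp only [Category.assoc])
          (by simp only [Category.assoc]) φ (unitCell (T.ιApp M ≫ 𝔪.act)) :
          VCell _ (T.map l ≫ 𝔪.act ≫ T.ιApp M ≫ 𝔪.act))
        (vcomp rfl rfl (unitCell (T.map l))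
          (vcomp d6 d7 (unitCell (T.ιApp (T.obj M))) 𝔪.associator)))) := by
    have k0 : (𝔟.act ≫ l) ≫ T.ιApp M ≫ 𝔪.act = 𝔟.act ≫ T.ιApp B ≫ T.map l ≫ 𝔪.act := by
      rw [← Category.assoc (T.ιApp B), e4]; simp only [Category.assoc]
    have k1 : vcomp rfl rfl (unitCell 𝔟.act) (vcomp (Category.comp_id l)
        (by rw [← Category.assoc, T.ιApp_naturality, Category.assoc]) (unitCell l) 𝔪.unitor) =
        vcomp (Category.comp_id _) k0 (unitCell (𝔟.act ≫ l)) 𝔪.unitor := by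
      apply toHom_injective
      rw [toHom_vcomp, toHom_vcomp, toHom_vcomp, ← Category.assoc, toHom_unitCell_comp rfl]
    have k2 : (T.map l ≫ 𝔪.act) ≫ T.ιApp M ≫ 𝔪.act = T.map l ≫ 𝔪.act ≫ T.ιApp M ≫ 𝔪.act :=
      Category.assoc _ _ _
    have k3 : vcomp (Category.comp_id _) k2 (unitCell (T.map l ≫ 𝔪.act)) 𝔪.unitor =
        vcomp rfl rfl (unitCell (T.map l))
          (vcomp (Category.comp_id 𝔪.act) rfl (unitCell 𝔪.act) 𝔪.unitor) := by
      apply toHom_injective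
      rw [toHom_vcomp, toHom_vcomp, toHom_vcomp, ← Category.assoc, toHom_unitCell_comp rfl]
    have k4 := vcomp_exchange (Category.comp_id _) (Category.comp_id _) k2 φ 𝔪.unitor
    rw [unitCell_id, vcomp_vid] at k4
    rw [← vComp_assoc, k1, vcomp_exchange' _ k0 k2, ← k4, vComp_assoc, k3,
      ← unitCell_vcomp_vComp, 𝔪.left_unitality_vcomp d6 d7, vcomp_unitCell, vComp_unitCell]
  rw [← toHom_vcomp d1 d5, unitCell_vcomp_vComp d1 d2 d5, unitCell_vcomp_vComp d2 d3 d5,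
    unitCell_vcomp_vComp d3 d4 d5, c1, ← vComp_assoc]
  have c2 : VCell.comp (vcomp rfl rfl (unitCell 𝔟.act)
      (vcomp (Category.id_comp l) (Category.assoc _ _ _) 𝔟.unitor (unitCell l)))
      (vcomp d2 d3 (unitCell (T.ιApp (T.obj B))) (recast (Category.assoc _ _ _).symm
        (by rw [T.map_comp, Category.assoc]) (preWhisker (T.map 𝔟.act) φ))) =
      vcomp rfl rfl (unitCell 𝔟.act) (vcomp (Category.comp_id l)
        (by rw [← Category.assoc, T.ιApp_naturality, Category.assoc]) (unitCell l) 𝔪.unitor) := by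
    rw [← h, unitCell_vcomp_vComp rfl rfl rfl]
    congr 1
    apply toHom_injective
    simp only [toHom_vcomp, toHom_recast, toHom_preWhisker]
    rw [← Category.assoc, toHom_unitCell_comp e1, ← toHom_unitCell_comp rfl, Category.assoc]
  rw [c2, hlhs]
  refine toHom_vComp_congr rfl (toHom_vComp_congr ?_ ?_)
  · rw [toHom_vcomp, toHom_vcomp, toHom_recast, toHom_postWhisker, ← Category.assoc,
      ← ιApp_naturality_vCell, Category.assoc, toHom_unitCell_comp rfl]
  · rw [toHom_vcomp, toHom_vcomp, toHom_vcomp, toHom_recast, toHom_preWhisker, ← Category.assoc,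
      ← Category.assoc, toHom_unitCell_comp rfl, toHom_unitCell_comp rfl, e2]

/-- Every vertical morphism between pseudo algebras has a unique structure of colax morphism. -/
theorem existsUnique_isColaxMorphism (hT : T.IsColaxIdempotent) {B M : K}
    (𝔟 : T.PseudoAlgebra B) (𝔪 : T.PseudoAlgebra M) (l : B ⟶ M) :
    ∃! φ : VCell (𝔟.act ≫ l) (T.map l ≫ 𝔪.act), IsColaxMorphism 𝔟 𝔪 l φ := by
  obtain ⟨ε, hε⟩ := 𝔟.exists_isVAdjunction hT
  obtain ⟨h1, h2⟩ := hε.bijective l (T.map l ≫ 𝔪.act)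
  -- The structure cell is the one whose mate is the unitor of `m` at `l`.
  obtain ⟨φ, hφ⟩ := h2 (vcomp (Category.comp_id l)
        (by rw [← Category.assoc, T.ιApp_naturality, Category.assoc]) (unitCell l) 𝔪.unitor)
  refine ⟨φ, isColaxMorphism_of_unitality hT 𝔟 𝔪 l φ hφ, fun ψ hψ => h1 ?_⟩
  exact ((unitality_iff 𝔟 𝔪 l ψ).1 hψ.unitality).trans hφ.symm

end NormalLaxDoubleMonad
-- Exact cells, and adjoints as conjoints.
section Exact

variable {K : Type u} [DoubleCategory.{v, u, w, z} K]

/-- A vertical cell `β : f ⇒ e ∘ i` is exact if it exhibits `e` as an absolute left Kan extension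
of `f` along `i`: composition with `β` is a bijection between cells `p ∘ e ⇒ q` and cells
`p ∘ f ⇒ q ∘ i` with arbitrary bottom. -/
def IsExact {A X M : K} {f : A ⟶ M} {i : A ⟶ X} {e : X ⟶ M} (β : VCell f (i ≫ e)) : Prop :=
  ∀ ⦃Y Z : K⦄ (p : M ⟶ Y) (q : X ⟶ Z) (L : Hor Y Z), Function.Bijective
    fun ψ : Cell (e ≫ p) q (unit X) L =>
      lact (vcomp rfl (Category.assoc _ _ _) β (unitCell p) : VCell (f ≫ p) (i ≫ e ≫ p))
        (vcomp rfl rfl (unitCell i) ψ : Cell (i ≫ e ≫ p) (i ≫ q) (unit A) L)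

/-- Cells out of `H` are, through `V`, the cells on which exactness is tested; factoring through the
pasted cell is that bijection followed by composition with `β`. -/
theorem IsOpcartesian.lact_iff_isExact {A X M : K} {f : A ⟶ M} {i : A ⟶ X} {e : X ⟶ M}
    {β : VCell f (i ≫ e)} {H : Hor M X} {V : Cell e (𝟙 X) (unit X) H} (hV : IsOpcartesian V) :
    IsOpcartesian (lact β (vcomp rfl (Category.comp_id i) (unitCell i) V)) ↔ IsExact β := by
  have key {Y Z : K} (p : M ⟶ Y) (q : X ⟶ Z) (L : Hor Y Z) (ψ : Cell p q H L) :
      vcomp rfl rfl (lact β (vcomp rfl (Category.comp_id i) (unitCell i) V)) ψ =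
        lact (vcomp rfl (Category.assoc _ _ _) β (unitCell p) : VCell (f ≫ p) (i ≫ e ≫ p))
          (vcomp rfl rfl (unitCell i) (vcomp rfl (Category.id_comp q) V ψ)) := by
    conv_lhs => rw [← unitCell_lact ψ]
    rw [vcomp_lact (Category.assoc _ _ _) rfl rfl]
    congr 1
    apply toHom_injective
    simp only [toHom_vcomp, Category.assoc]
  constructor
  · intro h Y Z p q L
    rw [← Function.Bijective.of_comp_iff _ (hV p q _ _ rfl (Category.id_comp q) L)]
    convert h p q _ _ rfl rfl L using 1
    funext ψ
    exact (key p q L ψ).symm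
  · intro h Y Z p q r s e₁ e₂ L
    subst e₁ e₂
    convert (h p q L).comp (hV p q _ _ rfl (Category.id_comp q) L) using 1
    funext ψ
    exact key p q L ψ

/-- If `i ⊣ m` then `i_*` also serves as `m^*`. The counit factored through the cartesian cell gives
`o`, the unit pasted onto that cell gives `c`, and each triangle identity becomes one identity of
the pair. -/
theorem IsVAdjunction.exists_isConjointPair {A X : K} {i : A ⟶ X} {m : X ⟶ A}
    {β : VCell (𝟙 A) (i ≫ m)} {ε : VCell (m ≫ i) (𝟙 X)} (h : IsVAdjunction β ε)
    (P : Companion i) :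
    ∃ (o : Cell m (𝟙 X) (unit X) P.hor) (c : Cell (𝟙 A) m P.hor (unit A)),
      IsConjointPair o c ∧ toHom o ≫ toHom P.cart = toHom ε := by
  obtain ⟨o, ho, -⟩ := P.isCartesian m (𝟙 X) _ _ rfl (Category.comp_id _) (unit X) ε
  have ho' := congrArg toHom ho
  rw [toHom_vcomp] at ho'
  refine ⟨o, lact β (vcomp rfl (Category.id_comp m) P.cart (unitCell m)), ⟨?_, ?_⟩, ho'⟩
  · have h1 := vcomp_lact rfl (Category.id_comp m) (Category.comp_id m) (unitCell m) β o
      (vcomp rfl (Category.id_comp m) P.cart (unitCell m))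
    rw [unitCell_lact] at h1
    rw [← toHom_vcomp (Category.comp_id m) (Category.id_comp m), h1]
    refine Eq.trans (toHom_lact_congr rfl ?_) (congrArg toHom h.right_triangle)
    rw [toHom_vcomp, toHom_vcomp, toHom_vcomp, ← Category.assoc, ho']
  · set c : Cell (i ≫ m) m P.hor (unit A) :=
      vcomp rfl (Category.id_comp m) P.cart (unitCell m) with hc
    let c' : Cell ((i ≫ m) ≫ i) (m ≫ i) P.hor (unit X) := vcomp rfl rfl c (unitCell i)
    have h1 : vcomp (Category.id_comp i) rfl (lact β c) (unitCell i) =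
        lact (vcomp (Category.id_comp i) rfl β (unitCell i)) c' := by
      have h := vcomp_lact rfl rfl (Category.id_comp i) β (unitCell i) c (unitCell i)
      rwa [unitCell_lact] at h
    have h2 : vcomp rfl (Category.comp_id _) P.cart ε =
        lact (vcomp rfl (Category.comp_id i) (unitCell i) ε) P.cart := by
      have h3 := vcomp_lact (Category.comp_id i) (Category.comp_id (𝟙 X))
        rfl (unitCell i) ε P.cart (unitCell (𝟙 X))
      rw [unitCell_lact, ← comp_eq_lact, vComp_unitCell, unitCell_id, vcomp_vid] at h3
      exact h3
    have h4 : toHom (below (hcompCell c' ε) (leftUnitor (unit X))) =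
        toHom (onTop (rightUnitor P.hor) (vcomp rfl (Category.comp_id _) P.cart ε)) := by
      have h5 : c' = vcomp (Category.assoc i m i).symm (Category.id_comp _) P.cart
          (unitCell (m ≫ i)) := by
        apply toHom_injective
        simp only [c', hc, toHom_vcomp, ← toHom_unitCell_comp (rfl : m ≫ i = _), Category.assoc]
      have h6 : hcompCell c' ε = vcomp (Category.assoc i m i).symm (Category.id_comp _)
          (hcompCell P.cart (unitCell (𝟙 X))) (hcompCell (unitCell (m ≫ i)) ε) := by
        rw [← hcompCell_vcomp (Category.assoc i m i).symm (Category.id_comp _)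
          (Category.id_comp _), ← h5, unitCell_id, vid_vcomp]
      rw [toHom_below, h6, toHom_vcomp, Category.assoc, toHom_leftUnitor, leftIso_naturality,
        leftIso_unit, reassoc_of% rightIso_naturality, toHom_onTop, toHom_vcomp]
      rfl
    rw [← toHom_leftUnitor, ← toHom_below]
    refine congrArg toHom (P.isCartesian.ext (ψ := rightUnitor P.hor) ?_)
    rw [toHom_below, Category.assoc, toHom_leftUnitor, ← leftIso_naturality, ← Category.assoc,
      toHom_hcompCell_comp (Category.id_comp i) rfl (Category.comp_id _), h1, ho, hcompCell_lact,
      ← toHom_leftUnitor, ← toHom_below, below_lact, ← toHom_onTop]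
    have h7 : lact (vcomp (Category.id_comp i) (Category.assoc i m i) β (unitCell i))
        (onTop (rightUnitor P.hor) (vcomp rfl (Category.comp_id _) P.cart ε)) =
          onTop (rightUnitor P.hor) P.cart := by
      rw [← onTop_lact, h2, ← vComp_lact, h.left_triangle, unitCell_lact]
    rw [← h7]
    exact toHom_lact_congr (by rw [toHom_vcomp, toHom_vcomp]) h4

end Exact

/-! ### The Beck–Chevalley condition as exactness. -/

namespace NormalLaxDoubleMonad

variable {K : Type u} [DoubleCategory.{v, u, w, z} K] {T : NormalLaxDoubleMonad K}

/-- The right Beck-Chevalley condition for a conjoint `g^*`, where the target of `g` is a pseudo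
algebra, in terms of the unitor of the latter. -/
theorem ιStar_isInvertible_iff (hT : T.IsColaxIdempotent) {A M : K} {g : A ⟶ M}
    (𝔪 : T.PseudoAlgebra M) (G : Conjoint g) (P : Companion (T.ιApp M))
    (Q : Companion (T.ιApp A)) (e : g ≫ T.ιApp M ≫ 𝔪.act = T.ιApp A ≫ T.map g ≫ 𝔪.act) :
    (T.ιStar G.hor P Q).IsInvertible ↔
      IsExact (vcomp (Category.comp_id g) e (unitCell g) 𝔪.unitor) := by
  obtain ⟨ε, hε⟩ := 𝔪.exists_isVAdjunction hT
  obtain ⟨v, c, hv, hvε⟩ := hε.exists_isConjointPair P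
  have hG := T.isConjointPair_map G.isConjointPair
  set oT := T.mapFromUnit rfl (T.map_id A) G.opcart with hoT
  have hg : T.ιApp A ≫ T.map g = g ≫ T.ιApp M := (T.ιApp_naturality g).symm
  -- Opcartesian cells `1_A ⇒ g^* ⊙ ι_{A*}` and, next, `1_{TA} ⇒ ι_{M*} ⊙ T g^*`. The latter uses
  -- `ι_{M*}` in its role of conjoint of the action.
  have hO := Q.isCompanionPair.isOpcartesian.comp (e₁ := Category.id_comp g)
    (e₂ := Category.comp_id _) (G.isConjointPair.isOpcartesian_hcompCell Q.hor)
  have hV := hG.isOpcartesian.comp (e₁ := rfl) (e₂ := Category.comp_id _)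
    (hv.isOpcartesian_hcompCell (T.mapHor G.hor))
  rw [hO.isInvertible_iff, ← hV.lact_iff_isExact]
  let x : Cell (g ≫ T.ιApp M) (T.ιApp A) (unit A) (T.mapHor G.hor) :=
    vcomp hg (Category.comp_id _) (unitCell (T.ιApp A)) oT
  let go : Cell g (g ≫ T.ιApp M) (unit A) P.hor :=
    vcomp (Category.comp_id g) rfl (unitCell g) P.opcart
  -- Both conditions assert that this same cell is opcartesian.
  let W : Cell g (T.ιApp A) (unit A) (hcomp P.hor (T.mapHor G.hor)) :=
    onTop (leftUnitorInv (unit A)) (hcompCell go x)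
  have h1 : below (vcomp (Category.id_comp g) (Category.comp_id _) Q.opcart
      (onTop (leftUnitorInv Q.hor) (hcompCell G.opcart (vid Q.hor)))) (T.ιStar G.hor P Q) = W := by
    apply toHom_injective
    have h2 : toHom Q.opcart ≫ (leftIso Q.hor).inv ≫ toHom (hcompCell G.opcart (vid Q.hor)) =
        (leftIso _).inv ≫ toHom (hcompCell G.opcart Q.opcart) := by
      rw [← Category.assoc, ← leftIso_inv_naturality, Category.assoc,
        toHom_hcompCell_comp (Category.id_comp _) (Category.id_comp _) (Category.comp_id _),
        unitCell_id, vid_vcomp, vcomp_vid]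
    have h3 : vcomp (Category.id_comp _) (Category.comp_id _) Q.opcart Q.cart =
        unitCell (T.ιApp A) := by
      apply toHom_injective
      rw [toHom_vcomp]
      exact Q.isCompanionPair.vert
    have h4 : vcomp rfl (Category.id_comp _) G.opcart (T.ιCell G.hor) = x := by
      apply toHom_injective
      rw [toHom_vcomp, ιCell_naturality, ιCell_unit, toHom_vcomp, hoT, toHom_mapFromUnit,
        Category.assoc]
    have h5 : toHom (hcompCell G.opcart Q.opcart) ≫
        (leftIso (hcomp G.hor Q.hor)).inv ≫
          toHom (hcompCell P.opcart (hcompCell (T.ιCell G.hor) Q.cart)) =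
        (leftIso _).inv ≫ toHom (hcompCell go (hcompCell x (unitCell (T.ιApp A)))) := by
      rw [← Category.assoc, ← leftIso_inv_naturality, Category.assoc,
        toHom_hcompCell_comp (Category.comp_id g) rfl (Category.comp_id _),
        ← hcompCell_vcomp rfl (Category.id_comp _) (Category.comp_id _), h3, h4]
    have h6 : toHom (hcompCell go (hcompCell x (unitCell (T.ιApp A)))) ≫
        toHom (hcompCell (vid P.hor) (rightUnitor (T.mapHor G.hor))) =
        toHom (hcompCell (unitCell (𝟙 A)) (rightUnitor (unit A))) ≫ toHom (hcompCell go x) := by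
      rw [toHom_hcompCell_comp (Category.comp_id _) (Category.comp_id _) (Category.comp_id _),
        toHom_hcompCell_comp (Category.id_comp _) (Category.id_comp _) (Category.id_comp _),
        vcomp_vid, unitCell_id, vid_vcomp]
      congr 2
      apply toHom_injective
      rw [toHom_vcomp, toHom_vcomp]
      exact rightIso_naturality x
    rw [toHom_below, toHom_vcomp, toHom_onTop, toHom_leftUnitorInv, h2, ιStar, toHom_onTop,
      toHom_below, Category.assoc, toHom_leftUnitorInv, reassoc_of% h5, h6,
      reassoc_of% leftIso_inv_naturality, toHom_rightUnitor, ← leftIso_unit,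
      Iso.inv_hom_id_assoc, toHom_onTop]
    rfl
  have h2 : lact (vcomp (Category.comp_id g) e (unitCell g) 𝔪.unitor)
      (vcomp rfl (Category.comp_id (T.ιApp A)) (unitCell (T.ιApp A))
        (vcomp rfl (Category.comp_id _) oT
          (onTop (leftUnitorInv (T.mapHor G.hor)) (hcompCell v (vid (T.mapHor G.hor)))))) = W := by
    let v' : Cell (T.ιApp M ≫ 𝔪.act) (T.ιApp M) (unit M) P.hor :=
      vcomp rfl (Category.comp_id _) (unitCell (T.ιApp M)) v
    -- By the left triangle of `ι_M ⊣ m`, pasting the unitor onto the conjoint cell returns the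
    -- companion cell.
    have h3 : lact 𝔪.unitor v' = P.opcart := by
      apply P.isCartesian.ext
      have h4 := vcomp_lact rfl (Category.comp_id _) (Category.id_comp _) 𝔪.unitor
        (unitCell (T.ιApp M)) v' P.cart
      rw [unitCell_lact] at h4
      rw [← toHom_vcomp (Category.id_comp _) (Category.comp_id _), h4,
        P.isCompanionPair.vert]
      refine Eq.trans (toHom_lact_congr (by rw [toHom_vcomp, toHom_vcomp]) ?_)
        (congrArg toHom hε.left_triangle)
      rw [toHom_vcomp, toHom_vcomp, toHom_vcomp, Category.assoc, hvε]
    let gv : Cell (T.ιApp A ≫ T.map g ≫ 𝔪.act) (g ≫ T.ιApp M) (unit A) P.hor :=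
      vcomp e rfl (unitCell g) v'
    have h5 : lact (vcomp (Category.comp_id g) e (unitCell g) 𝔪.unitor) gv = go := by
      have h6 := vcomp_lact e rfl (Category.comp_id g) (unitCell g) 𝔪.unitor (unitCell g) v'
      rw [unitCell_lact, h3] at h6
      exact h6.symm
    have h7 : vcomp rfl (Category.comp_id (T.ιApp A)) (unitCell (T.ιApp A))
        (vcomp rfl (Category.comp_id _) oT
          (onTop (leftUnitorInv (T.mapHor G.hor)) (hcompCell v (vid (T.mapHor G.hor))))) =
        onTop (leftUnitorInv (unit A)) (hcompCell gv x) := by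
      have h8 : toHom gv = toHom (unitCell (g ≫ T.ιApp M)) ≫ toHom v := by
        simp only [gv, v', toHom_vcomp, ← toHom_unitCell_comp (rfl : g ≫ T.ιApp M = _),
          Category.assoc]
      have e' : (g ≫ T.ιApp M) ≫ 𝔪.act = T.ιApp A ≫ T.map g ≫ 𝔪.act := by
        rw [Category.assoc, e]
      have h9 : gv = vcomp e' (Category.comp_id _) (unitCell (g ≫ T.ιApp M)) v :=
        toHom_injective (h8.trans (toHom_vcomp _ _ _ _).symm)
      have h10 : hcompCell gv x = vcomp e' (Category.comp_id _)
          (hcompCell (unitCell (g ≫ T.ιApp M)) x) (hcompCell v (vid _)) := by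
        rw [← hcompCell_vcomp e' (Category.comp_id _) (Category.comp_id _), ← h9, vcomp_vid]
      apply toHom_injective
      rw [h10]
      simp only [toHom_vcomp, toHom_onTop, toHom_leftUnitorInv]
      rw [reassoc_of% leftIso_inv_naturality]
      simp only [x, toHom_vcomp, Category.assoc]
    rw [h7, ← onTop_lact, ← hcompCell_lact, h5]
  rw [h1, h2]

end NormalLaxDoubleMonad
-- Kan extensions in terms of vertical cells; full and faithful morphisms.
section Kan

variable {K : Type u} [DoubleCategory.{v, u, w, z} K]

namespace VCell.IsInvertible

theorem bijective_lact {A B C D : K} {f f' : A ⟶ C} {g : B ⟶ D} {J : Hor A B} {H : Hor C D}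
    {α : VCell f' f} (h : α.IsInvertible) :
    Function.Bijective fun χ : Cell f g J H => lact α χ := by
  obtain ⟨β, h1, h2⟩ := h
  refine Function.bijective_iff_has_inverse.2 ⟨fun χ => lact β χ, fun χ => ?_, fun χ => ?_⟩ <;>
  dsimp only
  · rw [← vComp_lact, h2, unitCell_lact]
  · rw [← vComp_lact, h1, unitCell_lact]

/-- The Yoneda argument: lift the identity of `f`, then cancel `α` to see that the lift is
two-sided. -/
theorem of_bijective {A C : K} {f g : A ⟶ C} {α : VCell f g}
    (h : ∀ k : A ⟶ C, Function.Bijective fun χ : VCell g k => α.comp χ) : α.IsInvertible := by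
  obtain ⟨β, hβ⟩ := (h f).2 (unitCell f)
  refine ⟨β, hβ, (h g).1 ?_⟩
  change α.comp β = _ at hβ
  dsimp only
  rw [← vComp_assoc, hβ, unitCell_vComp, vComp_unitCell]

theorem comp {A C : K} {f g h : A ⟶ C} {α : VCell f g} {β : VCell g h} (hα : α.IsInvertible)
    (hβ : β.IsInvertible) : (α.comp β).IsInvertible := by
  obtain ⟨α', h1, h2⟩ := hα
  obtain ⟨β', h3, h4⟩ := hβ
  refine ⟨β'.comp α', ?_, ?_⟩
  · rw [vComp_assoc, ← vComp_assoc β, h3, unitCell_vComp, h1]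
  · rw [vComp_assoc, ← vComp_assoc α', h2, unitCell_vComp, h4]

theorem vcomp_unitCell {A C E : K} {f g : A ⟶ C} {α : VCell f g} (hα : α.IsInvertible)
    {h : C ⟶ E} {p q : A ⟶ E} (e₁ : f ≫ h = p) (e₂ : g ≫ h = q) :
    VCell.IsInvertible (vcomp e₁ e₂ α (unitCell h)) := by
  obtain ⟨α', h1, h2⟩ := hα
  refine ⟨vcomp e₂ e₁ α' (unitCell h), ?_, ?_⟩
  · rw [← vComp_vcomp_unitCell, h1, DoubleCategory.vcomp_unitCell]
  · rw [← vComp_vcomp_unitCell, h2, DoubleCategory.vcomp_unitCell]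

theorem unitCell_vcomp {A C E : K} {f g : C ⟶ E} {α : VCell f g} (hα : α.IsInvertible)
    {h : A ⟶ C} {p q : A ⟶ E} (e₁ : h ≫ f = p) (e₂ : h ≫ g = q) :
    VCell.IsInvertible (vcomp e₁ e₂ (unitCell h) α) := by
  obtain ⟨α', h1, h2⟩ := hα
  refine ⟨vcomp e₂ e₁ (unitCell h) α', ?_, ?_⟩
  · rw [← unitCell_vcomp_vComp, h1, DoubleCategory.vcomp_unitCell]
  · rw [← unitCell_vcomp_vComp, h2, DoubleCategory.vcomp_unitCell]

end VCell.IsInvertible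

theorem bijective_recast {A B C D : K} {f f' : A ⟶ C} {g g' : B ⟶ D} {J : Hor A B} {H : Hor C D}
    (e₁ : f = f') (e₂ : g = g') :
    Function.Bijective fun φ : Cell f g J H => recast e₁ e₂ φ := by
  subst e₁ e₂
  exact Function.bijective_id

theorem IsExact.bijective {A X M Y Z : K} {f : A ⟶ M} {i : A ⟶ X} {e : X ⟶ M}
    {β : VCell f (i ≫ e)} (hβ : IsExact β) (p : M ⟶ Y) (q : X ⟶ Z) (L : Hor Y Z) {e' : X ⟶ Y}
    {f' : A ⟶ Y} (h₁ : e ≫ p = e') (h₂ : f ≫ p = f') (h₃ : (i ≫ e) ≫ p = i ≫ e') :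
    Function.Bijective fun ψ : Cell e' q (unit X) L =>
      lact (vcomp h₂ h₃ β (unitCell p)) (vcomp rfl rfl (unitCell i) ψ) := by
  subst h₁ h₂
  exact hβ p q L

theorem IsExact.bijective_vComp {A X M : K} {f : A ⟶ M} {i : A ⟶ X} {e : X ⟶ M}
    {β : VCell f (i ≫ e)} (hβ : IsExact β) (k : X ⟶ M) :
    Function.Bijective fun ψ : VCell e k => β.comp (vcomp rfl rfl (unitCell i) ψ) := by
  have h := hβ.bijective (𝟙 M) k (unit M) (Category.comp_id e) (Category.comp_id f)
    (Category.comp_id _)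
  rw [unitCell_id, vcomp_vid] at h
  exact h

/-- Left Kan extensions along a horizontal morphism that is opcartesian over `j`, in terms of
vertical cells. -/
theorem isLeftKan_iff {A B M : K} {d : A ⟶ M} {l : B ⟶ M} {j : A ⟶ B} {J : Hor A B}
    {o : Cell (𝟙 A) j (unit A) J} (ho : IsOpcartesian o) (η : Cell d l J (unit M)) :
    IsLeftKan η ↔ ∀ k : B ⟶ M, Function.Bijective fun ψ : VCell l k =>
      VCell.comp (vcomp (Category.id_comp d) rfl o η) (vcomp rfl rfl (unitCell j) ψ) := by
  refine forall_congr' fun k => ?_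
  rw [← Function.bijective_iff_existsUnique,
    ← Function.Bijective.of_comp_iff' (ho d k _ _ (Category.id_comp d) rfl (unit M))]
  have h (ψ : VCell l k) : vcomp (Category.id_comp d) rfl o
      (onTop (rightUnitorInv J) (below (hcompCell η ψ) (leftUnitor (unit M)))) =
      VCell.comp (vcomp (Category.id_comp d) rfl o η) (vcomp rfl rfl (unitCell j) ψ) := by
    apply toHom_injective
    rw [comp_eq_lact, toHom_lact, toHom_vcomp, toHom_onTop, toHom_below, toHom_rightUnitorInv,
      ← reassoc_of% rightIso_inv_naturality, ← Category.assoc (toHom _) (toHom _),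
      toHom_hcompCell_comp (Category.id_comp d) rfl rfl, leftIso_unit A]
    rfl
  have h' : (fun ψ => vcomp (Category.id_comp d) rfl o ψ) ∘ (fun ψ : VCell l k =>
      onTop (rightUnitorInv J) (below (hcompCell η ψ) (leftUnitor (unit M)))) = fun ψ =>
      VCell.comp (vcomp (Category.id_comp d) rfl o η) (vcomp rfl rfl (unitCell j) ψ) :=
    funext h
  rw [h']

/-- The pointwise property tested on the horizontal unit of `B`. -/
theorem IsPointwiseLeftKan.isLeftKan {A B M : K} {d : A ⟶ M} {l : B ⟶ M} {J : Hor A B}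
    {η : Cell d l J (unit M)} (hη : IsPointwiseLeftKan η) : IsLeftKan η := by
  intro k φ
  have h (ψ : VCell l k) : onTop (rightUnitorInv J)
      (below (hcompCell η ψ) (leftUnitor (unit M))) = φ ↔
      below (hcompCell η ψ) (leftUnitor (unit M)) = onTop (rightUnitor J) φ := by
    constructor
    · rintro rfl
      apply toHom_injective
      rw [toHom_onTop, toHom_onTop, toHom_rightUnitor, toHom_rightUnitorInv,
        Iso.hom_inv_id_assoc]
    · intro e
      rw [e]
      apply toHom_injective
      rw [toHom_onTop, toHom_onTop, toHom_rightUnitor, toHom_rightUnitorInv,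
        Iso.inv_hom_id_assoc]
  simp only [h]
  exact hη (unit B) k _

/-- The composite of the companion and the conjoint of a full and faithful morphism is a unit. -/
theorem IsFullFaithful.hcompCell_opcart_isInvertible {A B : K} {j : A ⟶ B}
    (hj : IsFullFaithful j) (F : Companion j) (G : Conjoint j) :
    HCell.IsInvertible (hcompCell F.opcart G.opcart) := by
  set o : HCell (hcomp (unit A) (unit A)) (hcomp F.hor G.hor) := hcompCell F.opcart G.opcart
  let c : Cell j j (hcomp F.hor G.hor) (unit B) :=
    below (hcompCell F.cart G.cart) (leftUnitor (unit B))
  -- Full faithfulness factors `j_* ⊙ j^* ⇒ 1_B` through the unit cell of `j`; up to a unitor this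
  -- is the inverse.
  obtain ⟨u, hu, -⟩ := hj (𝟙 A) (𝟙 A) j j (Category.id_comp j) (Category.id_comp j) _ c
  have hu' := congrArg toHom hu
  rw [toHom_vcomp] at hu'
  have hoc : toHom o ≫ toHom c = toHom (leftUnitor (unit A)) ≫ toHom (unitCell j) := by
    have h1 : vcomp (Category.id_comp j) (Category.comp_id j) F.opcart F.cart = unitCell j :=
      toHom_injective ((toHom_vcomp _ _ _ _).trans F.isCompanionPair.vert)
    have h2 : vcomp (Category.comp_id j) (Category.id_comp j) G.opcart G.cart = unitCell j :=
      toHom_injective ((toHom_vcomp _ _ _ _).trans G.isConjointPair.vert)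
    rw [toHom_below, ← Category.assoc, toHom_hcompCell_comp (Category.id_comp j)
      (Category.comp_id _) (Category.id_comp j), toHom_leftUnitor, toHom_leftUnitor,
      ← leftIso_naturality, h1, h2]
  have hou : toHom o ≫ toHom u = toHom (leftUnitor (unit A)) := by
    rw [← toHom_vcomp (Category.id_comp _) (Category.id_comp _)]
    refine congrArg toHom (hj.ext ?_)
    rw [toHom_vcomp, Category.assoc, hu', hoc]
  refine ⟨HCell.comp u (leftUnitorInv _), ?_, ?_⟩
  · apply toHom_injective
    rw [toHom_hcellComp, toHom_hcellComp, ← Category.assoc, hou, toHom_leftUnitor,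
      toHom_leftUnitorInv, Iso.hom_inv_id, toHom_vid]
  -- The cell `c` can be cancelled in two stages, first the cartesian cell of the conjoint and then
  -- that of the companion.
  · have h1 (χ : HCell (hcomp F.hor G.hor) (hcomp F.hor G.hor))
        (h : toHom χ ≫ toHom c = toHom c) : χ = vid _ := by
      apply F.isCompanionPair.hcompCell_ext
      have h2 : toHom c = toHom (below (hcompCell F.cart (vid G.hor)) (leftUnitor G.hor)) ≫
          toHom G.cart := by
        rw [toHom_below, toHom_below, Category.assoc, toHom_leftUnitor G.hor,
          ← leftIso_naturality, ← Category.assoc, toHom_hcompCell_comp (Category.comp_id _)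
            (Category.id_comp _) (Category.id_comp _), vid_vcomp, unitCell_id, vcomp_vid]
        rfl
      have h3 : vcomp (Category.id_comp j) (Category.id_comp _) χ
          (below (hcompCell F.cart (vid G.hor)) (leftUnitor G.hor)) =
            below (hcompCell F.cart (vid G.hor)) (leftUnitor G.hor) := by
        apply G.isCartesian.ext
        rw [toHom_vcomp, Category.assoc, ← h2, h]
      have h4 := congrArg toHom h3
      rw [toHom_vcomp, toHom_below, ← Category.assoc, toHom_leftUnitor, cancel_mono] at h4
      rw [h4, toHom_vid, Category.id_comp]
    apply h1
    rw [toHom_hcellComp, toHom_hcellComp, Category.assoc, hoc, Category.assoc, toHom_leftUnitor,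
      toHom_leftUnitorInv, Iso.inv_hom_id_assoc, hu']

/-- The cell defining a pointwise left Kan extension along the companion of a full and faithful
morphism is invertible. -/
theorem IsPointwiseLeftKan.isInvertible_of_isFullFaithful {A B M : K} {d : A ⟶ M} {l : B ⟶ M}
    {j : A ⟶ B} {F : Companion j} {η : Cell d l F.hor (unit M)} (hη : IsPointwiseLeftKan η)
    (hj : IsFullFaithful j) (G : Conjoint j) :
    VCell.IsInvertible (vcomp (Category.id_comp d) rfl F.opcart η) := by
  refine .of_bijective fun k => ?_
  -- Three bijections: cells out of `j_* ⊙ j^*` are cells out of `d`; by pointwiseness they are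
  -- cells out of `j^*` with left boundary `l`; and these are cells out of `l ∘ j`.
  have ho := (leftUnitorInv_isInvertible (unit A)).isOpcartesian.comp
    (e₁ := Category.id_comp _) (e₂ := Category.id_comp _)
    (hj.hcompCell_opcart_isInvertible F G).isOpcartesian
  have h1 := ho d k d k (Category.id_comp d) (Category.id_comp k) (unit M)
  have h2 : Function.Bijective fun ψ : Cell l k G.hor (unit M) =>
      below (hcompCell η ψ) (leftUnitor (unit M)) :=
    (Function.bijective_iff_existsUnique _).2 (hη G.hor k)
  have h3 := G.isConjointPair.isOpcartesian l k (j ≫ l) k rfl (Category.id_comp k) (unit M)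
  rw [← Function.Bijective.of_comp_iff _ h3]
  convert h1.comp h2 using 1
  funext ψ
  apply toHom_injective
  simp only [Function.comp_apply]
  rw [comp_eq_lact, toHom_lact, toHom_vcomp, toHom_vcomp, toHom_below, Category.assoc,
    ← Category.assoc (toHom (hcompCell _ _)), toHom_hcompCell_comp (Category.id_comp d) rfl
      (Category.id_comp k)]
  rfl

end Kan

/-! ### Stability of exactness. -/

section Transfer

variable {K : Type u} [DoubleCategory.{v, u, w, z} K]

/-- Absoluteness: the test morphism `p` is replaced by its composite with `l`. -/
theorem IsExact.vcomp_unitCell {A X M N : K} {f : A ⟶ M} {i : A ⟶ X} {e : X ⟶ M}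
    {β : VCell f (i ≫ e)} (hβ : IsExact β) (l : M ⟶ N) :
    IsExact (vcomp rfl (Category.assoc i e l) β (unitCell l) : VCell (f ≫ l) (i ≫ e ≫ l)) := by
  intro Y Z p q L
  convert hβ.bijective (l ≫ p) q L (Category.assoc e l p).symm (Category.assoc f l p).symm
    (by simp only [Category.assoc]) using 1
  funext ψ
  congr 1
  apply toHom_injective
  simp only [toHom_vcomp, Category.assoc, toHom_unitCell_comp rfl]

/-- Exactness is invariant under isomorphism. -/
theorem IsExact.of_isInvertible {A X M : K} {f f' : A ⟶ M} {i : A ⟶ X} {e e' : X ⟶ M}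
    {β : VCell f (i ≫ e)} {β' : VCell f' (i ≫ e')} (hβ' : IsExact β') {α : VCell f' f}
    {κ : VCell e' e} (hα : α.IsInvertible) (hκ : κ.IsInvertible)
    (h : α.comp β = β'.comp (vcomp rfl rfl (unitCell i) κ)) : IsExact β := by
  intro Y Z p q L
  rw [← Function.Bijective.of_comp_iff' (hα.vcomp_unitCell rfl rfl :
    VCell.IsInvertible (vcomp rfl rfl α (unitCell p) : VCell (f' ≫ p) (f ≫ p))).bijective_lact]
  convert (hβ' p q L).comp (hκ.vcomp_unitCell rfl rfl :
    VCell.IsInvertible (vcomp rfl rfl κ (unitCell p) : VCell (e' ≫ p) (e ≫ p))).bijective_lact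
    using 1
  funext ψ
  simp only [Function.comp_apply]
  have h1 := vcomp_lact (rfl : i ≫ e ≫ p = _) (rfl : i ≫ q = _) (rfl : i ≫ e' ≫ p = _)
    (unitCell i) (vcomp rfl rfl κ (unitCell p) : VCell (e' ≫ p) (e ≫ p)) (unitCell i) ψ
  rw [unitCell_lact] at h1
  rw [h1, ← vComp_lact, ← vComp_lact, ← vComp_vcomp_unitCell, h]
  congr 1
  rw [vComp_vcomp_unitCell rfl (Category.assoc _ _ _) (Category.assoc _ _ _)]
  congr 1
  apply toHom_injective
  simp only [toHom_vcomp, Category.assoc]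

end Transfer

/-! ### The comparison square of Kan extensions and colax structures. -/

namespace NormalLaxDoubleMonad

variable {K : Type u} [DoubleCategory.{v, u, w, z} K] {T : NormalLaxDoubleMonad K}

/-- The cell `f ⇒ m ∘ ι ∘ f = m ∘ T f ∘ ι` induced by the unitor of a pseudo algebra. -/
def PseudoAlgebra.unitorAt {A M : K} (𝔪 : T.PseudoAlgebra M) (f : A ⟶ M) :
    VCell f (T.ιApp A ≫ T.map f ≫ 𝔪.act) :=
  vcomp (Category.comp_id f) (by rw [← Category.assoc, T.ιApp_naturality, Category.assoc])
    (unitCell f) 𝔪.unitor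

theorem PseudoAlgebra.toHom_unitorAt_comp {A B M : K} (𝔪 : T.PseudoAlgebra M) (j : A ⟶ B)
    (l : B ⟶ M) :
    toHom (𝔪.unitorAt (j ≫ l)) = toHom (unitCell j) ≫ toHom (𝔪.unitorAt l) := by
  simp only [PseudoAlgebra.unitorAt, toHom_vcomp, ← toHom_unitCell_comp (rfl : j ≫ l = _),
    Category.assoc]

theorem PseudoAlgebra.unitorAt_naturality {A M : K} (𝔪 : T.PseudoAlgebra M) {f g : A ⟶ M}
    (φ : VCell f g) :
    (𝔪.unitorAt f).comp (vcomp rfl rfl (unitCell (T.ιApp A))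
      (vcomp rfl rfl (T.mapVCell φ) (unitCell 𝔪.act))) = φ.comp (𝔪.unitorAt g) := by
  have e (f : A ⟶ M) : f ≫ T.ιApp M ≫ 𝔪.act = T.ιApp A ≫ T.map f ≫ 𝔪.act := by
    rw [← Category.assoc, T.ιApp_naturality, Category.assoc]
  have h1 : vcomp rfl rfl (unitCell (T.ιApp A))
      (vcomp rfl rfl (T.mapVCell φ) (unitCell 𝔪.act)) =
        vcomp (e f) (e g) φ (unitCell (T.ιApp M ≫ 𝔪.act)) := by
    apply toHom_injective
    rw [toHom_vcomp, toHom_vcomp, toHom_vcomp, ← toHom_unitCell_comp (rfl : T.ιApp M ≫ _ = _),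
      ← Category.assoc, ← Category.assoc, ιApp_naturality_vCell]
  have h2 : vcomp (Category.comp_id f) (Category.comp_id g) φ (unitCell (𝟙 M)) = φ := by
    rw [unitCell_id, vcomp_vid]
  conv_rhs => rw [← h2]
  rw [h1, unitorAt, unitorAt, vcomp_exchange', vcomp_exchange]

/-- Unitality identifies the mate of `lbar` with the unitor at `l`, and mates are natural in the
target. -/
theorem IsColaxMorphism.unitorAt_comp {B M : K} {𝔟 : T.PseudoAlgebra B}
    {𝔪 : T.PseudoAlgebra M} {l : B ⟶ M} {lbar : VCell (𝔟.act ≫ l) (T.map l ≫ 𝔪.act)}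
    (hl : IsColaxMorphism 𝔟 𝔪 l lbar) {k : T.obj B ⟶ M} (ψ : VCell (T.map l ≫ 𝔪.act) k) :
    VCell.comp (vcomp (Category.id_comp l) (Category.assoc _ _ _) 𝔟.unitor (unitCell l))
      (vcomp rfl rfl (unitCell (T.ιApp B)) (lbar.comp ψ)) =
    (𝔪.unitorAt l).comp (vcomp rfl rfl (unitCell (T.ιApp B)) ψ) := by
  rw [unitCell_vcomp_vComp rfl rfl rfl, ← vComp_assoc, (unitality_iff 𝔟 𝔪 l lbar).1 hl.unitality]
  rfl

/-- The square that compares the universal properties of `η`, of its image under `T`, and of the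
unitors of the algebras. -/
theorem toHom_unitorAt_square {A B M : K} {𝔟 : T.PseudoAlgebra B}
    {𝔪 : T.PseudoAlgebra M} {j : A ⟶ B} {d : A ⟶ M} {l : B ⟶ M}
    {lbar : VCell (𝔟.act ≫ l) (T.map l ≫ 𝔪.act)} (hl : IsColaxMorphism 𝔟 𝔪 l lbar)
    {η : VCell d (j ≫ l)} {θ : VCell (T.map d ≫ 𝔪.act) (T.map j ≫ T.map l ≫ 𝔪.act)}
    (hθ : toHom θ = toHom (T.mapVCell η) ≫ toHom (unitCell 𝔪.act)) {k : T.obj B ⟶ M}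
    (ψ : VCell (T.map l ≫ 𝔪.act) k) :
    toHom ((𝔪.unitorAt d).comp (vcomp rfl rfl (unitCell (T.ιApp A))
      (θ.comp (vcomp rfl rfl (unitCell (T.map j)) ψ)))) =
    toHom (η.comp (vcomp rfl rfl (unitCell j)
      (VCell.comp (vcomp (Category.id_comp l) (Category.assoc _ _ _) 𝔟.unitor (unitCell l))
        (vcomp rfl rfl (unitCell (T.ιApp B)) (lbar.comp ψ))))) := by
  rw [hl.unitorAt_comp, unitCell_vcomp_vComp rfl rfl rfl, unitCell_vcomp_vComp rfl rfl rfl,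
    ← vComp_assoc, ← vComp_assoc]
  -- The first factors agree by naturality of the unitor at `η`, the second by naturality of `ι` at
  -- `j`.
  refine toHom_vComp_congr ?_ ?_
  · have h := congrArg toHom (𝔪.unitorAt_naturality η)
    refine Eq.trans (toHom_vComp_congr rfl ?_) (h.trans (toHom_vComp_congr rfl ?_))
    · rw [toHom_vcomp, toHom_vcomp, toHom_vcomp, hθ]
    · rw [𝔪.toHom_unitorAt_comp, toHom_vcomp]
  · simp only [toHom_vcomp, ← Category.assoc]
    rw [toHom_unitCell_comp (T.ιApp_naturality j).symm, toHom_unitCell_comp rfl]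

/-- Composition with `θ` is bijective if and only if composition with the structure cell of `l`
is. -/
theorem bijective_iff_of_square {A B M : K} (hT : T.IsColaxIdempotent) {𝔟 : T.PseudoAlgebra B}
    {𝔪 : T.PseudoAlgebra M} {j : A ⟶ B} {d : A ⟶ M} {l : B ⟶ M}
    {lbar : VCell (𝔟.act ≫ l) (T.map l ≫ 𝔪.act)} (hl : IsColaxMorphism 𝔟 𝔪 l lbar)
    {η : VCell d (j ≫ l)} {θ : VCell (T.map d ≫ 𝔪.act) (T.map j ≫ T.map l ≫ 𝔪.act)}
    (hθ : toHom θ = toHom (T.mapVCell η) ≫ toHom (unitCell 𝔪.act))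
    (hη : ∀ k : B ⟶ M, Function.Bijective fun χ : VCell l k =>
      η.comp (vcomp rfl rfl (unitCell j) χ))
    (hd : IsExact (𝔪.unitorAt d)) (k : T.obj B ⟶ M) :
    (Function.Bijective fun ψ : VCell (T.map l ≫ 𝔪.act) k =>
      θ.comp (vcomp rfl rfl (unitCell (T.map j)) ψ)) ↔
    Function.Bijective fun ψ : VCell (T.map l ≫ 𝔪.act) k => lbar.comp ψ := by
  obtain ⟨ε, hε⟩ := 𝔟.exists_isVAdjunction hT
  have e : T.ιApp A ≫ T.map j ≫ k = j ≫ T.ιApp B ≫ k := by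
    rw [← Category.assoc, ← T.ιApp_naturality, Category.assoc]
  -- Each side is extended by known bijections until it is one way round the square: `lbar` by mates
  -- and `η`, `θ` by exactness at `d`. The recast reconciles `k ∘ Tj ∘ ι_A` with `k ∘ ι_B ∘ j`.
  rw [← Function.Bijective.of_comp_iff' (hε.bijective l k),
    ← Function.Bijective.of_comp_iff' (hη (T.ιApp B ≫ k)),
    ← Function.Bijective.of_comp_iff' (hd.bijective_vComp (T.map j ≫ k)),
    ← Function.Bijective.of_comp_iff' (bijective_recast (rfl : d = d) e)]
  refine iff_of_eq (congrArg _ (funext fun ψ => toHom_injective ?_))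
  exact (toHom_recast (rfl : d = d) e _).trans (toHom_unitorAt_square hl hθ ψ)

/-- If `η` and the structure cell of `l` are invertible, then exactness of the unitor at `j`
implies exactness of the unitor at `d`. -/
theorem IsExact.unitorAt_of_isInvertible {A B M : K} {𝔟 : T.PseudoAlgebra B}
    {𝔪 : T.PseudoAlgebra M} {j : A ⟶ B} {d : A ⟶ M} {l : B ⟶ M}
    {lbar : VCell (𝔟.act ≫ l) (T.map l ≫ 𝔪.act)} (hl : IsColaxMorphism 𝔟 𝔪 l lbar)
    (hlbar : lbar.IsInvertible) {η : VCell d (j ≫ l)} (hη : η.IsInvertible)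
    (hj : IsExact (𝔟.unitorAt j)) : IsExact (𝔪.unitorAt d) := by
  obtain ⟨ζ, h1, h2⟩ := hη
  have e : T.map (j ≫ l) ≫ 𝔪.act = T.map j ≫ T.map l ≫ 𝔪.act := by
    rw [T.map_comp, Category.assoc]
  have hζ : (T.mapVCell ζ).IsInvertible := by
    refine ⟨T.mapVCell η, ?_, ?_⟩ <;> apply toHom_injective <;>
      rw [← mapVCell_vComp]
    · rw [h2, toHom_mapVCell_unitCell]
    · rw [h1, toHom_mapVCell_unitCell]
  -- The isomorphism `l ∘ b ∘ Tj ≅ m ∘ Tl ∘ Tj ≅ m ∘ Td` between the two extensions along `ι_A`.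
  have hκ := (hlbar.unitCell_vcomp (h := T.map j) (Category.assoc _ _ _).symm rfl).comp
    (hζ.vcomp_unitCell e (rfl : T.map d ≫ 𝔪.act = _))
  refine (hj.vcomp_unitCell l).of_isInvertible (α := ζ) ⟨η, h2, h1⟩ hκ ?_
  rw [unitCell_vcomp_vComp rfl rfl rfl, ← vComp_assoc, ← 𝔪.unitorAt_naturality ζ]
  apply toHom_injective
  refine toHom_vComp_congr ?_ ?_
  · have h := congrArg (fun χ => toHom (unitCell j) ≫ toHom χ)
      ((unitality_iff 𝔟 𝔪 l lbar).1 hl.unitality)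
    rw [𝔪.toHom_unitorAt_comp]
    refine h.symm.trans ?_
    rw [← toHom_vcomp rfl rfl, unitCell_vcomp_vComp rfl rfl rfl]
    refine toHom_vComp_congr ?_ ?_
    · simp only [PseudoAlgebra.unitorAt, toHom_vcomp, Category.assoc]
    · simp only [toHom_vcomp, ← Category.assoc]
      rw [toHom_unitCell_comp (T.ιApp_naturality j), toHom_unitCell_comp rfl]
  · simp only [toHom_vcomp]

end NormalLaxDoubleMonad

end DoubleCategory

/-! ### The theorem. -/

open DoubleCategory NormalLaxDoubleMonad in
theorem mainTheorem2 {K : Type u} [DoubleCategory.{v, u, w, z} K]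
    (hK : DoubleCategory.IsEquipment K) (T : DoubleCategory.NormalLaxDoubleMonad K)
    (hT : T.IsColaxIdempotent) {A B M : K} (j : A ⟶ B) (d : A ⟶ M) (l : B ⟶ M)
    (jCompanion : DoubleCategory.Companion j) (jConjoint : DoubleCategory.Conjoint j)
    (dConjoint : DoubleCategory.Conjoint d)
    (η : DoubleCategory.Cell d l jCompanion.hor (DoubleCategory.unit M))
    (hη : DoubleCategory.IsPointwiseLeftKan η)
    (𝔟 : T.PseudoAlgebra B) (𝔪 : T.PseudoAlgebra M) :
    ∃ lbar : DoubleCategory.VCell (𝔟.act ≫ l) (T.map l ≫ 𝔪.act),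
      (DoubleCategory.NormalLaxDoubleMonad.IsColaxMorphism 𝔟 𝔪 l lbar ∧
        ∀ φ : DoubleCategory.VCell (𝔟.act ≫ l) (T.map l ≫ 𝔪.act),
          DoubleCategory.NormalLaxDoubleMonad.IsColaxMorphism 𝔟 𝔪 l φ → φ = lbar) ∧
      (T.RightBeckChevalley dConjoint.hor →
        DoubleCategory.IsLeftKan (DoubleCategory.vcomp rfl rfl (T.mapToUnit η)
          (DoubleCategory.unitCell 𝔪.act)) →
        lbar.IsInvertible) ∧
      (DoubleCategory.IsFullFaithful j → T.RightBeckChevalley jConjoint.hor →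
        lbar.IsInvertible →
        T.RightBeckChevalley dConjoint.hor ∧
          DoubleCategory.IsLeftKan (DoubleCategory.vcomp rfl rfl (T.mapToUnit η)
            (DoubleCategory.unitCell 𝔪.act))) := by
  obtain ⟨lbar, hl, hu⟩ := existsUnique_isColaxMorphism hT 𝔟 𝔪 l
  have companion {X Y : K} (f : X ⟶ Y) : Nonempty (Companion f) := by
    obtain ⟨J, c, hc⟩ := hK f (𝟙 Y) (unit Y)
    exact ⟨⟨J, c, hc⟩⟩
  have exact_of {X Y : K} {f : X ⟶ Y} (𝔶 : T.PseudoAlgebra Y) (G : Conjoint f)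
      (h : T.RightBeckChevalley G.hor) : IsExact (𝔶.unitorAt f) := by
    obtain ⟨P⟩ := companion (T.ιApp Y)
    obtain ⟨Q⟩ := companion (T.ιApp X)
    exact (ιStar_isInvertible_iff hT 𝔶 G P Q _).1 (h P Q)
  -- Restriction along opcartesian cells replaces `η` and `1_m ∘ Tη` by vertical cells `η'` and `θ`.
  -- As `T` preserves the companion pair of `j`, the cell `θ` is `T` of `η'` whiskered with `m`.
  let η' : VCell d (j ≫ l) := vcomp (Category.id_comp d) rfl jCompanion.opcart η
  let o := T.mapFromUnit (T.map_id A) rfl jCompanion.opcart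
  have ho : IsOpcartesian o := (T.isCompanionPair_map jCompanion.isCompanionPair).isOpcartesian
  let ηT := vcomp rfl rfl (T.mapToUnit η) (unitCell 𝔪.act)
  let θ : VCell (T.map d ≫ 𝔪.act) (T.map j ≫ T.map l ≫ 𝔪.act) :=
    vcomp (Category.id_comp _) rfl o ηT
  have hθ : toHom θ = toHom (T.mapVCell η') ≫ toHom (unitCell 𝔪.act) := by
    rw [toHom_vcomp, toHom_vcomp, toHom_mapVCell, toHom_mapFromUnit, toHom_mapToUnit,
      toHom_vcomp, hmap_comp]
    simp only [Category.assoc]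
  have hη' := (isLeftKan_iff jCompanion.isCompanionPair.isOpcartesian η).1 hη.isLeftKan
  have square := bijective_iff_of_square hT hl hθ hη'
  refine ⟨lbar, ⟨hl, hu⟩, fun hd hkan => ?_, fun hj hbc hlbar => ?_⟩
  · exact .of_bijective fun k =>
      (square (exact_of 𝔪 dConjoint hd) k).1 ((isLeftKan_iff ho ηT).1 hkan k)
  · have hd := IsExact.unitorAt_of_isInvertible hl hlbar
      (hη.isInvertible_of_isFullFaithful hj jConjoint) (exact_of 𝔟 jConjoint hbc)
    exact ⟨fun P Q => (ιStar_isInvertible_iff hT 𝔪 dConjoint P Q _).2 hd,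
      (isLeftKan_iff ho ηT).2 fun k => (square hd k).2 hlbar.bijective_lact⟩
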